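/- Let $(M,g)$ be a compact Riemannian surface with smooth, strictly convex boundary which is non-trapping (every geodesic leaves $M$ in finite time) and given in a global isothermal chart: $M\subset\mathbb{R}^2$, $g=e^{2\lambda}(dx^2+dy^2)$ with $\lambda$ smooth up to the boundary; this includes all simple surfaces. Let $SM=\{(\mathrm{x},\theta):\mathrm{x}\in M,\ \theta\in\mathbb{R}/2\pi\mathbb{Z}\}$ be the unit circle bundle, with volume form $d\Sigma^3=e^{2\lambda}\,dx\,dy\,d\theta$ and inner product $(u,v)=\int_{SM}u\bar v\,d\Sigma^3$. Let $X$ be the generator of the geodesic flow $\varphi_t$, let $V=\partial_\theta$ and $$X_\perp=[X,V]=-e^{-\lambda}\left(-\sin\theta\,\partial_x+\cos\theta\,\partial_y-(\cos\theta\,\partial_x\lambda+\sin\theta\,\partial_y\lambda)\,\partial_\theta\right).$$ For a function $u$ on $SM$ and $k\in\mathbb{Z}$ let $u_k(\mathrm{x},\theta)=\frac{e^{ik\theta}}{2\pi}\int_0^{2\pi}u(\mathrm{x},\theta')e^{-ik\theta'}\,d\theta'$. Let $\Omega_k=\ker(\partial_\theta-ik)\cap C^\infty(SM)$, and let $H_k$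 be the closure in $L^2(SM)$ of $e^{ik\theta}C_0^\infty(M)$, the set of elements of $\Omega_k$ with compact support in the interior of $M$. For $f$ continuous on $SM$ let $u^f(\mathrm{x},\theta)=\int_0^{\tau(\mathrm{x},\theta)}f(\varphi_t(\mathrm{x},\theta))\,dt$, where $\tau$ is the exit time. Put $$W_kf=(X_\perp u^f)_k\quad(f\in\Omega_k),\qquad W_k^\star h=(u^{X_\perp h})_k\quad(h\in\Omega_k,\ h|_{\partial M}=0).$$ **Proposition.** For every $k\in\mathbb{Z}$, the operator $W_k^\star$ is the adjoint of $W_k$ in $H_k\subset L^2(SM)$. Precisely: 1. For $f$ continuous on $SM$, $u^f$ is the unique solution of $Xu=-f$ on $SM$ with $u=0$ on $\partial_-SM=\{(\mathrm{x},\theta):\mathrm{x}\in\partial M,\ v\cdot\nu\le 0\}$, where $v$ is the unit vector at $\mathrm{x}$ of angle $\theta$, $\nu$ is the inner unit normal and $X$ is understood as differentiation along the orbits of the geodesic flow. 2. If $f\in\Omega_k$, then $u^f$ is differentiable over the interior of $M$, $X_\perp u^f$ is continuous on each circle over an interior point, and $f$ and $W_kf$ belong to $H_k$. If $h\in\Omega_k$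 and $h|_{\partial M}=0$, then $u^{X_\perp h}$ is continuous on each circle over an interior point, and $W_k^\star h$ belongs to $H_k$. 3. For all $f\in\Omega_k$ and all $h\in\Omega_k$ with $h|_{\partial M}=0$, the products $f\,\overline{W_k^\star h}$ and $(W_kf)\,\bar h$ are integrable on $SM$ and $$(f,W_k^\star h)=(W_kf,h).$$ 4. If $T$ is a bounded operator on $H_k$ with $Tf=W_kf$ for all $f\in e^{ik\theta}C_0^\infty(M)$, then its Hilbert space adjoint satisfies $T^*h=W_k^\star h$ for all $h\in\Omega_k$ with $h|_{\partial M}=0$. -/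

import Mathlib

open MeasureTheory Set
open scoped ContDiff

noncomputable section

/-- A compact Riemannian surface with smooth boundary in a global isothermal chart:
`M = {ρ ≥ 0} ⊆ ℝ²` is compact, `0` is a regular value of the boundary defining function `ρ`, and
the metric is `e^{2λ} (dx² + dy²)`. (A function that is smooth up to the boundary of `M` has a smooth
extension to the plane, so `λ` is taken smooth on the plane.) -/
structure IsothermalSurface where
  rho : ℝ × ℝ → ℝ
  lam : ℝ × ℝ → ℝ
  rho_smooth : ContDiff ℝ ∞ rho
  lam_smooth : ContDiff ℝ ∞ lam
  isCompact : IsCompact {x | 0 ≤ rho x}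
  regular : ∀ x, rho x = 0 → fderiv ℝ rho x ≠ 0

/-- Points `((x, y), θ)`: a base point and the angle of a unit tangent vector. Functions on the unit
circle bundle are functions of these coordinates, `2π`-periodic in `θ`. -/
abbrev PhasePoint : Type := (ℝ × ℝ) × ℝ

namespace IsothermalSurface

variable (S : IsothermalSurface)

/-- The surface `M` as a subset of the chart. -/
def carrier : Set (ℝ × ℝ) := {x | 0 ≤ S.rho x}

/-- The interior of `M`. -/
def inner : Set (ℝ × ℝ) := {x | 0 < S.rho x}

/-- The boundary of `M`. -/
def bdry : Set (ℝ × ℝ) := {x | S.rho x = 0}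

/-- The unit circle bundle `SM` in the coordinates `((x, y), θ)`. -/
def SM : Set PhasePoint := {p | p.1 ∈ S.carrier}

/-- `∂ₓ λ`. -/
def lamX (x : ℝ × ℝ) : ℝ := fderiv ℝ S.lam x (1, 0)

/-- `∂_y λ`. -/
def lamY (x : ℝ × ℝ) : ℝ := fderiv ℝ S.lam x (0, 1)

/-- The geodesic vector field
`X = e^{-λ} (cos θ ∂ₓ + sin θ ∂_y + (- sin θ ∂ₓλ + cos θ ∂_yλ) ∂_θ)`. -/
def geodesicField (p : PhasePoint) : PhasePoint :=
  Real.exp (-S.lam p.1) • ((Real.cos p.2, Real.sin p.2),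
    -Real.sin p.2 * S.lamX p.1 + Real.cos p.2 * S.lamY p.1)

/-- The transverse vector field `X_⊥ = [X, ∂_θ]`, that is,
`X_⊥ = - e^{-λ} (- sin θ ∂ₓ + cos θ ∂_y - (cos θ ∂ₓλ + sin θ ∂_yλ) ∂_θ)`. -/
def transverseField (p : PhasePoint) : PhasePoint :=
  (-Real.exp (-S.lam p.1)) • ((-Real.sin p.2, Real.cos p.2),
    -(Real.cos p.2 * S.lamX p.1 + Real.sin p.2 * S.lamY p.1))

/-- The operator `X_⊥` on functions on `SM`. -/
def Xperp (u : PhasePoint → ℂ) (p : PhasePoint) : ℂ :=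
  fderivWithin ℝ u S.SM p (S.transverseField p)

/-- The vertical derivative `V = ∂_θ` of functions on `SM`. -/
def vert (u : PhasePoint → ℂ) (p : PhasePoint) : ℂ :=
  fderivWithin ℝ u S.SM p (0, 1)

/-- The derivative along `X` of a function that is defined on the whole of `ℝ² × ℝ`. -/
def lieX (u : PhasePoint → ℝ) (p : PhasePoint) : ℝ :=
  fderiv ℝ u p (S.geodesicField p)

/-- The boundary defining function, lifted to phase space. -/
def rhoLift (p : PhasePoint) : ℝ := S.rho p.1

/-- `γ` is, on `[0, T]`, an orbit of the geodesic flow that starts at `p` and lies over `M`. -/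
def IsGeodesicArc (p : PhasePoint) (T : ℝ) (γ : ℝ → PhasePoint) : Prop :=
  γ 0 = p ∧ (∀ t ∈ Icc 0 T, γ t ∈ S.SM) ∧
    ∀ t ∈ Icc 0 T, HasDerivWithinAt γ (S.geodesicField (γ t)) (Icc 0 T) t

/-- The lengths of the geodesic arcs in `M` with initial condition `p`. -/
def arcLengths (p : PhasePoint) : Set ℝ := {T | 0 ≤ T ∧ ∃ γ, S.IsGeodesicArc p T γ}

/-- Non-trapping: no geodesic stays in `M` for ever. -/
def NonTrapping : Prop := ∀ p ∈ S.SM, BddAbove (S.arcLengths p)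

/-- Strictly convex boundary: `X² ρ = Hess ρ (v, v) < 0` for the unit vectors `v` tangent to `∂M`. -/
def StrictlyConvexBoundary : Prop :=
  ∀ p : PhasePoint, p.1 ∈ S.bdry → S.lieX S.rhoLift p = 0 → S.lieX (S.lieX S.rhoLift) p < 0

/-- The exit time `τ(x, θ)`. -/
def exitTime (p : PhasePoint) : ℝ := sSup (S.arcLengths p)

open Classical in
/-- The orbit `t ↦ φ_t(x, θ)`, `0 ≤ t ≤ τ(x, θ)`, of the geodesic flow. -/
def geodesic (p : PhasePoint) : ℝ → PhasePoint :=
  if h : ∃ γ, S.IsGeodesicArc p (S.exitTime p) γ then h.choose else fun _ => p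

/-- `u^f(x, θ) = ∫_0^{τ(x, θ)} f(φ_t(x, θ)) dt`. -/
def transport (f : PhasePoint → ℂ) (p : PhasePoint) : ℂ :=
  ∫ t in (0 : ℝ)..(S.exitTime p), f (S.geodesic p t)

/-- The outflow boundary `∂_- SM`: boundary points with `⟨v, ν⟩ ≤ 0`, `ν` the inner normal. -/
def outflow : Set PhasePoint := {p | p.1 ∈ S.bdry ∧ S.lieX S.rhoLift p ≤ 0}

/-- `u` solves `X u = - f` on `SM`, `u = 0` on `∂_- SM`; here `X u` is the derivative of `u` along the
orbits of the geodesic flow. -/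
def IsTransportSolution (f u : PhasePoint → ℂ) : Prop :=
  (∀ p T γ, S.IsGeodesicArc p T γ → ∀ t ∈ Icc 0 T,
    HasDerivWithinAt (fun s => u (γ s)) (-f (γ t)) (Icc 0 T) t) ∧
  ∀ p ∈ S.outflow, u p = 0

/-- The Fourier component `u_k(x, θ) = e^{ikθ} (1/2π) ∫_0^{2π} u(x, θ') e^{-ikθ'} dθ'`. -/
def fourierComp (k : ℤ) (u : PhasePoint → ℂ) (p : PhasePoint) : ℂ :=
  Complex.exp (Complex.I * k * p.2) * ((1 / (2 * (Real.pi : ℂ))) *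
    ∫ θ in (0 : ℝ)..(2 * Real.pi), u (p.1, θ) * Complex.exp (-(Complex.I * k * θ)))

/-- Smooth functions on `SM` (up to the boundary). -/
def IsSmooth (u : PhasePoint → ℂ) : Prop :=
  ContDiffOn ℝ ∞ u S.SM ∧ ∀ p ∈ S.SM, u (p.1, p.2 + 2 * Real.pi) = u p

/-- `Ω_k = ker (∂_θ - i k) ∩ C^∞(SM)`. -/
def Omega (k : ℤ) : Set (PhasePoint → ℂ) :=
  {u | S.IsSmooth u ∧ ∀ p ∈ S.SM, S.vert u p = Complex.I * k * u p}

/-- The elements of `Ω_k` that vanish on `∂M`. -/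
def OmegaZero (k : ℤ) : Set (PhasePoint → ℂ) :=
  {u | u ∈ S.Omega k ∧ ∀ p : PhasePoint, p.1 ∈ S.bdry → u p = 0}

/-- The elements of `Ω_k` with compact support in the interior of `M`, that is,
`e^{ikθ} C_0^∞(M)`. -/
def OmegaC (k : ℤ) : Set (PhasePoint → ℂ) :=
  {u | u ∈ S.Omega k ∧ ∃ K ⊆ S.inner, IsCompact K ∧ ∀ p ∈ S.SM, p.1 ∉ K → u p = 0}

/-- `W_k f = (X_⊥ u^f)_k`. -/
def W (k : ℤ) (f : PhasePoint → ℂ) : PhasePoint → ℂ :=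
  fourierComp k (S.Xperp (S.transport f))

/-- `W_k^* h = (u^{X_⊥ h})_k`. -/
def Wstar (k : ℤ) (h : PhasePoint → ℂ) : PhasePoint → ℂ :=
  fourierComp k (S.transport (S.Xperp h))

/-- The volume measure `dΣ³ = e^{2λ} dx dy dθ` of `SM`. -/
def vol : Measure PhasePoint :=
  (volume.restrict (S.carrier ×ˢ Ioc 0 (2 * Real.pi))).withDensity
    (fun p => ENNReal.ofReal (Real.exp (2 * S.lam p.1)))

/-- `(u, v) = ∫_{SM} u v̄ dΣ³`. -/
def pairing (u v : PhasePoint → ℂ) : ℂ := ∫ p, u p * starRingEnd ℂ (v p) ∂S.vol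

/-- `H_k`: the closure of `e^{ikθ} C_0^∞(M)` in `L²(SM)`. -/
def H (k : ℤ) : Submodule ℂ (Lp ℂ 2 S.vol) :=
  (Submodule.span ℂ {F : Lp ℂ 2 S.vol | ∃ f ∈ S.OmegaC k, F =ᵐ[S.vol] f}).topologicalClosure

instance (k : ℤ) : CompleteSpace (S.H k) :=
  (Submodule.isClosed_topologicalClosure _).completeSpace_coe

/-- The element `F` of `H_k` is the class of the function `u`. -/
def Represents {k : ℤ} (F : S.H k) (u : PhasePoint → ℂ) : Prop :=
  (F : Lp ℂ 2 S.vol) =ᵐ[S.vol] u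

end IsothermalSurface

end

/-! Formally the identity is two integrations by parts. The field `X` and its rotation `X_⊥` are
both divergence free for `dΣ³`. Integrating `X_⊥(u^f h̄)` gives `(X_⊥ u^f, h) = -(u^f, X_⊥ h)`,
because `h` vanishes on `∂M` and `u^f` is bounded (`pairing_Xperp_transport`). With `g = X_⊥ h` it
remains to see that `(f, u^g) = -(u^f, g)` (`pairing_transport`). Let `flip` reverse unit vectors
and integrate `X(u^f · conj(u^g ∘ flip))`. Of a boundary vector and its reverse at least one lies in
the outflow boundary, so this product vanishes on all of `∂SM`. Since `flip` turns `X` into `-X`,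
one has `X(u^g ∘ flip) = g ∘ flip`. Finally `f` has parity `(-1)^k` under `flip`, while `X_⊥ h` has
the opposite parity; this produces the minus sign, and the two signs cancel.

The analytic difficulty is that `u^f` is differentiable only over the interior, and its derivative
blows up along geodesics that are nearly tangent to the boundary. Strict convexity makes a geodesic
from an interior point exit transversally (`rhoDot_exit_neg`), so the implicit function theorem
makes the exit time `C¹` there (`hasFDerivAt_exitTime`), with derivative of size `1/|Xρ|` at the
exit point. An energy argument of Grönwall type bounds `(Xρ)²` at the exit from below by a multiple
of `ρ + (Xρ)²` at the start (`exists_le_sq_rhoDot_exit`), whence `|du^f|² ≤ M / (ρ + (Xρ)²)`. This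
weight is integrable (`lintegral_inv_rho_add_sq_rhoDot_lt_top`): integration over the angle leaves a
singularity `ρ^{-1/2}`, which is integrable over `M`. Hence `X_⊥ u^f ∈ L²`. The integrations by
parts are justified by cutting off in a collar of width `ε`: the gradient of the cutoff is `O(1/ε)`,
the collar has volume `O(ε)`, and the integrand tends to zero at the boundary
(`integral_vol_rot_eq_zero`).

Taking `k`-th Fourier components does not change pairings with functions `e^{ikθ} b(x)`
(`pairing_fourierComp`), and every square integrable function of this form lies in `H_k`
(`exists_represents`). The statement on bounded extensions then follows by density.

For the flow itself, `λ` is first cut off far from `M`. The geodesic field on the plane is then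
bounded with bounded first and second derivatives, so it has a global flow that is `C¹` in the
initial point, and nothing over `M` has changed. -/

open Filter Topology NNReal

/-! ### Global flows of Lipschitz vector fields and their derivative in the initial point -/

section Flow

variable {E : Type*} [NormedAddCommGroup E] [NormedSpace ℝ E]

/-- `φ x` is the integral curve of the autonomous vector field `v` that starts at `x`. -/
structure IsGlobalFlow (v : E → E) (φ : E → ℝ → E) : Prop where
  zero : ∀ x, φ x 0 = x
  hasDerivAt : ∀ x t, HasDerivAt (φ x) (v (φ x t)) t

/-- Bounded Lipschitz vector fields are complete. -/
theorem exists_isGlobalFlow [CompleteSpace E] {v : E → E} {K L : ℝ≥0} (hv : LipschitzWith K v)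
    (hb : ∀ x, ‖v x‖ ≤ L) : ∃ φ, IsGlobalFlow v φ := by
  have key : ∀ (x : E) (T : ℝ), 0 < T → ∃ α : ℝ → E, α 0 = x ∧
      ∀ t ∈ Icc (-T) T, HasDerivWithinAt α (v (α t)) (Icc (-T) T) t := by
    intro x T hT
    have h0 : (0 : ℝ) ∈ Icc (-T) T := ⟨by linarith, hT.le⟩
    -- The radius `L T` is the furthest a curve of speed at most `L` can travel in time `T`, so the
    -- time interval needs no shrinking.
    have : IsPicardLindelof (fun _ : ℝ => v) (⟨0, h0⟩ : Icc (-T) T) x (L * ⟨T, hT.le⟩) 0 L K := by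
      refine ⟨fun t _ => hv.lipschitzOnWith, fun _ _ => continuousOn_const, fun _ _ y _ => hb y, ?_⟩
      have e : ((L * ⟨T, hT.le⟩ : ℝ≥0) : ℝ) = L * T := rfl
      rw [e]
      simp
    obtain ⟨α, h1, h2⟩ := this.exists_eq_forall_mem_Icc_hasDerivWithinAt₀
    exact ⟨α, h1, h2⟩
  choose! α h0 hα using key
  have uniq : ∀ x S T, 0 < S → S ≤ T → EqOn (α x S) (α x T) (Icc (-S) S) := by
    intro x S T hS hST
    have hT : 0 < T := hS.trans_le hST
    have hsub : Icc (-S) S ⊆ Icc (-T) T := Icc_subset_Icc (by linarith) hST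
    refine ODE_solution_unique_of_mem_Icc (v := fun _ => v) (s := fun _ => univ) (K := K) (t₀ := 0)
      (fun t _ => hv.lipschitzOnWith) ⟨by linarith, hS⟩
      (fun t ht => (hα x S hS t ht).continuousWithinAt) (fun t ht => ?_) (fun _ _ => trivial)
      (fun t ht => ((hα x T hT t (hsub ht)).mono hsub).continuousWithinAt)
      (fun t ht => ?_) (fun _ _ => trivial) (by rw [h0 x S hS, h0 x T hT])
    · exact (hα x S hS t (Ioo_subset_Icc_self ht)).hasDerivAt (Icc_mem_nhds ht.1 ht.2)
    · exact (hα x T hT t (hsub (Ioo_subset_Icc_self ht))).hasDerivAt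
        (Icc_mem_nhds (by linarith [ht.1]) (by linarith [ht.2]))
  -- The margin `1` keeps `t` inside the interval of the chosen solution; by uniqueness, all times
  -- close to `t` can be served by the single solution on the interval of radius `|t| + 2`.
  refine ⟨fun x t => α x (|t| + 1) t, fun x => h0 x _ (by positivity), fun x t => ?_⟩
  have hev : (fun s => α x (|s| + 1) s) =ᶠ[𝓝 t] α x (|t| + 2) := by
    have : ∀ᶠ s in 𝓝 t, |s| < |t| + 1 :=
      (continuous_abs.tendsto t).eventually (gt_mem_nhds (by linarith))
    filter_upwards [this] with s hs
    exact uniq x (|s| + 1) (|t| + 2) (by positivity) (by linarith)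
      (by rw [mem_Icc, ← abs_le]; linarith)
  have hd := (hα x (|t| + 2) (by positivity) t (by rw [mem_Icc, ← abs_le]; linarith)).hasDerivAt
    (Icc_mem_nhds (by linarith [neg_abs_le t]) (by linarith [le_abs_self t]))
  have := hd.congr_of_eventuallyEq hev
  have e : α x (|t| + 2) t = α x (|t| + 1) t := hev.eq_of_nhds.symm
  rwa [e] at this

namespace IsGlobalFlow

variable {v : E → E} {φ : E → ℝ → E} {K K' : ℝ≥0} {v' : E → E →L[ℝ] E}

theorem continuous_right (h : IsGlobalFlow v φ) (x : E) : Continuous (φ x) :=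
  continuous_iff_continuousAt.2 fun t => (h.hasDerivAt x t).continuousAt

theorem eq_of_hasDerivAt (h : IsGlobalFlow v φ) (hv : LipschitzWith K v) {γ : ℝ → E}
    (hγ : ∀ t, HasDerivAt γ (v (γ t)) t) : γ = φ (γ 0) :=
  ODE_solution_unique_univ (v := fun _ => v) (s := fun _ => univ) (K := K) (t₀ := 0)
    (fun _ => hv.lipschitzOnWith) (fun t => ⟨hγ t, trivial⟩)
    (fun t => ⟨h.hasDerivAt _ t, trivial⟩) (h.zero _).symm

theorem map_add (h : IsGlobalFlow v φ) (hv : LipschitzWith K v) (x : E) (s t : ℝ) :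
    φ x (s + t) = φ (φ x s) t := by
  have := h.eq_of_hasDerivAt hv (γ := fun t => φ x (s + t))
    (fun t => (h.hasDerivAt x (s + t)).comp_const_add s t)
  simpa using congrFun this t

theorem eqOn_of_hasDerivWithinAt (h : IsGlobalFlow v φ) (hv : LipschitzWith K v) {γ : ℝ → E}
    {T : ℝ} (hγ : ∀ t ∈ Icc 0 T, HasDerivWithinAt γ (v (γ t)) (Icc 0 T) t) :
    EqOn γ (φ (γ 0)) (Icc 0 T) := by
  refine ODE_solution_unique (v := fun _ => v) (K := K) (fun _ => hv)
    (fun t ht => (hγ t ht).continuousWithinAt) (fun t ht => ?_)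
    (h.continuous_right _).continuousOn (fun t _ => (h.hasDerivAt _ t).hasDerivWithinAt)
    (h.zero _).symm
  exact (hγ t (Ico_subset_Icc_self ht)).mono_of_mem_nhdsWithin
    (Icc_mem_nhdsGE_of_mem ht)

theorem reverse (h : IsGlobalFlow v φ) : IsGlobalFlow (fun x => -v x) (fun x t => φ x (-t)) where
  zero x := by simp [h.zero]
  hasDerivAt x t := by
    simpa using! (h.hasDerivAt x (-t)).scomp t (hasDerivAt_neg t)

theorem dist_le_of_nonneg (h : IsGlobalFlow v φ) (hv : LipschitzWith K v) (x y : E) {t : ℝ}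
    (ht : 0 ≤ t) : dist (φ x t) (φ y t) ≤ dist x y * Real.exp (K * t) := by
  have := dist_le_of_trajectories_ODE (v := fun _ => v) (K := K) (a := 0) (b := t)
    (δ := dist x y) (fun _ => hv)
    (h.continuous_right x).continuousOn (fun t _ => (h.hasDerivAt x t).hasDerivWithinAt)
    (h.continuous_right y).continuousOn (fun t _ => (h.hasDerivAt y t).hasDerivWithinAt)
    (by rw [h.zero, h.zero]) t ⟨ht, le_rfl⟩
  simpa using this

theorem dist_le (h : IsGlobalFlow v φ) (hv : LipschitzWith K v) (x y : E) (t : ℝ) :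
    dist (φ x t) (φ y t) ≤ dist x y * Real.exp (K * |t|) := by
  rcases le_total 0 t with ht | ht
  · simpa [abs_of_nonneg ht] using h.dist_le_of_nonneg hv x y ht
  · have := h.reverse.dist_le_of_nonneg (K := K) hv.neg x y (neg_nonneg.2 ht)
    simpa [abs_of_nonpos ht] using this

theorem continuous_uncurry (h : IsGlobalFlow v φ) (hv : LipschitzWith K v) :
    Continuous (fun p : E × ℝ => φ p.1 p.2) := by
  refine continuous_iff_continuousAt.2 fun ⟨x, t⟩ => ?_
  have hc : ContinuousOn (fun p : E × ℝ => φ p.1 p.2) (univ ×ˢ Ioo (-(|t| + 1)) (|t| + 1)) := by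
    refine continuousOn_prod_of_continuousOn_lipschitzOnWith _
      (Real.toNNReal (Real.exp (K * (|t| + 1))))
      (fun x _ => (h.continuous_right x).continuousOn) (fun s hs => ?_)
    refine LipschitzOnWith.of_dist_le_mul fun y _ z _ => ?_
    rw [Real.coe_toNNReal _ (Real.exp_pos _).le]
    refine (h.dist_le hv y z s).trans ?_
    rw [mul_comm]
    gcongr
    exact (abs_lt.2 hs).le
  refine hc.continuousAt (prod_mem_nhds univ_mem (Ioo_mem_nhds ?_ ?_))
  · linarith [neg_abs_le t]
  · linarith [le_abs_self t]

end IsGlobalFlow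

/-- Linearity in the forcing lets a quadratically small error in the equation yield a quadratically
small error in the solution. -/
theorem gronwallBound_zero_left (K ε x : ℝ) :
    gronwallBound 0 K ε x = ε * gronwallBound 0 K 1 x := by
  by_cases hK : K = 0
  · simp [hK, gronwallBound_K0]
  · simp only [gronwallBound_of_K_ne_0 hK]; ring

/-- Quadratic Taylor estimate for a function with Lipschitz derivative. -/
theorem norm_sub_sub_le_of_lipschitz_deriv {F : Type*} [NormedAddCommGroup F] [NormedSpace ℝ F]
    {v : E → F} {v' : E → E →L[ℝ] F} {K' : ℝ≥0}
    (hd : ∀ x, HasFDerivAt v (v' x) x) (hd' : LipschitzWith K' v') (x y : E) :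
    ‖v y - v x - v' x (y - x)‖ ≤ K' * ‖y - x‖ ^ 2 := by
  have := (convex_closedBall x ‖y - x‖).norm_image_sub_le_of_norm_hasFDerivWithin_le'
    (f := v) (f' := v') (φ := v' x) (C := K' * ‖y - x‖) (x := x) (y := y)
    (fun z _ => (hd z).hasFDerivWithinAt) (fun z hz => ?_)
    (Metric.mem_closedBall_self (norm_nonneg _)) (by simp [dist_eq_norm])
  · linarith
  · have h1 := hd'.dist_le_mul z x
    rw [dist_eq_norm] at h1
    refine h1.trans ?_
    gcongr
    simpa using hz

namespace IsGlobalFlow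

variable {v : E → E} {φ : E → ℝ → E} {K K' : ℝ≥0} {v' : E → E →L[ℝ] E}

/-- Short time differentiability of the flow in the initial point. -/
theorem exists_hasFDerivAt_short [CompleteSpace E] (h : IsGlobalFlow v φ) (hv : LipschitzWith K v)
    (hd : ∀ x, HasFDerivAt v (v' x) x) (hd' : LipschitzWith K' v') :
    ∃ A : E → ℝ → E →L[ℝ] E,
      (∀ x, ∀ t ∈ Icc 0 (1 / (2 * ((K : ℝ) + 1))), HasFDerivAt (fun y => φ y t) (A x t) x) ∧
      ContinuousOn (fun p : E × ℝ => A p.1 p.2) (univ ×ˢ Icc 0 (1 / (2 * ((K : ℝ) + 1)))) := by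
  -- The linearised equation `A' = v'(φ) A` is solved in the unit ball around the identity. There
  -- `‖A‖ ≤ 2`, so the right side is at most `2K`, and `2Kε ≤ 1` keeps the solution in the ball.
  set ε : ℝ := 1 / (2 * ((K : ℝ) + 1)) with hε
  have hε0 : 0 < ε := by positivity
  have hvn : ∀ x, ‖v' x‖ ≤ K := fun x => (hd x).le_of_lipschitz hv
  have hcv' : Continuous v' := hd'.continuous
  have hlip : ∀ B : E →L[ℝ] E, ‖B‖ ≤ K → LipschitzWith K (fun A : E →L[ℝ] E => B ∘L A) := by
    intro B hB
    refine LipschitzWith.of_dist_le_mul fun A A' => ?_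
    rw [dist_eq_norm, dist_eq_norm, ← ContinuousLinearMap.comp_sub]
    exact (ContinuousLinearMap.opNorm_comp_le _ _).trans (by gcongr)
  have key : ∀ x : E, ∃ A : ℝ → E →L[ℝ] E, A 0 = ContinuousLinearMap.id ℝ E ∧
      ∀ t ∈ Icc 0 ε, HasDerivWithinAt A (v' (φ x t) ∘L A t) (Icc 0 ε) t := by
    intro x
    have h0 : (0 : ℝ) ∈ Icc 0 ε := ⟨le_rfl, hε0.le⟩
    have : IsPicardLindelof (fun (t : ℝ) (A : E →L[ℝ] E) => v' (φ x t) ∘L A)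
        (⟨0, h0⟩ : Icc 0 ε) (ContinuousLinearMap.id ℝ E) 1 0 (2 * K) K := by
      refine ⟨fun t _ => (hlip _ (hvn _)).lipschitzOnWith, fun A _ => ?_, fun t _ A hA => ?_, ?_⟩
      · exact ((hcv'.comp (h.continuous_right x)).clm_comp continuous_const).continuousOn
      · have hA' : ‖A‖ ≤ 2 := by
          have h1 : ‖A - ContinuousLinearMap.id ℝ E‖ ≤ 1 := by simpa [dist_eq_norm] using hA
          have h2 := norm_add_le (A - ContinuousLinearMap.id ℝ E) (ContinuousLinearMap.id ℝ E)
          have h3 : ‖ContinuousLinearMap.id ℝ E‖ ≤ 1 := ContinuousLinearMap.norm_id_le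
          rw [sub_add_cancel] at h2
          linarith
        refine (ContinuousLinearMap.opNorm_comp_le _ _).trans ?_
        push_cast
        nlinarith [hvn (φ x t), norm_nonneg A, norm_nonneg (v' (φ x t))]
      · have : (K : ℝ) / (K + 1) ≤ 1 := by rw [div_le_one (by positivity)]; linarith
        simp only [sub_zero, sub_self, max_eq_left hε0.le]
        push_cast
        calc 2 * (K : ℝ) * ε = K / (K + 1) := by rw [hε]; field_simp
          _ ≤ 1 - 0 := by simpa using this
    exact this.exists_eq_forall_mem_Icc_hasDerivWithinAt₀
  choose A hA0 hA using key
  have hAc : ∀ x, ContinuousOn (A x) (Icc 0 ε) := fun x t ht => (hA x t ht).continuousWithinAt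
  have hA' : ∀ x, ∀ t ∈ Ico 0 ε, HasDerivWithinAt (A x) (v' (φ x t) ∘L A x t) (Ici t) t :=
    fun x t ht => (hA x t (Ico_subset_Icc_self ht)).mono_of_mem_nhdsWithin (Icc_mem_nhdsGE_of_mem ht)
  set M : ℝ := Real.exp (K * ε) with hM
  have hAn : ∀ x, ∀ t ∈ Icc 0 ε, ‖A x t‖ ≤ M := by
    intro x t ht
    have := norm_le_gronwallBound_of_norm_deriv_right_le (hAc x) (hA' x) (δ := 1) (K := K) (ε := 0)
      (by rw [hA0]; exact ContinuousLinearMap.norm_id_le)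
      (fun s _ => by
        rw [add_zero]
        exact (ContinuousLinearMap.opNorm_comp_le _ _).trans (by gcongr; exact hvn _)) t ht
    rw [gronwallBound_ε0, one_mul, sub_zero] at this
    refine this.trans ?_
    rw [hM]; gcongr; exact ht.2
  have hgm : Monotone (gronwallBound 0 K 1) := gronwallBound_mono le_rfl zero_le_one K.2
  have hg0 : 0 ≤ gronwallBound 0 K 1 ε := by
    have := hgm hε0.le
    rwa [gronwallBound_x0] at this
  have hφd : ∀ x y, ∀ t ∈ Icc 0 ε, dist (φ x t) (φ y t) ≤ M * dist x y := by
    intro x y t ht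
    refine (h.dist_le_of_nonneg hv x y ht.1).trans ?_
    rw [mul_comm, hM]
    gcongr
    exact ht.2
  refine ⟨A, fun x t ht => ?_, ?_⟩
  -- The curve `φ x t + A x t (y - x)` solves the nonlinear equation up to an error quadratic in `‖y
  -- - x‖`; Grönwall compares it with the true orbit of `y`.
  · have quad : ∀ y, ‖φ y t - φ x t - A x t (y - x)‖ ≤
        (K' * M ^ 2 * gronwallBound 0 K 1 ε) * ‖y - x‖ ^ 2 := by
      intro y
      have := dist_le_of_approx_trajectories_ODE (v := fun _ => v) (K := K) (a := 0) (b := ε)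
        (f := φ y) (f' := fun t => v (φ y t)) (g := fun t => φ x t + A x t (y - x))
        (g' := fun t => v (φ x t) + v' (φ x t) (A x t (y - x))) (δ := 0) (εf := 0)
        (εg := K' * (M * ‖y - x‖) ^ 2) (fun _ => hv)
        (h.continuous_right y).continuousOn (fun t _ => (h.hasDerivAt y t).hasDerivWithinAt)
        (by simp) ((h.continuous_right x).continuousOn.add
          ((hAc x).clm_apply continuousOn_const))
        (fun t ht => ?_) (fun t ht => ?_) (by simp [h.zero, hA0]) t ht
      · rw [zero_add, sub_zero, gronwallBound_zero_left, dist_eq_norm, ← sub_sub] at this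
        refine this.trans ?_
        have h1 : gronwallBound 0 K 1 t ≤ gronwallBound 0 K 1 ε := hgm ht.2
        calc K' * (M * ‖y - x‖) ^ 2 * gronwallBound 0 K 1 t
            ≤ K' * (M * ‖y - x‖) ^ 2 * gronwallBound 0 K 1 ε := by gcongr
          _ = _ := by ring
      · have h2 := (hA' x t ht).clm_apply (hasDerivWithinAt_const t (Ici t) (y - x))
        simpa using! ((h.hasDerivAt x t).hasDerivWithinAt (s := Ici t)).add h2
      · rw [dist_comm, dist_eq_norm]
        have h3 := norm_sub_sub_le_of_lipschitz_deriv hd hd' (φ x t) (φ x t + A x t (y - x))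
        rw [add_sub_cancel_left, sub_sub] at h3
        refine h3.trans ?_
        gcongr
        exact ((A x t).le_opNorm _).trans (by gcongr; exact hAn x t (Ico_subset_Icc_self ht))
    refine HasFDerivAt.of_isLittleO ?_
    have hO : (fun y => φ y t - φ x t - A x t (y - x)) =O[𝓝 x] fun y => ‖y - x‖ ^ 2 :=
      Asymptotics.IsBigO.of_bound _ (Eventually.of_forall fun y => by
        rw [norm_pow, norm_norm]; exact quad y)
    refine hO.trans_isLittleO ?_
    have : Tendsto (fun y => ‖y - x‖) (𝓝 x) (𝓝 0) := by
      have : Continuous fun y => ‖y - x‖ := by fun_prop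
      simpa using this.tendsto x
    have h1 : (fun y => ‖y - x‖ * ‖y - x‖) =o[𝓝 x] fun y => 1 * ‖y - x‖ :=
      ((Asymptotics.isLittleO_one_iff ℝ).2 this).mul_isBigO (Asymptotics.isBigO_refl _ _)
    simp only [one_mul] at h1
    simpa [pow_two] using h1.of_norm_right
  -- Joint continuity follows from continuity in `t` and a Lipschitz bound in `x` uniform in `t`.
  -- The latter is Grönwall again: `A y` solves the linearised equation along the orbit of `x` up to
  -- `K' M² dist x y`.
  · refine continuousOn_prod_of_continuousOn_lipschitzOnWith _
      (Real.toNNReal (K' * M ^ 2 * gronwallBound 0 K 1 ε)) (fun x _ => hAc x) (fun t ht => ?_)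
    refine LipschitzOnWith.of_dist_le_mul fun x _ y _ => ?_
    rw [Real.coe_toNNReal _ (by positivity)]
    have := dist_le_of_approx_trajectories_ODE_of_mem
        (v := fun t (B : E →L[ℝ] E) => v' (φ x t) ∘L B) (s := fun _ => univ) (K := K) (a := 0)
        (b := ε) (f := A x) (f' := fun t => v' (φ x t) ∘L A x t) (g := A y)
        (g' := fun t => v' (φ y t) ∘L A y t) (δ := 0) (εf := 0)
        (εg := K' * (M * dist x y) * M) (fun t _ => (hlip _ (hvn _)).lipschitzOnWith) (hAc x)
        (hA' x) (by simp) (fun _ _ => trivial) (hAc y) (hA' y) (fun t ht => ?_)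
        (fun _ _ => trivial) (by simp [hA0]) t ht
    · rw [zero_add, sub_zero, gronwallBound_zero_left] at this
      refine this.trans ?_
      calc K' * (M * dist x y) * M * gronwallBound 0 K 1 t
          ≤ K' * (M * dist x y) * M * gronwallBound 0 K 1 ε := by
            gcongr; exact hgm ht.2
        _ = _ := by ring
    · rw [dist_eq_norm, ← ContinuousLinearMap.sub_comp]
      refine (ContinuousLinearMap.opNorm_comp_le _ _).trans ?_
      have ht' := Ico_subset_Icc_self ht
      gcongr
      · rw [← dist_eq_norm]
        refine (hd'.dist_le_mul _ _).trans ?_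
        gcongr
        rw [dist_comm]
        exact hφd x y t ht'
      · exact hAn y t ht'

/-- The flow of a vector field with bounded and Lipschitz derivative is differentiable in the initial
point, with a jointly continuous derivative. -/
theorem exists_hasFDerivAt [CompleteSpace E] (h : IsGlobalFlow v φ) (hv : LipschitzWith K v)
    (hd : ∀ x, HasFDerivAt v (v' x) x) (hd' : LipschitzWith K' v') :
    ∃ A : E → ℝ → E →L[ℝ] E, (∀ x t, HasFDerivAt (fun y => φ y t) (A x t) x) ∧
      Continuous (fun p : E × ℝ => A p.1 p.2) := by
  set ε : ℝ := 1 / (2 * ((K : ℝ) + 1)) with hε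
  have hε0 : 0 < ε := by positivity
  have base : ∃ A : E → ℝ → E →L[ℝ] E,
      (∀ x, ∀ t ∈ Icc (-ε) ε, HasFDerivAt (fun y => φ y t) (A x t) x) ∧
      ContinuousOn (fun p : E × ℝ => A p.1 p.2) (univ ×ˢ Icc (-ε) ε) := by
    obtain ⟨A, hA, hAc⟩ := h.exists_hasFDerivAt_short hv hd hd'
    obtain ⟨B, hB, hBc⟩ := h.reverse.exists_hasFDerivAt_short (K := K) (K' := K')
      (v' := fun x => -v' x) hv.neg (fun x => (hd x).neg) hd'.neg
    -- The forward and backward derivatives must match at time zero for the glued one to be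
    -- continuous.
    have h00 : ∀ x, A x 0 = B x 0 := fun x => by
      have h1 := hA x 0 ⟨le_rfl, hε0.le⟩
      have h2 := hB x 0 ⟨le_rfl, hε0.le⟩
      simp only [neg_zero] at h2
      exact h1.unique h2
    refine ⟨fun x t => if 0 ≤ t then A x t else B x (-t), fun x t ht => ?_, ?_⟩
    · by_cases h0 : 0 ≤ t
      · simpa [h0] using hA x t ⟨h0, ht.2⟩
      · simpa [h0] using hB x (-t) ⟨by linarith, by linarith [ht.1]⟩
    · have hsplit : (univ ×ˢ Icc (-ε) ε : Set (E × ℝ)) =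
          (univ ×ˢ Icc 0 ε) ∪ (univ ×ˢ Icc (-ε) 0) := by
        rw [← prod_union, union_comm, Icc_union_Icc_eq_Icc (by linarith) hε0.le]
      rw [hsplit]
      refine ContinuousOn.union_of_isClosed ?_ ?_ (isClosed_univ.prod isClosed_Icc)
        (isClosed_univ.prod isClosed_Icc)
      · refine hAc.congr fun p hp => ?_
        have : 0 ≤ p.2 := hp.2.1
        simp [this]
      · have : ContinuousOn (fun p : E × ℝ => B p.1 (-p.2)) (univ ×ˢ Icc (-ε) 0) := by
          refine hBc.comp (f := fun p : E × ℝ => (p.1, -p.2)) (by fun_prop) fun p hp => ?_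
          exact ⟨trivial, by simpa using hp.2.2, by linarith [hp.2.1]⟩
        refine this.congr fun p hp => ?_
        by_cases h0 : 0 ≤ p.2
        · have h1 : p.2 = 0 := le_antisymm hp.2.2 h0
          simp [h1, h00]
        · simp [h0]
  -- Since `φ_t = φ_{t/2} ∘ φ_{t/2}`, the chain rule doubles the time interval on which the
  -- derivative is known.
  have double : ∀ n : ℕ, ∃ A : E → ℝ → E →L[ℝ] E,
      (∀ x, ∀ t ∈ Icc (-(2 ^ n * ε)) (2 ^ n * ε), HasFDerivAt (fun y => φ y t) (A x t) x) ∧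
      ContinuousOn (fun p : E × ℝ => A p.1 p.2) (univ ×ˢ Icc (-(2 ^ n * ε)) (2 ^ n * ε)) := by
    intro n
    induction n with
    | zero => simpa using base
    | succ n ih =>
      obtain ⟨A, hA, hAc⟩ := ih
      have hm : ∀ t ∈ Icc (-(2 ^ (n + 1) * ε)) (2 ^ (n + 1) * ε),
          t / 2 ∈ Icc (-(2 ^ n * ε)) (2 ^ n * ε) := by
        intro t ht
        have := ht.1; have := ht.2
        rw [pow_succ] at *
        constructor <;> linarith
      refine ⟨fun x t => A (φ x (t / 2)) (t / 2) ∘L A x (t / 2), fun x t ht => ?_, ?_⟩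
      · have h1 := (hA (φ x (t / 2)) (t / 2) (hm t ht)).comp x (hA x (t / 2) (hm t ht))
        refine h1.congr_of_eventuallyEq (Eventually.of_forall fun y => ?_)
        change φ y t = φ (φ y (t / 2)) (t / 2)
        rw [← h.map_add hv, add_halves]
      · refine ContinuousOn.clm_comp ?_ ?_
        · refine hAc.comp (f := fun p : E × ℝ => (φ p.1 (p.2 / 2), p.2 / 2)) ?_
            fun p hp => ⟨trivial, hm _ hp.2⟩
          have := h.continuous_uncurry hv
          exact (Continuous.prodMk (this.comp (f := fun p : E × ℝ => (p.1, p.2 / 2)) (by fun_prop))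
            (by fun_prop)).continuousOn
        · exact hAc.comp (f := fun p : E × ℝ => (p.1, p.2 / 2)) (by fun_prop)
            fun p hp => ⟨trivial, hm _ hp.2⟩
  have hbig : ∀ t : ℝ, ∃ n : ℕ, |t| < 2 ^ n * ε := by
    intro t
    obtain ⟨n, hn⟩ := pow_unbounded_of_one_lt (|t| / ε) one_lt_two
    exact ⟨n, by rwa [div_lt_iff₀ hε0] at hn⟩
  -- Taking `fderiv` itself makes the derivative independent of the number of doublings; locally it
  -- agrees with the continuous one.
  refine ⟨fun x t => fderiv ℝ (fun y => φ y t) x, fun x t => ?_, ?_⟩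
  · obtain ⟨n, hn⟩ := hbig t
    obtain ⟨A, hA, -⟩ := double n
    exact (hA x t (abs_le.1 hn.le)).differentiableAt.hasFDerivAt
  · refine continuous_iff_continuousAt.2 fun ⟨x, t⟩ => ?_
    obtain ⟨n, hn⟩ := hbig t
    obtain ⟨A, hA, hAc⟩ := double n
    have hnh : (univ ×ˢ Icc (-(2 ^ n * ε)) (2 ^ n * ε) : Set (E × ℝ)) ∈ 𝓝 (x, t) :=
      prod_mem_nhds univ_mem (Icc_mem_nhds (abs_lt.1 hn).1 (abs_lt.1 hn).2)
    refine (hAc.continuousAt hnh).congr ?_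
    filter_upwards [hnh] with p hp
    exact (hA p.1 p.2 hp.2).fderiv.symm

end IsGlobalFlow

end Flow

/-! ### Uniform bounds for maps whose germs, up to translation, come from a compact set -/

section Translate

variable {E F : Type*} [NormedAddCommGroup E] [NormedSpace ℝ E] [NormedAddCommGroup F]
  [NormedSpace ℝ F]

/-- A continuous function whose germs all occur over a compact set is bounded. -/
theorem exists_bound_of_germs {E F : Type*} [NormedAddCommGroup E] [NormedAddCommGroup F]
    {Y : E → F} (hY : Continuous Y) {C : Set E} (hC : IsCompact C)
    (h : ∀ p, ∃ q ∈ C, ∀ᶠ v in 𝓝 (0 : E), Y (p + v) = Y (q + v)) : ∃ L : ℝ≥0, ∀ p, ‖Y p‖ ≤ L := by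
  obtain ⟨L, hL⟩ := hC.exists_bound_of_continuousOn hY.continuousOn
  refine ⟨L.toNNReal, fun p => ?_⟩
  obtain ⟨q, hq, hv⟩ := h p
  have := hv.self_of_nhds
  simp only [add_zero] at this
  rw [this]
  exact (hL q hq).trans (Real.le_coe_toNNReal L)

/-- Differentiation is local and commutes with translations, so the hypothesis passes to all
derivatives and each of them can be bounded over the same compact set. -/
theorem fderiv_germs {Y : E → F} {C : Set E}
    (h : ∀ p, ∃ q ∈ C, ∀ᶠ v in 𝓝 (0 : E), Y (p + v) = Y (q + v)) :
    ∀ p, ∃ q ∈ C, ∀ᶠ v in 𝓝 (0 : E), fderiv ℝ Y (p + v) = fderiv ℝ Y (q + v) := by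
  intro p
  obtain ⟨q, hq, hv⟩ := h p
  refine ⟨q, hq, ?_⟩
  have : (fun v => Y (p + v)) =ᶠ[𝓝 0] fun v => Y (q + v) := hv
  filter_upwards [this.fderiv (𝕜 := ℝ)] with v hv
  rwa [fderiv_comp_add_left, fderiv_comp_add_left] at hv

theorem exists_lipschitz_of_germs {Y : E → F} (hY : ContDiff ℝ ∞ Y) {C : Set E} (hC : IsCompact C)
    (h : ∀ p, ∃ q ∈ C, ∀ᶠ v in 𝓝 (0 : E), Y (p + v) = Y (q + v)) :
    ∃ K K' L : ℝ≥0, LipschitzWith K Y ∧ LipschitzWith K' (fderiv ℝ Y) ∧ ∀ p, ‖Y p‖ ≤ L := by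
  have h1 : ContDiff ℝ ∞ (fderiv ℝ Y) := hY.fderiv_right (by simp)
  have h2 : ContDiff ℝ ∞ (fderiv ℝ (fderiv ℝ Y)) := h1.fderiv_right (by simp)
  obtain ⟨L, hL⟩ := exists_bound_of_germs hY.continuous hC h
  obtain ⟨K, hK⟩ := exists_bound_of_germs h1.continuous hC (fderiv_germs h)
  obtain ⟨K', hK'⟩ := exists_bound_of_germs h2.continuous hC (fderiv_germs (fderiv_germs h))
  exact ⟨K, K', L, lipschitzWith_of_nnnorm_fderiv_le (hY.differentiable (by simp)) hK,
    lipschitzWith_of_nnnorm_fderiv_le (h1.differentiable (by simp)) hK', hL⟩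

end Translate

/-! ### The geodesic field in the chart and its global flow -/

namespace IsothermalSurface

variable (S : IsothermalSurface)

theorem contDiff_fderiv_lam : ContDiff ℝ ∞ (fderiv ℝ S.lam) :=
  S.lam_smooth.fderiv_right (by simp)

theorem contDiff_lamX : ContDiff ℝ ∞ S.lamX :=
  S.contDiff_fderiv_lam.clm_apply contDiff_const

theorem contDiff_lamY : ContDiff ℝ ∞ S.lamY :=
  S.contDiff_fderiv_lam.clm_apply contDiff_const

theorem contDiff_geodesicField : ContDiff ℝ ∞ S.geodesicField := by
  have h1 := S.lam_smooth
  have h2 := S.contDiff_lamX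
  have h3 := S.contDiff_lamY
  unfold geodesicField
  fun_prop

theorem contDiff_transverseField : ContDiff ℝ ∞ S.transverseField := by
  have h1 := S.lam_smooth
  have h2 := S.contDiff_lamX
  have h3 := S.contDiff_lamY
  unfold transverseField
  fun_prop

theorem contDiff_rhoLift : ContDiff ℝ ∞ S.rhoLift := S.rho_smooth.comp contDiff_fst

theorem contDiff_lieX {u : PhasePoint → ℝ} (hu : ContDiff ℝ ∞ u) : ContDiff ℝ ∞ (S.lieX u) :=
  (hu.fderiv_right (m := ∞) (by simp)).clm_apply S.contDiff_geodesicField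

theorem isClosed_carrier : IsClosed S.carrier :=
  isClosed_le continuous_const S.rho_smooth.continuous

theorem isClosed_SM : IsClosed S.SM := S.isClosed_carrier.preimage continuous_fst

theorem isOpen_inner : IsOpen S.inner := isOpen_lt continuous_const S.rho_smooth.continuous

theorem inner_subset_carrier : S.inner ⊆ S.carrier := fun x hx => le_of_lt (show 0 < S.rho x from hx)

/-- Rotation of the unit tangent vector by the angle `π`. -/
noncomputable def flip (p : PhasePoint) : PhasePoint := (p.1, p.2 + Real.pi)

theorem geodesicField_flip (p : PhasePoint) : S.geodesicField (flip p) = -S.geodesicField p := by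
  ext <;> simp [geodesicField, flip]
  ring

theorem transverseField_flip (p : PhasePoint) :
    S.transverseField (flip p) = -S.transverseField p := by
  ext <;> simp [transverseField, flip]
  ring

theorem geodesicField_add_int_period (x : ℝ × ℝ) (θ : ℝ) (n : ℤ) :
    S.geodesicField (x, θ + n * (2 * Real.pi)) = S.geodesicField (x, θ) := by
  simp [geodesicField, Real.cos_add_int_mul_two_pi, Real.sin_add_int_mul_two_pi]

theorem exists_int_add_mem_Icc (θ : ℝ) : ∃ n : ℤ, θ + n * (2 * Real.pi) ∈ Icc 0 (2 * Real.pi) := by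
  obtain ⟨n, hn, -⟩ := existsUnique_add_zsmul_mem_Ico Real.two_pi_pos θ 0
  refine ⟨n, ?_⟩
  have := Ico_subset_Icc_self hn
  simpa using this

/-- The field is `2π`-periodic in the angle, and off the support of `λ` it does not depend on the
base point. Hence angles reduce to `[0, 2π]`, and all base points off the support can be represented
by one point outside a ball containing it. -/
theorem geodesicField_germs (hc : HasCompactSupport S.lam) :
    ∃ C : Set PhasePoint, IsCompact C ∧
      ∀ p, ∃ q ∈ C, ∀ᶠ v in 𝓝 (0 : PhasePoint), S.geodesicField (p + v) = S.geodesicField (q + v) := by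
  obtain ⟨R, hR⟩ := hc.isCompact.isBounded.subset_closedBall 0
  refine ⟨Metric.closedBall 0 (max R 0 + 1) ×ˢ Icc 0 (2 * Real.pi),
    (isCompact_closedBall _ _).prod isCompact_Icc, fun ⟨x, θ⟩ => ?_⟩
  obtain ⟨n, hn⟩ := exists_int_add_mem_Icc θ
  by_cases hx : x ∈ tsupport S.lam
  · refine ⟨(x, θ + n * (2 * Real.pi)), ⟨?_, hn⟩, Eventually.of_forall fun v => ?_⟩
    · exact Metric.closedBall_subset_closedBall (by linarith [le_max_left R 0]) (hR hx)
    · change _ = S.geodesicField (x + v.1, θ + n * (2 * Real.pi) + v.2)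
      rw [add_right_comm, geodesicField_add_int_period]
      rfl
  · have far : ∀ y ∉ tsupport S.lam, ∀ η, S.geodesicField (y, η) = ((Real.cos η, Real.sin η), 0) := by
      intro y hy η
      have h1 : S.lam y = 0 := image_eq_zero_of_notMem_tsupport hy
      have h2 : fderiv ℝ S.lam y = 0 := by
        by_contra h
        exact hy (support_fderiv_subset ℝ h)
      simp [geodesicField, lamX, lamY, h1, h2]
    have near : ∀ y ∉ tsupport S.lam, ∀ᶠ v : PhasePoint in 𝓝 0, y + v.1 ∉ tsupport S.lam := by
      intro y hy
      have hcont : Continuous fun v : PhasePoint => y + v.1 := by fun_prop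
      exact hcont.tendsto' 0 y (by simp) ((isClosed_tsupport _).isOpen_compl.mem_nhds hy)
    have hy : ((max R 0 + 1, 0) : ℝ × ℝ) ∉ tsupport S.lam := by
      intro h
      have := hR h
      have h0 := le_max_right R 0
      have h1 := le_max_left R 0
      simp only [Metric.mem_closedBall, dist_zero_right, Prod.norm_def, norm_zero,
        Real.norm_eq_abs, abs_of_nonneg (by linarith : 0 ≤ max R 0 + 1)] at this
      have := (le_max_left _ _).trans this
      linarith
    refine ⟨((max R 0 + 1, 0), θ + n * (2 * Real.pi)), ⟨?_, hn⟩, ?_⟩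
    · have h0 := le_max_right R 0
      simp [Prod.norm_def, abs_of_nonneg (by linarith : 0 ≤ max R 0 + 1)]
      linarith
    · filter_upwards [near x hx, near _ hy] with v h1 h2
      change S.geodesicField (x + v.1, θ + v.2) =
        S.geodesicField ((max R 0 + 1, 0) + v.1, θ + n * (2 * Real.pi) + v.2)
      rw [far _ h1, add_right_comm, geodesicField_add_int_period, far _ h2]

/-- The geodesic flow on the whole plane, together with its derivative in the initial point. -/
structure FlowData where
  φ : PhasePoint → ℝ → PhasePoint
  A : PhasePoint → ℝ → PhasePoint →L[ℝ] PhasePoint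
  K : ℝ≥0
  L : ℝ≥0
  isFlow : IsGlobalFlow S.geodesicField φ
  lipschitz : LipschitzWith K S.geodesicField
  norm_le : ∀ p, ‖S.geodesicField p‖ ≤ L
  hasFDerivAt : ∀ p t, HasFDerivAt (fun q => φ q t) (A p t) p
  continuous_A : Continuous fun q : PhasePoint × ℝ => A q.1 q.2

theorem nonempty_flowData (hc : HasCompactSupport S.lam) : Nonempty S.FlowData := by
  obtain ⟨C, hC, hg⟩ := S.geodesicField_germs hc
  obtain ⟨K, K', L, hK, hK', hL⟩ := exists_lipschitz_of_germs S.contDiff_geodesicField hC hg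
  obtain ⟨φ, hφ⟩ := exists_isGlobalFlow hK hL
  obtain ⟨A, hA, hAc⟩ := hφ.exists_hasFDerivAt hK
    (fun x => (S.contDiff_geodesicField.differentiable (by simp) x).hasFDerivAt) hK'
  exact ⟨⟨φ, A, K, L, hφ, hK, hL, hA, hAc⟩⟩

/-- Multiplication by a bump function equal to one near `M` does not change `λ` there, while it
provides the global bounds needed for the flow on the whole plane. -/
theorem exists_hasCompactSupport : ∃ S' : IsothermalSurface, S'.rho = S.rho ∧
    HasCompactSupport S'.lam ∧ ∀ x ∈ S.carrier, S'.lam =ᶠ[𝓝 x] S.lam := by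
  obtain ⟨R, hR⟩ := S.isCompact.isBounded.subset_ball 0
  have hR' : (0 : ℝ) < max R 1 := by positivity
  let χ : ContDiffBump (0 : ℝ × ℝ) := ⟨max R 1, max R 1 + 1, hR', by linarith⟩
  refine ⟨⟨S.rho, fun x => χ x * S.lam x, S.rho_smooth, χ.contDiff.mul S.lam_smooth, S.isCompact,
    S.regular⟩, rfl, χ.hasCompactSupport.mul_right, fun x hx => ?_⟩
  have : Metric.ball (0 : ℝ × ℝ) (max R 1) ∈ 𝓝 x :=
    Metric.isOpen_ball.mem_nhds (Metric.ball_subset_ball (le_max_left _ _) (hR hx))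
  filter_upwards [this] with y hy
  rw [χ.one_of_mem_closedBall (Metric.ball_subset_closedBall hy), one_mul]

/-- `S'` is the surface `S` with another extension of the conformal factor. -/
structure Agrees (S S' : IsothermalSurface) : Prop where
  rho : S'.rho = S.rho
  lam : ∀ x ∈ S.carrier, S'.lam =ᶠ[𝓝 x] S.lam

/-! ### Independence of the extension of the conformal factor -/

namespace Agrees

variable {S} {S' : IsothermalSurface}

theorem carrier (h : Agrees S S') : S'.carrier = S.carrier := by
  simp [IsothermalSurface.carrier, h.rho]

theorem inner (h : Agrees S S') : S'.inner = S.inner := by simp [IsothermalSurface.inner, h.rho]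

theorem bdry (h : Agrees S S') : S'.bdry = S.bdry := by simp [IsothermalSurface.bdry, h.rho]

theorem SM (h : Agrees S S') : S'.SM = S.SM := by simp [IsothermalSurface.SM, h.carrier]

theorem rhoLift (h : Agrees S S') : S'.rhoLift = S.rhoLift := by
  funext p; simp [IsothermalSurface.rhoLift, h.rho]

theorem geodesicField (h : Agrees S S') {p : PhasePoint} (hp : p ∈ S.SM) :
    S'.geodesicField p = S.geodesicField p := by
  have h1 := h.lam p.1 hp
  simp [IsothermalSurface.geodesicField, lamX, lamY, h1.fderiv_eq, h1.eq_of_nhds]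

theorem transverseField (h : Agrees S S') {p : PhasePoint} (hp : p ∈ S.SM) :
    S'.transverseField p = S.transverseField p := by
  have h1 := h.lam p.1 hp
  simp [IsothermalSurface.transverseField, lamX, lamY, h1.fderiv_eq, h1.eq_of_nhds]

theorem isGeodesicArc (h : Agrees S S') : S'.IsGeodesicArc = S.IsGeodesicArc := by
  funext p T γ
  simp only [IsGeodesicArc, h.SM]
  refine propext (and_congr_right fun _ => and_congr_right fun hγ => ?_)
  exact forall₂_congr fun t ht => by rw [h.geodesicField (hγ t ht)]

theorem arcLengths (h : Agrees S S') : S'.arcLengths = S.arcLengths := by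
  funext p; simp only [IsothermalSurface.arcLengths, h.isGeodesicArc]

theorem exitTime (h : Agrees S S') : S'.exitTime = S.exitTime := by
  funext p; simp only [IsothermalSurface.exitTime, h.arcLengths]

theorem geodesic (h : Agrees S S') : S'.geodesic = S.geodesic := by
  funext p
  have h1 := h.isGeodesicArc
  have h2 := h.exitTime
  unfold IsothermalSurface.geodesic
  -- The orbit is chosen from an existence proof that depends on the arc predicate and the exit
  -- time; substituting these as variables makes the two choices syntactically equal.
  generalize S'.IsGeodesicArc = P at h1 ⊢
  generalize S'.exitTime = τ at h2 ⊢
  subst h1 h2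
  rfl

theorem transport (h : Agrees S S') : S'.transport = S.transport := by
  funext f p; simp only [IsothermalSurface.transport, h.geodesic, h.exitTime]

theorem xperp (h : Agrees S S') : S'.Xperp = S.Xperp := by
  funext u p
  simp only [Xperp, h.SM]
  by_cases hp : p ∈ S.SM
  · rw [h.transverseField hp]
  -- Off `S.SM` the two transverse fields may differ, but there the derivative within the closed set
  -- `S.SM` takes the default value zero.
  · rw [fderivWithin_zero_of_notMem_closure (by rwa [S.isClosed_SM.closure_eq])]
    rfl

theorem omega (h : Agrees S S') (k : ℤ) : S'.Omega k = S.Omega k := by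
  simp only [Omega, IsSmooth, vert, h.SM]

theorem omegaZero (h : Agrees S S') (k : ℤ) : S'.OmegaZero k = S.OmegaZero k := by
  simp only [OmegaZero, h.omega, h.bdry]

theorem lieX_rhoLift (h : Agrees S S') {p : PhasePoint} (hp : p ∈ S.SM) :
    S'.lieX S'.rhoLift p = S.lieX S.rhoLift p := by
  simp only [lieX, h.rhoLift, h.geodesicField hp]

/-- The second derivative along `X` differentiates the coefficients of the field, which is why the
two conformal factors have to agree near each point of `M` and not just on `M`. -/
theorem lieX_lieX_rhoLift (h : Agrees S S') {p : PhasePoint} (hp : p ∈ S.SM) :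
    S'.lieX (S'.lieX S'.rhoLift) p = S.lieX (S.lieX S.rhoLift) p := by
  have h1 : ∀ᶠ y in 𝓝 p.1, S'.lam =ᶠ[𝓝 y] S.lam := eventually_eventually_nhds.2 (h.lam p.1 hp)
  have h2 : S'.lieX S'.rhoLift =ᶠ[𝓝 p] S.lieX S.rhoLift := by
    filter_upwards [continuous_fst.continuousAt.eventually h1] with q hq
    simp [lieX, h.rhoLift, IsothermalSurface.geodesicField, lamX, lamY, hq.fderiv_eq,
      hq.eq_of_nhds]
  rw [lieX, h2.fderiv_eq, h.geodesicField hp, lieX]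

theorem nonTrapping (h : Agrees S S') (hS : S.NonTrapping) : S'.NonTrapping := by
  simpa only [NonTrapping, h.arcLengths, h.SM] using hS

theorem strictlyConvexBoundary (h : Agrees S S') (hS : S.StrictlyConvexBoundary) :
    S'.StrictlyConvexBoundary := by
  intro p hp h0
  rw [h.bdry] at hp
  have hp' : p ∈ S.SM := show 0 ≤ S.rho p.1 from le_of_eq (Eq.symm hp)
  rw [h.lieX_rhoLift hp'] at h0
  rw [h.lieX_lieX_rhoLift hp']
  exact hS p hp h0

theorem vol (h : Agrees S S') : S'.vol = S.vol := by
  rw [IsothermalSurface.vol, IsothermalSurface.vol, h.carrier]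
  refine withDensity_congr_ae ?_
  refine (ae_restrict_iff' (S.isClosed_carrier.measurableSet.prod measurableSet_Ioc)).2
    (Eventually.of_forall fun p hp => ?_)
  simp only [(h.lam p.1 hp.1).eq_of_nhds]

end Agrees

theorem exists_agrees : ∃ S' : IsothermalSurface, Agrees S S' ∧ HasCompactSupport S'.lam := by
  obtain ⟨S', h1, h2, h3⟩ := S.exists_hasCompactSupport
  exact ⟨S', ⟨h1, h3⟩, h2⟩

end IsothermalSurface

/-! ### Exit times on a non-trapping surface with strictly convex boundary -/

namespace IsothermalSurface

variable {S : IsothermalSurface}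

/-- `X ρ`. -/
noncomputable def rhoDot (S : IsothermalSurface) : PhasePoint → ℝ := S.lieX S.rhoLift

/-- `X² ρ`. -/
noncomputable def rhoDDot (S : IsothermalSurface) : PhasePoint → ℝ := S.lieX S.rhoDot

theorem contDiff_rhoDot : ContDiff ℝ ∞ S.rhoDot := S.contDiff_lieX S.contDiff_rhoLift

theorem contDiff_rhoDDot : ContDiff ℝ ∞ S.rhoDDot := S.contDiff_lieX contDiff_rhoDot

theorem rhoDot_eq (p : PhasePoint) : S.rhoDot p = fderiv ℝ S.rho p.1 (S.geodesicField p).1 := by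
  have h : HasFDerivAt S.rhoLift ((fderiv ℝ S.rho p.1) ∘L (ContinuousLinearMap.fst ℝ (ℝ × ℝ) ℝ)) p :=
    ((S.rho_smooth.differentiable (by simp) p.1).hasFDerivAt).comp p hasFDerivAt_fst
  simp [rhoDot, lieX, h.fderiv]

theorem rhoDot_flip (p : PhasePoint) : S.rhoDot (flip p) = -S.rhoDot p := by
  rw [rhoDot_eq, geodesicField_flip, rhoDot_eq]
  simp [flip]

theorem exitTime_nonneg (S : IsothermalSurface) (p : PhasePoint) : 0 ≤ S.exitTime p :=
  Real.sSup_nonneg fun _ h => h.1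

namespace FlowData

theorem continuous_φ (D : S.FlowData) : Continuous fun q : PhasePoint × ℝ => D.φ q.1 q.2 :=
  D.isFlow.continuous_uncurry D.lipschitz

theorem hasDerivAt_comp (D : S.FlowData) {u : PhasePoint → ℝ} (hu : ContDiff ℝ ∞ u) (p : PhasePoint) (t : ℝ) :
    HasDerivAt (fun s => u (D.φ p s)) (S.lieX u (D.φ p t)) t :=
  (hu.differentiable (by simp) (D.φ p t)).hasFDerivAt.comp_hasDerivAt t (D.isFlow.hasDerivAt p t)

theorem φ_zero (D : S.FlowData) (p : PhasePoint) : D.φ p 0 = p := D.isFlow.zero p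

theorem φ_add (D : S.FlowData) (p : PhasePoint) (s t : ℝ) : D.φ p (s + t) = D.φ (D.φ p s) t :=
  D.isFlow.map_add D.lipschitz p s t

theorem φ_add_period (D : S.FlowData) (p : PhasePoint) (n : ℤ) (t : ℝ) :
    D.φ (p.1, p.2 + n * (2 * Real.pi)) t = ((D.φ p t).1, (D.φ p t).2 + n * (2 * Real.pi)) := by
  have := D.isFlow.eq_of_hasDerivAt D.lipschitz
    (γ := fun t => D.φ p t + (0, n * (2 * Real.pi))) (fun t => ?_)
  · have h := congrFun this t
    simp only [φ_zero] at h
    have e : p + ((0 : ℝ × ℝ), (n : ℝ) * (2 * Real.pi)) = (p.1, p.2 + n * (2 * Real.pi)) := by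
      ext <;> simp
    rw [e] at h
    rw [← h]
    ext <;> simp
  · have h1 := (D.isFlow.hasDerivAt p t).add_const ((0 : ℝ × ℝ), (n : ℝ) * (2 * Real.pi))
    have h2 := S.geodesicField_add_int_period (D.φ p t).1 (D.φ p t).2 n
    have e : D.φ p t + ((0 : ℝ × ℝ), (n : ℝ) * (2 * Real.pi)) =
      ((D.φ p t).1, (D.φ p t).2 + n * (2 * Real.pi)) := by ext <;> simp
    rw [e, h2]
    exact h1

/-- Reversing the unit vector negates `X`, so it traverses the same geodesic backwards. -/
theorem φ_flip (D : S.FlowData) (p : PhasePoint) (t : ℝ) : D.φ (flip p) t = flip (D.φ p (-t)) := by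
  have := D.isFlow.eq_of_hasDerivAt D.lipschitz
    (γ := fun t => D.φ p (-t) + (0, Real.pi)) (fun t => ?_)
  · have h := congrFun this t
    simp only [neg_zero, φ_zero] at h
    have e : p + ((0 : ℝ × ℝ), Real.pi) = flip p := by ext <;> simp [flip]
    rw [e] at h
    rw [← h]
    ext <;> simp [flip]
  · have h1 := (D.isFlow.reverse.hasDerivAt p t).add_const ((0 : ℝ × ℝ), Real.pi)
    have e : D.φ p (-t) + ((0 : ℝ × ℝ), Real.pi) = flip (D.φ p (-t)) := by ext <;> simp [flip]
    rw [e, S.geodesicField_flip]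
    exact h1

theorem eqOn_of_isGeodesicArc (D : S.FlowData) {p : PhasePoint} {T : ℝ} {γ : ℝ → PhasePoint}
    (h : S.IsGeodesicArc p T γ) : EqOn γ (D.φ p) (Icc 0 T) := by
  have := D.isFlow.eqOn_of_hasDerivWithinAt D.lipschitz h.2.2
  rwa [h.1] at this

theorem isGeodesicArc (D : S.FlowData) {p : PhasePoint} {T : ℝ} (h : ∀ t ∈ Icc 0 T, D.φ p t ∈ S.SM) :
    S.IsGeodesicArc p T (D.φ p) :=
  ⟨D.φ_zero p, h, fun t _ => (D.isFlow.hasDerivAt p t).hasDerivWithinAt⟩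

/-- By uniqueness every geodesic arc is a piece of the global orbit, so the choice of `γ` plays no
role. -/
theorem mem_arcLengths (D : S.FlowData) {p : PhasePoint} {T : ℝ} :
    T ∈ S.arcLengths p ↔ 0 ≤ T ∧ ∀ t ∈ Icc 0 T, D.φ p t ∈ S.SM := by
  refine and_congr_right fun hT => ⟨fun ⟨γ, hγ⟩ t ht => ?_, fun h => ⟨_, D.isGeodesicArc h⟩⟩
  rw [← D.eqOn_of_isGeodesicArc hγ ht]
  exact hγ.2.1 t ht

theorem le_exitTime (D : S.FlowData) (hnt : S.NonTrapping) {p : PhasePoint} (hp : p ∈ S.SM) {T : ℝ} (hT : 0 ≤ T)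
    (h : ∀ t ∈ Icc 0 T, D.φ p t ∈ S.SM) : T ≤ S.exitTime p :=
  le_csSup (hnt p hp) (D.mem_arcLengths.2 ⟨hT, h⟩)

theorem zero_mem_arcLengths (D : S.FlowData) {p : PhasePoint} (hp : p ∈ S.SM) : 0 ∈ S.arcLengths p := by
  refine D.mem_arcLengths.2 ⟨le_rfl, fun t ht => ?_⟩
  rw [le_antisymm ht.2 ht.1, D.φ_zero]
  exact hp

theorem φ_mem_of_lt (D : S.FlowData) {p : PhasePoint} (hp : p ∈ S.SM) {t : ℝ} (h0 : 0 ≤ t)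
    (ht : t < S.exitTime p) : D.φ p t ∈ S.SM := by
  obtain ⟨T, hT, h⟩ := exists_lt_of_lt_csSup ⟨0, D.zero_mem_arcLengths hp⟩ ht
  exact (D.mem_arcLengths.1 hT).2 t ⟨h0, h.le⟩

theorem φ_mem (D : S.FlowData) {p : PhasePoint} (hp : p ∈ S.SM) {t : ℝ} (ht : t ∈ Icc 0 (S.exitTime p)) :
    D.φ p t ∈ S.SM := by
  rcases ht.1.eq_or_lt with h0 | h0
  · rw [← h0, D.φ_zero]; exact hp
  have hτ : 0 < S.exitTime p := h0.trans_le ht.2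
  have hcl : closure (Ico 0 (S.exitTime p)) ⊆ D.φ p ⁻¹' S.SM :=
    (S.isClosed_SM.preimage (D.isFlow.continuous_right p)).closure_subset_iff.2
      fun s hs => D.φ_mem_of_lt hp hs.1 hs.2
  rw [closure_Ico hτ.ne] at hcl
  exact hcl ht

theorem isGeodesicArc_exitTime (D : S.FlowData) {p : PhasePoint} (hp : p ∈ S.SM) :
    S.IsGeodesicArc p (S.exitTime p) (D.φ p) := D.isGeodesicArc fun _ ht => D.φ_mem hp ht

theorem geodesic_eqOn (D : S.FlowData) {p : PhasePoint} (hp : p ∈ S.SM) :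
    EqOn (S.geodesic p) (D.φ p) (Icc 0 (S.exitTime p)) := by
  have h : ∃ γ, S.IsGeodesicArc p (S.exitTime p) γ := ⟨_, D.isGeodesicArc_exitTime hp⟩
  rw [geodesic, dif_pos h]
  exact D.eqOn_of_isGeodesicArc h.choose_spec

theorem transport_eq (D : S.FlowData) (f : PhasePoint → ℂ) {p : PhasePoint} (hp : p ∈ S.SM) :
    S.transport f p = ∫ t in (0 : ℝ)..(S.exitTime p), f (D.φ p t) := by
  refine intervalIntegral.integral_congr fun t ht => ?_
  rw [uIcc_of_le (S.exitTime_nonneg p)] at ht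
  simp only [D.geodesic_eqOn hp ht]

theorem exitTime_φ (D : S.FlowData) (hnt : S.NonTrapping) {p : PhasePoint} (hp : p ∈ S.SM) {s : ℝ}
    (hs : s ∈ Icc 0 (S.exitTime p)) : S.exitTime (D.φ p s) = S.exitTime p - s := by
  have hps := D.φ_mem hp hs
  refine le_antisymm ?_ ?_
  · have h0 := S.exitTime_nonneg (D.φ p s)
    have := D.le_exitTime hnt hp (T := s + S.exitTime (D.φ p s)) (by linarith [hs.1]) fun t ht => ?_
    · linarith
    · rcases le_total t s with h | h
      · exact D.φ_mem hp ⟨ht.1, h.trans hs.2⟩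
      · have := D.φ_mem hps (t := t - s) ⟨by linarith, by linarith [ht.2]⟩
        rwa [← D.φ_add, add_sub_cancel] at this
  · refine D.le_exitTime hnt hps (by linarith [hs.2]) fun t ht => ?_
    rw [← D.φ_add]
    exact D.φ_mem hp ⟨by linarith [hs.1, ht.1], by linarith [ht.2]⟩

theorem hasDerivAt_rho (D : S.FlowData) (p : PhasePoint) (t : ℝ) :
    HasDerivAt (fun s => S.rho (D.φ p s).1) (S.rhoDot (D.φ p t)) t :=
  D.hasDerivAt_comp S.contDiff_rhoLift p t

theorem hasDerivAt_rhoDot (D : S.FlowData) (p : PhasePoint) (t : ℝ) :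
    HasDerivAt (fun s => S.rhoDot (D.φ p s)) (S.rhoDDot (D.φ p t)) t :=
  D.hasDerivAt_comp contDiff_rhoDot p t

theorem rho_lt_of_rhoDot_neg (D : S.FlowData) {p : PhasePoint} {δ : ℝ} (hδ : 0 < δ)
    (h : ∀ t ∈ Ioo 0 δ, S.rhoDot (D.φ p t) < 0) : S.rho (D.φ p δ).1 < S.rho p.1 := by
  have := strictAntiOn_of_deriv_neg (convex_Icc 0 δ) (f := fun s => S.rho (D.φ p s).1)
    (fun t _ => (D.hasDerivAt_rho p t).continuousAt.continuousWithinAt)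
    (fun t ht => by rw [interior_Icc] at ht; rw [(D.hasDerivAt_rho p t).deriv]; exact h t ht)
    (left_mem_Icc.2 hδ.le) (right_mem_Icc.2 hδ.le) hδ
  simpa [D.φ_zero] using this

theorem continuous_rhoDot_φ (D : S.FlowData) (p : PhasePoint) : Continuous fun t => S.rhoDot (D.φ p t) :=
  continuous_iff_continuousAt.2 fun t => (D.hasDerivAt_rhoDot p t).continuousAt

/-- Along the orbit `ρ` falls below its initial value `0` at once: to first order if `Xρ < 0`, and
in the tangential case to second order, since strict convexity makes `X²ρ < 0`. -/
theorem exitTime_eq_zero_of_outflow (D : S.FlowData) (hconv : S.StrictlyConvexBoundary)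
    {p : PhasePoint} (hp : p ∈ S.outflow) : S.exitTime p = 0 := by
  have h0 : S.rho p.1 = 0 := hp.1
  have hpS : p ∈ S.SM := show 0 ≤ S.rho p.1 from h0.ge
  have key : ∃ δ > 0, ∀ t ∈ Ioo 0 δ, S.rhoDot (D.φ p t) < 0 := by
    have hle : S.rhoDot p ≤ 0 := hp.2
    rcases hle.lt_or_eq with h | h
    · have hc := (D.continuous_rhoDot_φ p).continuousAt (x := 0)
      have : ∀ᶠ t in 𝓝 (0 : ℝ), S.rhoDot (D.φ p t) < 0 :=
        hc.eventually_lt continuousAt_const (by simpa [D.φ_zero] using h)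
      obtain ⟨δ, hδ, hb⟩ := Metric.eventually_nhds_iff.1 this
      exact ⟨δ, hδ, fun t ht => hb (by simpa [abs_of_pos ht.1] using ht.2)⟩
    · have hb : S.rhoDDot p < 0 := hconv p hp.1 h
      have hc : ContinuousAt (fun t => S.rhoDDot (D.φ p t)) 0 :=
        (contDiff_rhoDDot.continuous.comp (D.isFlow.continuous_right p)).continuousAt
      have : ∀ᶠ t in 𝓝 (0 : ℝ), S.rhoDDot (D.φ p t) < 0 :=
        hc.eventually_lt continuousAt_const (by simpa [D.φ_zero] using hb)
      obtain ⟨δ, hδ, hb⟩ := Metric.eventually_nhds_iff.1 this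
      refine ⟨δ, hδ, fun t ht => ?_⟩
      have := strictAntiOn_of_deriv_neg (convex_Icc 0 t) (f := fun s => S.rhoDot (D.φ p s))
        (D.continuous_rhoDot_φ p).continuousOn
        (fun s hs => by
          rw [interior_Icc] at hs
          rw [(D.hasDerivAt_rhoDot p s).deriv]
          exact hb (by simpa [abs_of_pos hs.1] using hs.2.trans ht.2))
        (left_mem_Icc.2 ht.1.le) (right_mem_Icc.2 ht.1.le) ht.1
      simpa [D.φ_zero, h] using this
  obtain ⟨δ, hδ, hneg⟩ := key
  by_contra hne
  have hpos : 0 < S.exitTime p := lt_of_le_of_ne (S.exitTime_nonneg p) (Ne.symm hne)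
  have hm : 0 < min δ (S.exitTime p) := lt_min hδ hpos
  have h1 := D.rho_lt_of_rhoDot_neg hm fun t ht => hneg t ⟨ht.1, ht.2.trans_le (min_le_left _ _)⟩
  have h2 : 0 ≤ S.rho (D.φ p (min δ (S.exitTime p))).1 := D.φ_mem hpS ⟨hm.le, min_le_right _ _⟩
  linarith

theorem exitTime_pos (D : S.FlowData) (hnt : S.NonTrapping) {p : PhasePoint} (hp : p ∈ S.SM)
    (h : 0 < S.rho p.1 ∨ 0 < S.rhoDot p) : 0 < S.exitTime p := by
  have key : ∃ δ > 0, ∀ t ∈ Icc 0 δ, D.φ p t ∈ S.SM := by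
    rcases h with h | h
    · have hc : ContinuousAt (fun t => S.rho (D.φ p t).1) 0 := (D.hasDerivAt_rho p 0).continuousAt
      have : ∀ᶠ t in 𝓝 (0 : ℝ), 0 < S.rho (D.φ p t).1 :=
        continuousAt_const.eventually_lt hc (by simpa [D.φ_zero] using h)
      obtain ⟨δ, hδ, hb⟩ := Metric.eventually_nhds_iff.1 this
      exact ⟨δ / 2, by positivity, fun t ht =>
        (hb (by rw [dist_zero_right, Real.norm_eq_abs, abs_of_nonneg ht.1]; linarith [ht.2])).le⟩
    · have hc := (D.continuous_rhoDot_φ p).continuousAt (x := 0)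
      have : ∀ᶠ t in 𝓝 (0 : ℝ), 0 < S.rhoDot (D.φ p t) :=
        continuousAt_const.eventually_lt hc (by simpa [D.φ_zero] using h)
      obtain ⟨δ, hδ, hb⟩ := Metric.eventually_nhds_iff.1 this
      refine ⟨δ / 2, by positivity, fun t ht => ?_⟩
      have := monotoneOn_of_deriv_nonneg (convex_Icc 0 t) (f := fun s => S.rho (D.φ p s).1)
        (fun t _ => (D.hasDerivAt_rho p t).continuousAt.continuousWithinAt)
        (fun t _ => (D.hasDerivAt_rho p t).differentiableAt.differentiableWithinAt)
        (fun s hs => by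
          rw [interior_Icc] at hs
          rw [(D.hasDerivAt_rho p s).deriv]
          exact (hb (by
            rw [dist_zero_right, Real.norm_eq_abs, abs_of_pos hs.1]
            linarith [hs.2, ht.2])).le)
        (left_mem_Icc.2 ht.1) (right_mem_Icc.2 ht.1) ht.1
      simp only [D.φ_zero] at this
      exact le_trans (show 0 ≤ S.rho p.1 from hp) this
  obtain ⟨δ, hδ, h⟩ := key
  exact hδ.trans_le (D.le_exitTime hnt hp hδ.le h)

theorem outflow_of_exitTime_eq_zero (D : S.FlowData) (hnt : S.NonTrapping) {p : PhasePoint} (hp : p ∈ S.SM)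
    (h : S.exitTime p = 0) : p ∈ S.outflow := by
  refine ⟨le_antisymm (not_lt.1 fun h0 => ?_) hp, not_lt.1 fun h0 => ?_⟩
  · exact (D.exitTime_pos hnt hp (.inl h0)).ne' h
  · exact (D.exitTime_pos hnt hp (.inr h0)).ne' h

theorem exit_mem_outflow (D : S.FlowData) (hnt : S.NonTrapping) {p : PhasePoint} (hp : p ∈ S.SM) :
    D.φ p (S.exitTime p) ∈ S.outflow := by
  have hτ := right_mem_Icc.2 (S.exitTime_nonneg p)
  exact D.outflow_of_exitTime_eq_zero hnt (D.φ_mem hp hτ) (by rw [D.exitTime_φ hnt hp hτ, sub_self])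

/-- Touching the boundary before the exit would be a local minimum of `ρ` along the orbit, hence
tangential. By convexity the remaining exit time would then be zero. -/
theorem φ_mem_inner (D : S.FlowData) (hnt : S.NonTrapping) (hconv : S.StrictlyConvexBoundary) {p : PhasePoint}
    (hp : p.1 ∈ S.inner) {t : ℝ} (ht : t ∈ Ico 0 (S.exitTime p)) : (D.φ p t).1 ∈ S.inner := by
  have hpS : p ∈ S.SM := S.inner_subset_carrier hp
  have hmem := D.φ_mem hpS (Ico_subset_Icc_self ht)
  have hmem' : 0 ≤ S.rho (D.φ p t).1 := hmem
  refine lt_of_le_of_ne hmem' fun h0 => ?_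
  have ht0 : 0 < t := by
    refine lt_of_le_of_ne ht.1 fun h => ?_
    rw [← h, D.φ_zero] at h0
    exact (show 0 < S.rho p.1 from hp).ne h0
  have hmin : IsLocalMin (fun s => S.rho (D.φ p s).1) t := by
    filter_upwards [Ioo_mem_nhds ht0 ht.2] with s hs
    rw [← h0]
    exact D.φ_mem hpS (Ioo_subset_Icc_self hs)
  have h1 := hmin.hasDerivAt_eq_zero (D.hasDerivAt_rho p t)
  have h2 := D.exitTime_eq_zero_of_outflow hconv (p := D.φ p t) ⟨h0.symm, h1.le⟩
  rw [D.exitTime_φ hnt hpS (Ico_subset_Icc_self ht)] at h2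
  linarith [ht.2]

/-- If the exit were tangential, the reversed exit vector would also be in the outflow boundary and
would leave at once; but it runs back along the given geodesic inside `M` for a positive time. -/
theorem rhoDot_exit_neg (D : S.FlowData) (hnt : S.NonTrapping) (hconv : S.StrictlyConvexBoundary) {p : PhasePoint}
    (hp : p.1 ∈ S.inner) : S.rhoDot (D.φ p (S.exitTime p)) < 0 := by
  have hpS : p ∈ S.SM := S.inner_subset_carrier hp
  have hτ : 0 < S.exitTime p := D.exitTime_pos hnt hpS (.inl hp)
  have hout := D.exit_mem_outflow hnt hpS
  refine lt_of_le_of_ne hout.2 fun h => ?_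
  set e := D.φ p (S.exitTime p) with he
  have hfl : flip e ∈ S.outflow := ⟨hout.1, by
    change S.rhoDot (flip e) ≤ 0
    rw [rhoDot_flip, h, neg_zero]⟩
  have h0 := D.exitTime_eq_zero_of_outflow hconv hfl
  have h1 : S.exitTime p ≤ S.exitTime (flip e) := by
    refine D.le_exitTime hnt (p := flip e) (show 0 ≤ S.rho e.1 from hout.1.ge) hτ.le fun t ht => ?_
    rw [D.φ_flip, he, ← D.φ_add]
    exact D.φ_mem hpS (t := S.exitTime p + -t) ⟨by linarith [ht.2], by linarith [ht.1]⟩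
  linarith

theorem exitTime_add_period (D : S.FlowData) (p : PhasePoint) (n : ℤ) :
    S.exitTime (p.1, p.2 + n * (2 * Real.pi)) = S.exitTime p := by
  have : S.arcLengths (p.1, p.2 + n * (2 * Real.pi)) = S.arcLengths p := by
    ext T
    rw [D.mem_arcLengths, D.mem_arcLengths]
    simp only [φ_add_period, SM, Set.mem_ofPred_eq]
  rw [exitTime, this, exitTime]

theorem exists_exit (D : S.FlowData) (hnt : S.NonTrapping) {p : PhasePoint} (hp : p ∈ S.SM) :
    ∃ T > 0, S.rho (D.φ p T).1 < 0 := by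
  by_contra! h
  have h0 := S.exitTime_nonneg p
  have := D.le_exitTime hnt hp (T := S.exitTime p + 1) (by linarith) fun t ht => ?_
  · linarith
  · rcases ht.1.eq_or_lt with h1 | h1
    · rw [← h1, D.φ_zero]; exact hp
    · exact h t h1

theorem exitTime_le_of_rho_neg (D : S.FlowData) {p : PhasePoint} (hp : p ∈ S.SM) {T : ℝ}
    (hT : 0 ≤ T) (h : S.rho (D.φ p T).1 < 0) : S.exitTime p ≤ T := by
  by_contra! hlt
  exact not_le.2 h (D.φ_mem hp ⟨hT, hlt.le⟩)

/-- Having `ρ < 0` at some time `T` is an open condition on the initial vector, and it bounds the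
exit time by `T`; compactness modulo the period `2π` makes the bound uniform. -/
theorem exists_exitTime_le (D : S.FlowData) (hnt : S.NonTrapping) : ∃ T > 0, ∀ p ∈ S.SM, S.exitTime p ≤ T := by
  have hK : IsCompact (S.carrier ×ˢ Icc 0 (2 * Real.pi)) := IsCompact.prod S.isCompact isCompact_Icc
  have key : ∃ T, ∀ p ∈ S.carrier ×ˢ Icc 0 (2 * Real.pi), p ∈ S.SM → S.exitTime p ≤ T := by
    refine hK.induction_on (p := fun s => ∃ T, ∀ p ∈ s, p ∈ S.SM → S.exitTime p ≤ T) ⟨0, by simp⟩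
      (fun s t hst ⟨T, hT⟩ => ⟨T, fun p hp => hT p (hst hp)⟩)
      (fun s t ⟨T, hT⟩ ⟨T', hT'⟩ => ⟨max T T', fun p hp hS => ?_⟩) fun p hp => ?_
    · rcases hp with hp | hp
      · exact (hT p hp hS).trans (le_max_left _ _)
      · exact (hT' p hp hS).trans (le_max_right _ _)
    · obtain ⟨T, hT, h⟩ := D.exists_exit hnt (p := p) hp.1
      have hc : Continuous fun q => S.rho (D.φ q T).1 :=
        S.rho_smooth.continuous.comp (continuous_fst.comp
          (D.continuous_φ.comp (f := fun q => (q, T)) (by fun_prop)))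
      refine ⟨{q | S.rho (D.φ q T).1 < 0},
        mem_nhdsWithin_of_mem_nhds ((isOpen_lt hc continuous_const).mem_nhds h),
        T, fun q hq hS => D.exitTime_le_of_rho_neg hS hT.le hq⟩
  obtain ⟨T, hT⟩ := key
  refine ⟨max T 1, by positivity, fun p hp => le_trans ?_ (le_max_left _ _)⟩
  obtain ⟨n, hn⟩ := exists_int_add_mem_Icc p.2
  rw [← D.exitTime_add_period p n]
  exact hT _ ⟨hp, hn⟩ hp

end FlowData

end IsothermalSurface

/-! ### Parametric integrals and a compactness inequality -/

section Parametric

variable {E F : Type*} [NormedAddCommGroup E] [NormedSpace ℝ E] [ProperSpace E]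
  [NormedAddCommGroup F] [NormedSpace ℝ F]

theorem exists_bound_nhds_of_continuousOn {E F : Type*} [NormedAddCommGroup E] [ProperSpace E]
    [NormedAddCommGroup F] {U : Set E} (hU : IsOpen U) {G : E → ℝ → F} {a b : ℝ}
    (hG : ContinuousOn (fun q : E × ℝ => G q.1 q.2) (U ×ˢ Icc a b)) {p : E} (hp : p ∈ U) :
    ∃ r > 0, Metric.ball p r ⊆ U ∧ ∃ M, ∀ q ∈ Metric.ball p r, ∀ s ∈ Icc a b, ‖G q s‖ ≤ M := by
  obtain ⟨r, hr, hrU⟩ := Metric.nhds_basis_closedBall.mem_iff.1 (hU.mem_nhds hp)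
  obtain ⟨M, hM⟩ := ((isCompact_closedBall p r).prod isCompact_Icc).exists_bound_of_continuousOn
    (hG.mono (prod_mono hrU (subset_refl (Icc a b))))
  exact ⟨r, hr, Metric.ball_subset_closedBall.trans hrU, M,
    fun q hq s hs => hM (q, s) ⟨Metric.ball_subset_closedBall hq, hs⟩⟩

theorem continuousOn_intervalIntegral_of_continuousOn {E : Type*} [NormedAddCommGroup E]
    [ProperSpace E] {U : Set E} (hU : IsOpen U) {G : E → ℝ → F}
    {a b : ℝ} (hab : a ≤ b) (hG : ContinuousOn (fun q : E × ℝ => G q.1 q.2) (U ×ˢ Icc a b)) :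
    ContinuousOn (fun q => ∫ s in a..b, G q s) U := by
  intro p hp
  obtain ⟨r, hr, hrU, M, hM⟩ := exists_bound_nhds_of_continuousOn hU hG hp
  refine ContinuousAt.continuousWithinAt ?_
  refine intervalIntegral.continuousAt_of_dominated_interval (bound := fun _ => M) ?_ ?_ (by simp) ?_
  · filter_upwards [hU.mem_nhds hp] with q hq
    rw [uIoc_of_le hab]
    exact ((hG.comp (f := fun s => (q, s)) (by fun_prop)
      (fun s hs => ⟨hq, hs⟩)).mono Ioc_subset_Icc_self).aestronglyMeasurable measurableSet_Ioc
  · filter_upwards [Metric.ball_mem_nhds p hr] with q hq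
    refine Eventually.of_forall fun s hs => hM q hq s ?_
    rw [uIoc_of_le hab] at hs
    exact Ioc_subset_Icc_self hs
  · refine Eventually.of_forall fun s hs => ?_
    rw [uIoc_of_le hab] at hs
    have : ContinuousOn (fun q => G q s) U := hG.comp (f := fun q => (q, s)) (by fun_prop)
      (fun q hq => ⟨hq, Ioc_subset_Icc_self hs⟩)
    exact this.continuousAt (hU.mem_nhds hp)

/-- Differentiability of the integrand is asked only at interior times: in the application the
time-one point lies on `∂M`, where `f` has only a one-sided derivative. -/
theorem hasFDerivAt_intervalIntegral_of_continuousOn {U : Set E} (hU : IsOpen U) {G : E → ℝ → F}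
    {G' : E → ℝ → E →L[ℝ] F} {a b : ℝ} (hab : a ≤ b)
    (hG : ContinuousOn (fun q : E × ℝ => G q.1 q.2) (U ×ˢ Icc a b))
    (hG' : ContinuousOn (fun q : E × ℝ => G' q.1 q.2) (U ×ˢ Icc a b))
    (hd : ∀ q ∈ U, ∀ s ∈ Ioo a b, HasFDerivAt (fun q => G q s) (G' q s) q) {p : E} (hp : p ∈ U) :
    HasFDerivAt (fun q => ∫ s in a..b, G q s) (∫ s in a..b, G' p s) p := by
  obtain ⟨r, hr, hrU, M, hM⟩ := exists_bound_nhds_of_continuousOn hU hG' hp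
  have hslice : ∀ q ∈ U, ContinuousOn (G q) (Icc a b) := fun q hq =>
    hG.comp (f := fun s => (q, s)) (by fun_prop) (fun s hs => ⟨hq, hs⟩)
  have hslice' : ContinuousOn (G' p) (Icc a b) :=
    hG'.comp (f := fun s => (p, s)) (by fun_prop) (fun s hs => ⟨hp, hs⟩)
  refine intervalIntegral.hasFDerivAt_integral_of_dominated_of_fderiv_le (bound := fun _ => M)
    (F' := G') (Metric.ball_mem_nhds p hr) ?_ ?_ ?_ ?_ (by simp) ?_
  · filter_upwards [hU.mem_nhds hp] with q hq
    rw [uIoc_of_le hab]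
    exact ((hslice q hq).mono Ioc_subset_Icc_self).aestronglyMeasurable measurableSet_Ioc
  · exact (hslice p hp).intervalIntegrable_of_Icc hab
  · rw [uIoc_of_le hab]
    exact ((hslice').mono Ioc_subset_Icc_self).aestronglyMeasurable measurableSet_Ioc
  · refine Eventually.of_forall fun s hs q hq => hM q hq s ?_
    rw [uIoc_of_le hab] at hs
    exact Ioc_subset_Icc_self hs
  · have hb : ∀ᵐ s : ℝ, s ≠ b := by simp [ae_iff]
    filter_upwards [hb] with s hsb hs q hq
    rw [uIoc_of_le hab] at hs
    exact hd q (hrU hq) s ⟨hs.1, lt_of_le_of_ne hs.2 hsb⟩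

end Parametric

/-- On a compact set, a function that is positive on the zero set of `w ≥ 0` becomes positive after
adding a large multiple of `w`. -/
theorem IsCompact.exists_pos_le_add_mul {X : Type*} [TopologicalSpace X] {C : Set X}
    (hC : IsCompact C) {u w : X → ℝ} (hu : Continuous u) (hw : Continuous w)
    (hw0 : ∀ x ∈ C, 0 ≤ w x) (h : ∀ x ∈ C, w x = 0 → 0 < u x) :
    ∃ B c : ℝ, 0 < B ∧ 0 < c ∧ ∀ x ∈ C, c ≤ u x + B * w x := by
  have hcov : ∃ B c : ℝ, 0 < B ∧ 0 < c ∧ ∀ x ∈ C, x ∈ C → c ≤ u x + B * w x := by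
    refine hC.induction_on
      (p := fun s => ∃ B c : ℝ, 0 < B ∧ 0 < c ∧ ∀ x ∈ s, x ∈ C → c ≤ u x + B * w x)
      ⟨1, 1, one_pos, one_pos, by simp⟩
      (fun s t hst ⟨B, c, hB, hc, h⟩ => ⟨B, c, hB, hc, fun x hx => h x (hst hx)⟩)
      (fun s t ⟨B, c, hB, hc, h⟩ ⟨B', c', hB', hc', h'⟩ =>
        ⟨max B B', min c c', lt_max_of_lt_left hB, lt_min hc hc', fun x hx hxC => ?_⟩)
      fun x hx => ?_
    · have h0 := hw0 x hxC
      rcases hx with hx | hx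
      · have := h x hx hxC
        have := mul_le_mul_of_nonneg_right (le_max_left B B') h0
        linarith [min_le_left c c']
      · have := h' x hx hxC
        have := mul_le_mul_of_nonneg_right (le_max_right B B') h0
        linarith [min_le_right c c']
    · have : ∃ B c : ℝ, 0 < B ∧ 0 < c ∧ c < u x + B * w x := by
        rcases (hw0 x hx).eq_or_lt with h0 | h0
        · have := h x hx h0.symm
          exact ⟨1, u x / 2, one_pos, by positivity, by rw [← h0]; linarith⟩
        · refine ⟨(|u x| + 2) / w x, 1, by positivity, one_pos, ?_⟩
          rw [div_mul_cancel₀ _ h0.ne']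
          linarith [neg_abs_le (u x)]
      obtain ⟨B, c, hB, hc, hlt⟩ := this
      refine ⟨{y | c < u y + B * w y}, mem_nhdsWithin_of_mem_nhds
        ((isOpen_lt continuous_const (by fun_prop)).mem_nhds hlt), B, c, hB, hc,
        fun y hy _ => le_of_lt hy⟩
  obtain ⟨B, c, hB, hc, h⟩ := hcov
  exact ⟨B, c, hB, hc, fun x hx => h x hx hx⟩

/-! ### Unique differentiability up to the boundary, and the tangency estimate -/

namespace IsothermalSurface

variable {S : IsothermalSurface}

/-- At a boundary point the tangent cone contains the open half plane `dρ > 0`, which is nonempty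
because `dρ ≠ 0` and therefore spans the plane. This makes derivatives within `SM` meaningful up to
the boundary. -/
theorem uniqueDiffOn_carrier (S : IsothermalSurface) : UniqueDiffOn ℝ S.carrier := by
  intro x hx
  rcases (show 0 ≤ S.rho x from hx).eq_or_lt with h0 | h0
  swap
  · exact (S.isOpen_inner.uniqueDiffWithinAt h0).mono S.inner_subset_carrier
  have hd := (S.rho_smooth.differentiable (by simp) x).hasFDerivAt
  have hcone : {v | 0 < fderiv ℝ S.rho x v} ⊆ tangentConeAt ℝ S.carrier x := by
    intro v hv
    refine mem_tangentConeAt_of_add_smul_mem (α := ℝ) (l := 𝓝[>] 0) (c := id)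
      (tendsto_id'.mpr <| nhdsGT_le_nhdsNE 0) ?_
    have hline : HasDerivAt (fun t : ℝ => S.rho (x + t • v)) (fderiv ℝ S.rho x v) 0 := by
      have h1 : HasDerivAt (fun t : ℝ => x + t • v) v 0 := by
        simpa using! ((hasDerivAt_id (0 : ℝ)).smul_const v).const_add x
      have h2 : HasFDerivAt S.rho (fderiv ℝ S.rho x) (x + (0 : ℝ) • v) := by simpa using hd
      exact h2.comp_hasDerivAt (0 : ℝ) h1
    have h1 := (hasDerivAt_iff_tendsto_slope.1 hline).mono_left (nhdsGT_le_nhdsNE 0)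
    filter_upwards [h1.eventually (lt_mem_nhds hv), self_mem_nhdsWithin] with t ht ht0
    have ht0' : 0 < t := ht0
    rw [slope_def_field, zero_smul, add_zero, ← h0, sub_zero, sub_zero] at ht
    exact (div_pos_iff_of_pos_right ht0').1 ht |>.le
  refine ⟨?_, subset_closure hx⟩
  have hopen : IsOpen {v | 0 < fderiv ℝ S.rho x v} :=
    isOpen_lt continuous_const (fderiv ℝ S.rho x).continuous
  have hne : ∃ v, 0 < fderiv ℝ S.rho x v := by
    by_contra! hall
    refine S.regular x h0.symm (ContinuousLinearMap.ext fun v => ?_)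
    have h1 := hall v
    have h2 := hall (-v)
    rw [map_neg] at h2
    simp only [zero_apply]
    linarith
  have htop : Submodule.span ℝ (tangentConeAt ℝ S.carrier x) = ⊤ := by
    refine Submodule.eq_top_of_nonempty_interior' _ ?_
    obtain ⟨v, hv⟩ := hne
    exact ⟨v, interior_mono (hcone.trans Submodule.subset_span) (by rwa [hopen.interior_eq])⟩
  rw [htop]
  simp

theorem SM_eq (S : IsothermalSurface) : S.SM = S.carrier ×ˢ univ := by
  ext p; simp [SM]

theorem uniqueDiffOn_SM (S : IsothermalSurface) : UniqueDiffOn ℝ S.SM := by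
  rw [SM_eq]; exact S.uniqueDiffOn_carrier.prod uniqueDiffOn_univ

theorem SM_mem_nhds {p : PhasePoint} (hp : p.1 ∈ S.inner) : S.SM ∈ 𝓝 p :=
  mem_of_superset ((S.isOpen_inner.preimage continuous_fst).mem_nhds hp)
    fun _ hq => S.inner_subset_carrier hq

namespace FlowData

/-- The orbits in `SM` that start in a compact set stay in a compact set. -/
theorem exists_compact_orbits (D : S.FlowData) (hnt : S.NonTrapping) {P : Set PhasePoint}
    (hP : IsCompact P) : ∃ C ⊆ S.SM, IsCompact C ∧
      ∀ p ∈ P, p ∈ S.SM → ∀ t ∈ Icc 0 (S.exitTime p), D.φ p t ∈ C := by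
  obtain ⟨T, -, hT⟩ := D.exists_exitTime_le hnt
  refine ⟨(fun q : PhasePoint × ℝ => D.φ q.1 q.2) '' (P ×ˢ Icc 0 T) ∩ S.SM, inter_subset_right,
    ((hP.prod isCompact_Icc).image D.continuous_φ).inter_right S.isClosed_SM,
    fun p hp hS t ht => ⟨⟨(p, t), ⟨hp, ht.1, ht.2.trans (hT p hS)⟩, rfl⟩, D.φ_mem hS ht⟩⟩

/-- Geodesics that start close to the boundary or almost tangentially do not leave transversally
faster than they leave at all. -/
theorem exists_le_sq_rhoDot_exit (D : S.FlowData) (hnt : S.NonTrapping)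
    (hconv : S.StrictlyConvexBoundary) {P : Set PhasePoint} (hP : IsCompact P) :
    ∃ c > 0, ∀ p ∈ P, p ∈ S.SM →
      c * (S.rho p.1 + S.rhoDot p ^ 2) ≤ S.rhoDot (D.φ p (S.exitTime p)) ^ 2 := by
  obtain ⟨C, hCS, hC, horb⟩ := D.exists_compact_orbits hnt hP
  obtain ⟨T, hT0, hT⟩ := D.exists_exitTime_le hnt
  set r := S.rhoLift with hr
  set a := S.rhoDot with ha
  set b := S.rhoDDot with hb
  set d := S.lieX b with hd
  have hrc : ContDiff ℝ ∞ r := S.contDiff_rhoLift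
  have hac : ContDiff ℝ ∞ a := contDiff_rhoDot
  have hbc : ContDiff ℝ ∞ b := contDiff_rhoDDot
  have hdc : ContDiff ℝ ∞ d := S.contDiff_lieX hbc
  have hr0 : ∀ p ∈ C, 0 ≤ r p := fun p hp => hCS hp
  -- On `C` the weight `ρ + (Xρ)²` vanishes exactly at the vectors tangent to the boundary, and
  -- there `-2 X²ρ > 0` by convexity.
  obtain ⟨B, c, hB, hc, hBc⟩ := hC.exists_pos_le_add_mul (u := fun p => -2 * b p)
    (w := fun p => r p + a p ^ 2) (continuous_const.mul hbc.continuous)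
    (hrc.continuous.add (hac.continuous.pow 2))
    (fun p hp => add_nonneg (hr0 p hp) (sq_nonneg _)) fun p hp h0 => by
      have h1 := hr0 p hp
      have h2 := sq_nonneg (a p)
      have h3 : a p = 0 := by
        have : a p ^ 2 = 0 := by linarith
        exact pow_eq_zero_iff two_ne_zero |>.1 this
      have h4 : r p = 0 := by rw [h3] at h0; linarith
      have := hconv p h4 h3
      change b p < 0 at this
      linarith
  obtain ⟨M₁, hM₁⟩ := hC.exists_bound_of_continuousOn hac.continuous.continuousOn
  obtain ⟨M₂, hM₂⟩ := hC.exists_bound_of_continuousOn hbc.continuous.continuousOn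
  obtain ⟨M₃, hM₃⟩ := hC.exists_bound_of_continuousOn hdc.continuous.continuousOn
  set m := min 1 c with hm
  have hm0 : 0 < m := lt_min one_pos hc
  set N := 2 * |M₃| + B * (3 * |M₁| + 2 * |M₁| * |M₂|) with hN
  have hN0 : 0 ≤ N := by positivity
  -- An energy that dominates `m (ρ + (Xρ)²)` and equals `(Xρ)²` where `ρ = 0`. In its derivative
  -- the term `2 Xρ X²ρ` from `(Xρ)²` cancels against that from `-2 ρ X²ρ`. Everything left is
  -- bounded by a multiple of `ρ + (Xρ)²`, so a Grönwall argument applies.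
  let En : PhasePoint → ℝ := fun p => a p ^ 2 + r p * (-2 * b p + B * (r p + a p ^ 2))
  have hEn : ∀ p ∈ C, m * (r p + a p ^ 2) ≤ En p := fun p hp => by
    have h1 := hBc p hp
    have h2 := mul_le_mul_of_nonneg_left h1 (hr0 p hp)
    have h3 := mul_le_mul_of_nonneg_right (min_le_left 1 c) (sq_nonneg (a p))
    have h4 := mul_le_mul_of_nonneg_right (min_le_right 1 c) (hr0 p hp)
    simp only [En]
    nlinarith
  let En' : PhasePoint → ℝ := fun p =>
    -2 * r p * d p + B * (2 * (a p * r p) + a p ^ 3 + 2 * (r p * a p * b p))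
  have hEn' : ∀ p ∈ C, -(N * (r p + a p ^ 2)) ≤ En' p := fun p hp => by
    have h1 : |a p| ≤ |M₁| := (hM₁ p hp).trans (le_abs_self _)
    have h2 : |b p| ≤ |M₂| := (hM₂ p hp).trans (le_abs_self _)
    have h3 : |d p| ≤ |M₃| := (hM₃ p hp).trans (le_abs_self _)
    have h0 := hr0 p hp
    have e1 : -(2 * |M₃| * r p) ≤ -2 * r p * d p := by
      have := mul_le_mul_of_nonneg_left ((le_abs_self _).trans h3) h0
      linarith
    have e2 : -(2 * |M₁| * r p) ≤ 2 * (a p * r p) := by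
      have := mul_le_mul_of_nonneg_right ((neg_le_abs _).trans h1) h0
      linarith
    have e3 : -(|M₁| * a p ^ 2) ≤ a p ^ 3 := by
      have := mul_le_mul_of_nonneg_right ((neg_le_abs _).trans h1) (sq_nonneg (a p))
      have e : a p ^ 3 = a p * a p ^ 2 := by ring
      linarith
    have e4 : -(2 * |M₁| * |M₂| * r p) ≤ 2 * (r p * a p * b p) := by
      have h5 : -(a p * b p) ≤ |M₁| * |M₂| :=
        (neg_le_abs _).trans (by rw [abs_mul]; gcongr)
      have := mul_le_mul_of_nonneg_left h5 h0
      linarith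
    have e5 : -(B * (3 * |M₁| + 2 * |M₁| * |M₂|) * (r p + a p ^ 2)) ≤
        B * (2 * (a p * r p) + a p ^ 3 + 2 * (r p * a p * b p)) := by
      have h6 : -((3 * |M₁| + 2 * |M₁| * |M₂|) * (r p + a p ^ 2)) ≤
          2 * (a p * r p) + a p ^ 3 + 2 * (r p * a p * b p) := by
        have g1 : 0 ≤ |M₁| * r p := by positivity
        have g2 : 0 ≤ |M₁| * a p ^ 2 := by positivity
        have g3 : 0 ≤ |M₁| * |M₂| * a p ^ 2 := by positivity
        linarith
      have := mul_le_mul_of_nonneg_left h6 hB.le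
      linarith
    have g4 : 0 ≤ |M₃| * a p ^ 2 := by positivity
    simp only [En', hN]
    linarith
  have hder : ∀ p t, HasDerivAt (fun s => En (D.φ p s)) (En' (D.φ p t)) t := fun p t => by
    have k1 : HasDerivAt (fun s => r (D.φ p s)) (a (D.φ p t)) t := D.hasDerivAt_rho p t
    have k2 : HasDerivAt (fun s => a (D.φ p s)) (b (D.φ p t)) t := D.hasDerivAt_rhoDot p t
    have k3 : HasDerivAt (fun s => b (D.φ p s)) (d (D.φ p t)) t := D.hasDerivAt_comp hbc p t
    have := (k2.pow 2).add (k1.mul ((k3.const_mul (-2)).add ((k1.add (k2.pow 2)).const_mul B)))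
    refine this.congr_deriv ?_
    simp only [En', Pi.add_apply, Pi.pow_apply]
    push_cast
    ring
  -- The two bounds on the energy give `En' ≥ -(N/m) En` along orbits, so `En · exp(N t / m)` is
  -- nondecreasing. The exit time is at most `T`, and one factor `m` comes from the lower bound at
  -- the starting point.
  refine ⟨m * Real.exp (-(N / m * T)), by positivity, fun p hp hS => ?_⟩
  set τ := S.exitTime p with hτ
  have hτ0 : 0 ≤ τ := S.exitTime_nonneg p
  have hder' : ∀ t, HasDerivAt (fun s => En (D.φ p s) * Real.exp (N / m * s))
      (En' (D.φ p t) * Real.exp (N / m * t) +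
        En (D.φ p t) * (Real.exp (N / m * t) * (N / m))) t := fun t => by
    simpa using! (hder p t).mul (((hasDerivAt_id t).const_mul (N / m)).exp)
  have hmono := monotoneOn_of_deriv_nonneg (convex_Icc 0 τ)
    (f := fun s => En (D.φ p s) * Real.exp (N / m * s))
    (fun t _ => (hder' t).continuousAt.continuousWithinAt)
    (fun t _ => (hder' t).differentiableAt.differentiableWithinAt)
    (fun t ht => by
      rw [interior_Icc] at ht
      rw [(hder' t).deriv]
      have hmem := horb p hp hS t (Ioo_subset_Icc_self ht)
      have h1 := hEn _ hmem
      have h2 := hEn' _ hmem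
      have h3 : N * (r (D.φ p t) + a (D.φ p t) ^ 2) ≤ N / m * En (D.φ p t) := by
        have := mul_le_mul_of_nonneg_left h1 (show 0 ≤ N / m by positivity)
        calc _ = N / m * (m * (r (D.φ p t) + a (D.φ p t) ^ 2)) := by field_simp
          _ ≤ _ := this
      have h4 : 0 ≤ En' (D.φ p t) + N / m * En (D.φ p t) := by linarith
      have := mul_nonneg h4 (Real.exp_pos (N / m * t)).le
      linarith)
    (left_mem_Icc.2 hτ0) (right_mem_Icc.2 hτ0) hτ0
  simp only [mul_zero, Real.exp_zero, mul_one, D.φ_zero] at hmono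
  have hout := D.exit_mem_outflow hnt hS
  have hre : r (D.φ p τ) = 0 := hout.1
  have hEe : En (D.φ p τ) = a (D.φ p τ) ^ 2 := by simp only [En, hre]; ring
  have hpC : p ∈ C := by simpa [D.φ_zero] using horb p hp hS 0 (left_mem_Icc.2 hτ0)
  have h5 := (hEn p hpC).trans hmono
  rw [hEe] at h5
  have hexp : Real.exp (N / m * τ) ≤ Real.exp (N / m * T) := by
    gcongr; exact hT p hS
  have h6 : m * (r p + a p ^ 2) ≤ a (D.φ p τ) ^ 2 * Real.exp (N / m * T) :=
    h5.trans (by gcongr)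
  rw [Real.exp_neg, mul_right_comm, mul_inv_le_iff₀ (Real.exp_pos _)]
  exact h6

end FlowData

end IsothermalSurface

/-! ### The transport problem and the regularity of `u^f` over the interior -/

namespace IsothermalSurface

variable {S : IsothermalSurface}

/-- The unit tangent vectors over the interior of `M`. -/
def innerSM (S : IsothermalSurface) : Set PhasePoint := {p | p.1 ∈ S.inner}

theorem isOpen_innerSM : IsOpen S.innerSM := S.isOpen_inner.preimage continuous_fst

theorem innerSM_subset : S.innerSM ⊆ S.SM := fun _ hp => S.inner_subset_carrier hp

namespace FlowData

theorem isTransportSolution (D : S.FlowData) (hnt : S.NonTrapping)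
    (hconv : S.StrictlyConvexBoundary) {f : PhasePoint → ℂ} (hf : ContinuousOn f S.SM) :
    S.IsTransportSolution f (S.transport f) := by
  refine ⟨fun p T γ hγ t ht => ?_, fun p hp => ?_⟩
  · have hT : 0 ≤ T := ht.1.trans ht.2
    have hp : p ∈ S.SM := by rw [← hγ.1]; exact hγ.2.1 0 ⟨le_rfl, hT⟩
    have heq := D.eqOn_of_isGeodesicArc hγ
    have hTτ : T ≤ S.exitTime p :=
      le_csSup (hnt p hp) ⟨hT, γ, hγ⟩
    set τ := S.exitTime p with hτ
    have hτ0 : 0 ≤ τ := hT.trans hTτ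
    let g : ℝ → ℂ := fun r => f (D.φ p (projIcc 0 τ hτ0 r))
    have hg : Continuous g := by
      refine hf.comp_continuous ?_ fun r => D.φ_mem hp (projIcc 0 τ hτ0 r).2
      exact (D.isFlow.continuous_right p).comp (continuous_subtype_val.comp continuous_projIcc)
    have hgI : ∀ r ∈ Icc 0 τ, g r = f (D.φ p r) := fun r hr => by
      simp only [g, projIcc_of_mem hτ0 hr]
    have hval : ∀ s ∈ Icc 0 T, S.transport f (γ s) = ∫ r in s..τ, g r := by
      intro s hs
      have hs' : s ∈ Icc 0 τ := ⟨hs.1, hs.2.trans hTτ⟩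
      rw [heq hs, D.transport_eq f (D.φ_mem hp hs'), D.exitTime_φ hnt hp hs']
      have h1 : ∫ r in s..τ, g r = ∫ r in (0 : ℝ)..(τ - s), g (s + r) := by
        rw [intervalIntegral.integral_comp_add_left]; simp
      rw [h1]
      refine intervalIntegral.integral_congr fun r hr => ?_
      rw [uIcc_of_le (by linarith [hs'.2])] at hr
      rw [hgI (s + r) ⟨by linarith [hs.1, hr.1], by linarith [hr.2]⟩, D.φ_add]
    have hd : HasDerivAt (fun s => ∫ r in s..τ, g r) (-g t) t :=
      intervalIntegral.integral_hasDerivAt_left (hg.intervalIntegrable _ _)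
        (hg.stronglyMeasurableAtFilter _ _) hg.continuousAt
    have ht' : g t = f (γ t) := by rw [hgI t ⟨ht.1, ht.2.trans hTτ⟩, heq ht]
    rw [ht'] at hd
    exact hd.hasDerivWithinAt.congr hval (hval t ht)
  · have h0 := D.exitTime_eq_zero_of_outflow hconv hp
    rw [transport, h0, intervalIntegral.integral_same]

theorem eqOn_of_isTransportSolution (D : S.FlowData) (hnt : S.NonTrapping)
    {f u w : PhasePoint → ℂ} (hu : S.IsTransportSolution f u) (hw : S.IsTransportSolution f w) :
    EqOn u w S.SM := by
  intro p hp
  set τ := S.exitTime p with hτ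
  have hτ0 : 0 ≤ τ := S.exitTime_nonneg p
  have harc := D.isGeodesicArc_exitTime hp
  have hder : ∀ t ∈ Icc 0 τ, HasDerivWithinAt (fun s => u (D.φ p s) - w (D.φ p s)) 0 (Icc 0 τ) t :=
    fun t ht => by simpa using! (hu.1 p τ _ harc t ht).sub (hw.1 p τ _ harc t ht)
  have hconst := constant_of_has_deriv_right_zero (a := 0) (b := τ)
    (fun t ht => (hder t ht).continuousWithinAt)
    (fun t ht => (hder t (Ico_subset_Icc_self ht)).mono_of_mem_nhdsWithin
      (Icc_mem_nhdsGE_of_mem ht)) τ ⟨hτ0, le_rfl⟩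
  have hout := D.exit_mem_outflow hnt hp
  rw [hu.2 _ hout, hw.2 _ hout, D.φ_zero, sub_self] at hconst
  exact sub_eq_zero.1 hconst.symm

/-- Exiting much earlier is excluded because a compact piece of the orbit lies in the open interior,
a stable condition. Exiting much later is excluded because the transversal exit makes `ρ` negative
shortly after `τ`, also a stable condition. -/
theorem continuousAt_exitTime (D : S.FlowData) (hnt : S.NonTrapping)
    (hconv : S.StrictlyConvexBoundary) {p : PhasePoint} (hp : p ∈ S.innerSM) :
    ContinuousAt S.exitTime p := by
  have hpS := innerSM_subset hp
  have hτ0 : 0 < S.exitTime p := D.exitTime_pos hnt hpS (.inl hp)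
  have hcr : Continuous fun q : PhasePoint × ℝ => S.rho (D.φ q.1 q.2).1 :=
    S.rho_smooth.continuous.comp (continuous_fst.comp D.continuous_φ)
  have hev : ∀ᶠ q in 𝓝 p, q ∈ S.innerSM := isOpen_innerSM.mem_nhds hp
  refine tendsto_order.2 ⟨fun l hl => ?_, fun l hl => ?_⟩
  · obtain ⟨m, hm1, hm2⟩ := exists_between (max_lt hl hτ0)
    have hm0 : 0 < m := (le_max_right _ _).trans_lt hm1
    have htube : ∀ᶠ q in 𝓝 p, ∀ t ∈ Icc 0 m, 0 < S.rho (D.φ q t).1 := by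
      refine isCompact_Icc.eventually_forall_of_forall_eventually fun t ht => ?_
      have : 0 < S.rho (D.φ p t).1 := D.φ_mem_inner hnt hconv hp ⟨ht.1, ht.2.trans_lt hm2⟩
      exact (hcr.tendsto (p, t)).eventually (lt_mem_nhds this)
    filter_upwards [htube, hev] with q hq hqi
    exact ((le_max_left _ _).trans_lt hm1).trans_le
      (D.le_exitTime hnt (innerSM_subset hqi) hm0.le fun t ht => (hq t ht).le)
  · have hneg := D.rhoDot_exit_neg hnt hconv hp
    have hc := D.hasDerivAt_rho p (S.exitTime p)
    have he0 : S.rho (D.φ p (S.exitTime p)).1 = 0 := (D.exit_mem_outflow hnt hpS).1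
    have hslope := (hasDerivAt_iff_tendsto_slope.1 hc).mono_left
      (nhdsGT_le_nhdsNE (S.exitTime p))
    have hex := ((hslope.eventually (gt_mem_nhds hneg)).and (Ioo_mem_nhdsGT hl)).exists
    obtain ⟨T, hT1, hT2⟩ := hex
    rw [slope_def_field, he0, sub_zero] at hT1
    have hrT : S.rho (D.φ p T).1 < 0 := by
      by_contra! h
      exact not_le.2 hT1 (div_nonneg h (by linarith [hT2.1]))
    have hct : Continuous fun q => S.rho (D.φ q T).1 := hcr.comp (f := fun q => (q, T)) (by fun_prop)
    filter_upwards [(hct.tendsto p).eventually (gt_mem_nhds hrT), hev] with q hq hqi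
    exact (D.exitTime_le_of_rho_neg (innerSM_subset hqi) (hτ0.le.trans hT2.1.le) hq).trans_lt hT2.2

theorem hasStrictFDerivAt_uncurry (D : S.FlowData) (p : PhasePoint) (t : ℝ) :
    HasStrictFDerivAt (fun q : PhasePoint × ℝ => D.φ q.1 q.2)
      ((D.A p t).coprod (ContinuousLinearMap.toSpanSingleton ℝ (S.geodesicField (D.φ p t)))) (p, t) := by
  have hX : Continuous fun q : PhasePoint × ℝ => S.geodesicField (D.φ q.1 q.2) :=
    S.contDiff_geodesicField.continuous.comp D.continuous_φ
  exact hasStrictFDerivAt_uncurry_coprod (𝕜 := ℝ) (u := (p, t)) (f := D.φ) (f₁ := D.A)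
    (f₂ := fun q s => ContinuousLinearMap.toSpanSingleton ℝ (S.geodesicField (D.φ q s)))
    (Eventually.of_forall fun v => D.hasFDerivAt v.1 v.2)
    (Eventually.of_forall fun v => (D.isFlow.hasDerivAt v.1 v.2).hasFDerivAt)
    D.continuous_A.continuousAt
    (((ContinuousLinearMap.toSpanSingletonCLE (𝕜 := ℝ)
      (E := PhasePoint)).continuous.comp hX).continuousAt)

/-- The derivative of the exit time. -/
noncomputable def dExit (D : S.FlowData) (p : PhasePoint) : PhasePoint →L[ℝ] ℝ :=
  (-(S.rhoDot (D.φ p (S.exitTime p)))⁻¹) •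
    (fderiv ℝ S.rhoLift (D.φ p (S.exitTime p)) ∘L D.A p (S.exitTime p))

/-- The implicit function theorem for `ρ(φ_t(q)) = 0`: the time derivative at the exit is `Xρ < 0`.
The formula comes from differentiating `ρ(φ_{τ(q)}(q)) = 0`. -/
theorem hasFDerivAt_exitTime (D : S.FlowData) (hnt : S.NonTrapping)
    (hconv : S.StrictlyConvexBoundary) {p : PhasePoint} (hp : p ∈ S.innerSM) :
    HasFDerivAt S.exitTime (D.dExit p) p := by
  have hcont := D.continuousAt_exitTime hnt hconv hp
  have hneg := D.rhoDot_exit_neg hnt hconv hp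
  set τ := S.exitTime p with hτ
  set e := D.φ p τ with he
  have hrd : ∀ q, HasStrictFDerivAt S.rhoLift (fderiv ℝ S.rhoLift q) q := fun q =>
    S.contDiff_rhoLift.contDiffAt.hasStrictFDerivAt (by simp)
  have hstrict : HasStrictFDerivAt (fun q : PhasePoint × ℝ => S.rhoLift (D.φ q.1 q.2))
      (fderiv ℝ S.rhoLift e ∘L ((D.A p τ).coprod
        (ContinuousLinearMap.toSpanSingleton ℝ (S.geodesicField e)))) (p, τ) :=
    (hrd e).comp (p, τ) (D.hasStrictFDerivAt_uncurry p τ)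
  have hinv : ((fderiv ℝ S.rhoLift e ∘L ((D.A p τ).coprod
      (ContinuousLinearMap.toSpanSingleton ℝ (S.geodesicField e)))) ∘L
        ContinuousLinearMap.inr ℝ PhasePoint ℝ).IsInvertible := by
    refine ⟨ContinuousLinearEquiv.unitsEquivAut ℝ (Units.mk0 (S.rhoDot e) hneg.ne), ?_⟩
    ext
    simp [rhoDot, lieX]
  have hzero : ∀ q ∈ S.innerSM, S.rhoLift (D.φ q (S.exitTime q)) = 0 := fun q hq =>
    (D.exit_mem_outflow hnt (innerSM_subset hq)).1
  have htend : Tendsto (fun q => (q, S.exitTime q)) (𝓝 p) (𝓝 (p, τ)) := by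
    have := (continuousAt_id (x := p)).prodMk hcont
    exact this
  -- Continuity of `τ` places `(q, τ(q))` in the neighbourhood where the implicit function gives the
  -- only zeros, so `τ` coincides with it near `p`.
  have hev := htend.eventually (hstrict.eventually_apply_eq_iff_implicitFunctionOfProdDomain hinv)
  have hU : ∀ᶠ q in 𝓝 p, q ∈ S.innerSM := isOpen_innerSM.mem_nhds hp
  have heq : S.exitTime =ᶠ[𝓝 p] hstrict.implicitFunctionOfProdDomain hinv := by
    filter_upwards [hev, hU] with q hq hqi
    refine (hq.1 ?_).symm
    rw [hzero q hqi, hzero p hp]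
  have hdiff : DifferentiableAt ℝ S.exitTime p :=
    (((hstrict.hasStrictFDerivAt_implicitFunctionOfProdDomain
      hinv).hasFDerivAt).congr_of_eventuallyEq heq).differentiableAt
  have hd := hdiff.hasFDerivAt
  have hcomp : HasFDerivAt (fun q => S.rhoLift (D.φ q (S.exitTime q)))
      ((fderiv ℝ S.rhoLift e ∘L ((D.A p τ).coprod
        (ContinuousLinearMap.toSpanSingleton ℝ (S.geodesicField e)))) ∘L
        ((ContinuousLinearMap.id ℝ PhasePoint).prod (fderiv ℝ S.exitTime p))) p :=
    (hstrict.hasFDerivAt (x := (p, τ))).comp (f := fun q => (q, S.exitTime q)) p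
      ((hasFDerivAt_id p).prodMk hd)
  have h0 : HasFDerivAt (fun q => S.rhoLift (D.φ q (S.exitTime q))) (0 : PhasePoint →L[ℝ] ℝ) p :=
    (hasFDerivAt_const (0 : ℝ) p).congr_of_eventuallyEq (by
      filter_upwards [hU] with q hq using hzero q hq)
  have huniq := hcomp.unique h0
  have hfin : fderiv ℝ S.exitTime p = D.dExit p := by
    refine ContinuousLinearMap.ext fun v => ?_
    have h1 := DFunLike.congr_fun huniq v
    simp only [ContinuousLinearMap.comp_apply, ContinuousLinearMap.prod_apply,
      ContinuousLinearMap.coprod_apply, ContinuousLinearMap.id_apply, map_add,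
      ContinuousLinearMap.toSpanSingleton_apply, map_smul, zero_apply, smul_eq_mul] at h1
    have h2 : fderiv ℝ S.rhoLift e (S.geodesicField e) = S.rhoDot e := rfl
    rw [h2] at h1
    simp only [dExit, smul_apply, ContinuousLinearMap.comp_apply, smul_eq_mul]
    rw [← hτ, ← he]
    have h3 : fderiv ℝ S.exitTime p v * S.rhoDot e = -fderiv ℝ S.rhoLift e (D.A p τ v) := by linarith
    rw [(eq_div_iff hneg.ne).2 h3, div_eq_mul_inv]
    ring
  rw [← hfin]
  exact hd

theorem continuousOn_exitTime (D : S.FlowData) (hnt : S.NonTrapping)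
    (hconv : S.StrictlyConvexBoundary) : ContinuousOn S.exitTime S.innerSM := fun _ hp =>
  (D.continuousAt_exitTime hnt hconv hp).continuousWithinAt

theorem continuousOn_exitPoint (D : S.FlowData) (hnt : S.NonTrapping)
    (hconv : S.StrictlyConvexBoundary) :
    ContinuousOn (fun p => D.φ p (S.exitTime p)) S.innerSM :=
  D.continuous_φ.comp_continuousOn (f := fun p => (p, S.exitTime p))
    (continuousOn_id.prodMk (D.continuousOn_exitTime hnt hconv))

theorem continuousOn_dExit (D : S.FlowData) (hnt : S.NonTrapping)
    (hconv : S.StrictlyConvexBoundary) : ContinuousOn D.dExit S.innerSM := by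
  have h1 := D.continuousOn_exitPoint hnt hconv
  unfold dExit
  refine ContinuousOn.smul (f := fun p => -(S.rhoDot (D.φ p (S.exitTime p)))⁻¹) ?_
    (ContinuousOn.clm_comp ?_ ?_)
  · exact ((contDiff_rhoDot.continuous.comp_continuousOn h1).inv₀
      fun p hp => (D.rhoDot_exit_neg hnt hconv hp).ne).neg
  · exact (S.contDiff_rhoLift.continuous_fderiv (by simp)).comp_continuousOn h1
  · exact D.continuous_A.comp_continuousOn (f := fun p => (p, S.exitTime p))
      (continuousOn_id.prodMk (D.continuousOn_exitTime hnt hconv))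

theorem mul_exitTime_mem (p : PhasePoint) {s : ℝ} (hs : s ∈ Icc (0 : ℝ) 1) :
    s * S.exitTime p ∈ Icc 0 (S.exitTime p) :=
  ⟨mul_nonneg hs.1 (S.exitTime_nonneg p), mul_le_of_le_one_left (S.exitTime_nonneg p) hs.2⟩

/-- Rescaling to the fixed interval `[0, 1]` removes the moving endpoint, so that `f` is never
evaluated outside `SM` when the initial vector varies. -/
theorem transport_eq_smul (D : S.FlowData) (f : PhasePoint → ℂ) {p : PhasePoint} (hp : p ∈ S.SM) :
    S.transport f p = S.exitTime p • ∫ s in (0 : ℝ)..1, f (D.φ p (s * S.exitTime p)) := by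
  rw [D.transport_eq f hp]
  have := intervalIntegral.smul_integral_comp_mul_right (a := 0) (b := 1)
    (fun t => f (D.φ p t)) (S.exitTime p)
  rw [this, zero_mul, one_mul]

theorem continuousOn_scaled (D : S.FlowData) (hnt : S.NonTrapping)
    (hconv : S.StrictlyConvexBoundary) : ContinuousOn
      (fun q : PhasePoint × ℝ => D.φ q.1 (q.2 * S.exitTime q.1)) (S.innerSM ×ˢ Icc (0 : ℝ) 1) := by
  have h : ContinuousOn (fun q : PhasePoint × ℝ => S.exitTime q.1) (S.innerSM ×ˢ Icc (0 : ℝ) 1) :=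
    (D.continuousOn_exitTime hnt hconv).comp continuousOn_fst fun q hq => hq.1
  exact D.continuous_φ.comp_continuousOn
    (f := fun q : PhasePoint × ℝ => (q.1, q.2 * S.exitTime q.1))
    (continuousOn_fst.prodMk (continuousOn_snd.mul h))

theorem continuousOn_comp_scaled (D : S.FlowData) (hnt : S.NonTrapping)
    (hconv : S.StrictlyConvexBoundary) {F : Type*} [TopologicalSpace F] {f : PhasePoint → F}
    (hf : ContinuousOn f S.SM) : ContinuousOn
      (fun q : PhasePoint × ℝ => f (D.φ q.1 (q.2 * S.exitTime q.1))) (S.innerSM ×ˢ Icc (0 : ℝ) 1) :=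
  hf.comp (D.continuousOn_scaled hnt hconv) fun q hq =>
    D.φ_mem (innerSM_subset hq.1) (mul_exitTime_mem q.1 hq.2)

theorem continuousOn_transport (D : S.FlowData) (hnt : S.NonTrapping)
    (hconv : S.StrictlyConvexBoundary) {f : PhasePoint → ℂ} (hf : ContinuousOn f S.SM) :
    ContinuousOn (S.transport f) S.innerSM := by
  have h1 : ContinuousOn (fun p => ∫ s in (0 : ℝ)..1, f (D.φ p (s * S.exitTime p))) S.innerSM :=
    continuousOn_intervalIntegral_of_continuousOn isOpen_innerSM zero_le_one
      (G := fun p s => f (D.φ p (s * S.exitTime p))) (D.continuousOn_comp_scaled hnt hconv hf)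
  exact ((D.continuousOn_exitTime hnt hconv).smul h1).congr fun p hp =>
    D.transport_eq_smul f (innerSM_subset hp)

/-- The derivative of `p ↦ f (φ_{s τ(p)}(p))`. -/
noncomputable def dScaled (D : S.FlowData) (f : PhasePoint → ℂ) (p : PhasePoint) (s : ℝ) :
    PhasePoint →L[ℝ] ℂ :=
  fderivWithin ℝ f S.SM (D.φ p (s * S.exitTime p)) ∘L
    (D.A p (s * S.exitTime p) +
      (s • D.dExit p).smulRight (S.geodesicField (D.φ p (s * S.exitTime p))))

/-- The derivative of `u^f`. -/
noncomputable def dTransport (D : S.FlowData) (f : PhasePoint → ℂ) (p : PhasePoint) :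
    PhasePoint →L[ℝ] ℂ :=
  S.exitTime p • (∫ s in (0 : ℝ)..1, D.dScaled f p s) +
    (D.dExit p).smulRight (∫ s in (0 : ℝ)..1, f (D.φ p (s * S.exitTime p)))

theorem continuousOn_dScaled (D : S.FlowData) (hnt : S.NonTrapping)
    (hconv : S.StrictlyConvexBoundary) {f : PhasePoint → ℂ} (hf : ContDiffOn ℝ 1 f S.SM) :
    ContinuousOn (fun q : PhasePoint × ℝ => D.dScaled f q.1 q.2) (S.innerSM ×ˢ Icc (0 : ℝ) 1) := by
  have h1 : ContinuousOn (fderivWithin ℝ f S.SM) S.SM :=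
    hf.continuousOn_fderivWithin S.uniqueDiffOn_SM le_rfl
  have h : ContinuousOn (fun q : PhasePoint × ℝ => S.exitTime q.1) (S.innerSM ×ˢ Icc (0 : ℝ) 1) :=
    (D.continuousOn_exitTime hnt hconv).comp continuousOn_fst fun q hq => hq.1
  have hd : ContinuousOn (fun q : PhasePoint × ℝ => D.dExit q.1) (S.innerSM ×ˢ Icc (0 : ℝ) 1) :=
    (D.continuousOn_dExit hnt hconv).comp continuousOn_fst fun q hq => hq.1
  have hX := S.contDiff_geodesicField.continuous.comp_continuousOn (D.continuousOn_scaled hnt hconv)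
  refine ContinuousOn.clm_comp (D.continuousOn_comp_scaled hnt hconv h1) (ContinuousOn.add ?_ ?_)
  · exact D.continuous_A.comp_continuousOn
      (f := fun q : PhasePoint × ℝ => (q.1, q.2 * S.exitTime q.1))
      (continuousOn_fst.prodMk (continuousOn_snd.mul h))
  · exact (ContinuousLinearMap.smulRightL ℝ PhasePoint PhasePoint).continuous.comp_continuousOn
      (continuousOn_snd.smul hd) |>.clm_apply hX

/-- For `0 < s < 1` the point reached is over the interior, so the derivative of `f` within `SM` is
a full derivative and the chain rule applies. -/
theorem hasFDerivAt_scaled (D : S.FlowData) (hnt : S.NonTrapping)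
    (hconv : S.StrictlyConvexBoundary) {f : PhasePoint → ℂ} (hf : ContDiffOn ℝ 1 f S.SM)
    {p : PhasePoint} (hp : p ∈ S.innerSM) {s : ℝ} (hs : s ∈ Ioo (0 : ℝ) 1) :
    HasFDerivAt (fun q => f (D.φ q (s * S.exitTime q))) (D.dScaled f p s) p := by
  have hpS := innerSM_subset hp
  have hτ0 : 0 < S.exitTime p := D.exitTime_pos hnt hpS (.inl hp)
  have hmem : D.φ p (s * S.exitTime p) ∈ S.innerSM := D.φ_mem_inner hnt hconv hp
    ⟨mul_nonneg hs.1.le hτ0.le, by nlinarith [hs.2]⟩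
  have hfd : HasFDerivAt f (fderivWithin ℝ f S.SM (D.φ p (s * S.exitTime p)))
      (D.φ p (s * S.exitTime p)) :=
    ((hf.differentiableOn one_ne_zero) _ (innerSM_subset hmem)).hasFDerivWithinAt.hasFDerivAt
      (SM_mem_nhds hmem)
  have h1 : HasFDerivAt (fun q => s * S.exitTime q) (s • D.dExit p) p :=
    (D.hasFDerivAt_exitTime hnt hconv hp).const_mul s
  have h2 := (D.hasStrictFDerivAt_uncurry p (s * S.exitTime p)).hasFDerivAt.comp
    (f := fun q => (q, s * S.exitTime q)) p ((hasFDerivAt_id p).prodMk h1)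
  refine (hfd.comp (f := fun q => D.φ q (s * S.exitTime q)) p h2).congr_fderiv ?_
  refine ContinuousLinearMap.ext fun v => ?_
  simp [dScaled]

theorem hasFDerivAt_transport (D : S.FlowData) (hnt : S.NonTrapping)
    (hconv : S.StrictlyConvexBoundary) {f : PhasePoint → ℂ} (hf : ContDiffOn ℝ 1 f S.SM)
    {p : PhasePoint} (hp : p ∈ S.innerSM) :
    HasFDerivAt (S.transport f) (D.dTransport f p) p := by
  have h1 : HasFDerivAt (fun p => ∫ s in (0 : ℝ)..1, f (D.φ p (s * S.exitTime p)))
      (∫ s in (0 : ℝ)..1, D.dScaled f p s) p :=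
    hasFDerivAt_intervalIntegral_of_continuousOn isOpen_innerSM zero_le_one
      (G := fun p s => f (D.φ p (s * S.exitTime p)))
      (D.continuousOn_comp_scaled hnt hconv hf.continuousOn)
      (D.continuousOn_dScaled hnt hconv hf)
      (fun q hq s hs => D.hasFDerivAt_scaled hnt hconv hf hq hs) hp
  refine ((D.hasFDerivAt_exitTime hnt hconv hp).smul h1).congr_of_eventuallyEq ?_
  filter_upwards [isOpen_innerSM.mem_nhds hp] with q hq
  exact D.transport_eq_smul f (innerSM_subset hq)

theorem continuousOn_dTransport (D : S.FlowData) (hnt : S.NonTrapping)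
    (hconv : S.StrictlyConvexBoundary) {f : PhasePoint → ℂ} (hf : ContDiffOn ℝ 1 f S.SM) :
    ContinuousOn (D.dTransport f) S.innerSM := by
  have h1 : ContinuousOn (fun p => ∫ s in (0 : ℝ)..1, f (D.φ p (s * S.exitTime p))) S.innerSM :=
    continuousOn_intervalIntegral_of_continuousOn isOpen_innerSM zero_le_one
      (G := fun p s => f (D.φ p (s * S.exitTime p)))
      (D.continuousOn_comp_scaled hnt hconv hf.continuousOn)
  have h2 : ContinuousOn (fun p => ∫ s in (0 : ℝ)..1, D.dScaled f p s) S.innerSM :=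
    continuousOn_intervalIntegral_of_continuousOn isOpen_innerSM zero_le_one
      (D.continuousOn_dScaled hnt hconv hf)
  refine ((D.continuousOn_exitTime hnt hconv).smul h2).add ?_
  exact (ContinuousLinearMap.smulRightL ℝ PhasePoint ℂ).continuous.comp_continuousOn
      (D.continuousOn_dExit hnt hconv) |>.clm_apply h1

theorem exists_norm_transport_le_mul_exitTime (D : S.FlowData) (hnt : S.NonTrapping)
    {f : PhasePoint → ℂ} (hf : ContinuousOn f S.SM) {P : Set PhasePoint} (hP : IsCompact P) :
    ∃ M, 0 ≤ M ∧ ∀ p ∈ P, p ∈ S.SM → ‖S.transport f p‖ ≤ M * S.exitTime p := by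
  obtain ⟨C, hCS, hC, horb⟩ := D.exists_compact_orbits hnt hP
  obtain ⟨M, hM⟩ := hC.exists_bound_of_continuousOn (hf.mono hCS)
  refine ⟨|M|, abs_nonneg _, fun p hp hS => ?_⟩
  rw [D.transport_eq f hS]
  have h0 := S.exitTime_nonneg p
  have := intervalIntegral.norm_integral_le_of_norm_le_const (a := 0) (b := S.exitTime p)
    (f := fun t => f (D.φ p t)) (C := |M|) fun t ht => by
      rw [uIoc_of_le h0] at ht
      exact (hM _ (horb p hp hS t (Ioc_subset_Icc_self ht))).trans (le_abs_self _)
  rwa [sub_zero, abs_of_nonneg h0] at this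

theorem exists_norm_transport_le (D : S.FlowData) (hnt : S.NonTrapping) {f : PhasePoint → ℂ}
    (hf : ContinuousOn f S.SM) {P : Set PhasePoint} (hP : IsCompact P) :
    ∃ M, ∀ p ∈ P, p ∈ S.SM → ‖S.transport f p‖ ≤ M := by
  obtain ⟨M, hM0, hM⟩ := D.exists_norm_transport_le_mul_exitTime hnt hf hP
  obtain ⟨T, -, hT⟩ := D.exists_exitTime_le hnt
  exact ⟨M * T, fun p hp hS => (hM p hp hS).trans (by gcongr; exact hT p hS)⟩


/-- Only the derivative of the exit time is unbounded, and it becomes bounded after multiplication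
by `|Xρ|` at the exit point. The tangency estimate converts this into the weight at the initial
point. -/
theorem exists_sq_norm_dTransport_le (D : S.FlowData) (hnt : S.NonTrapping)
    (hconv : S.StrictlyConvexBoundary) {f : PhasePoint → ℂ} (hf : ContDiffOn ℝ 1 f S.SM)
    {P : Set PhasePoint} (hP : IsCompact P) :
    ∃ M, ∀ p ∈ P, p ∈ S.innerSM →
      ‖D.dTransport f p‖ ^ 2 * (S.rho p.1 + S.rhoDot p ^ 2) ≤ M := by
  obtain ⟨C, hCS, hC, horb⟩ := D.exists_compact_orbits hnt hP
  obtain ⟨T, hT0, hT⟩ := D.exists_exitTime_le hnt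
  obtain ⟨c, hc, hcP⟩ := D.exists_le_sq_rhoDot_exit hnt hconv hP
  obtain ⟨F₀, hF₀⟩ := hC.exists_bound_of_continuousOn (hf.continuousOn.mono hCS)
  obtain ⟨F₁, hF₁⟩ := hC.exists_bound_of_continuousOn
    ((hf.continuousOn_fderivWithin S.uniqueDiffOn_SM le_rfl).mono hCS)
  obtain ⟨a₀, ha₀⟩ := hC.exists_bound_of_continuousOn
    (contDiff_rhoDot (S := S)).continuous.continuousOn
  obtain ⟨r₁, hr₁⟩ := hC.exists_bound_of_continuousOn
    (S.contDiff_rhoLift.continuous_fderiv (by simp)).continuousOn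
  obtain ⟨A₀, hA₀⟩ := (hP.prod (isCompact_Icc (a := 0) (b := T))).exists_bound_of_continuousOn
    D.continuous_A.continuousOn
  have pos : ∀ {x y : ℝ}, x ≤ y → x ≤ |y| := fun h => h.trans (le_abs_self _)
  set Q : ℝ := T * (|F₁| * (|A₀| * |a₀| + |r₁| * |A₀| * D.L)) + |r₁| * |A₀| * |F₀| with hQ
  refine ⟨Q ^ 2 / c, fun p hp hpi => ?_⟩
  have hS := innerSM_subset hpi
  have hneg := D.rhoDot_exit_neg hnt hconv hpi
  have hτ0 := S.exitTime_nonneg p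
  have hE := horb p hp hS (S.exitTime p) ⟨hτ0, le_rfl⟩
  set k := |S.rhoDot (D.φ p (S.exitTime p))| with hk
  have hk0 : 0 < k := abs_pos.2 hneg.ne
  have hka : k ≤ |a₀| := pos (ha₀ _ hE)
  have hA : ∀ s ∈ Icc (0 : ℝ) 1, ‖D.A p (s * S.exitTime p)‖ ≤ |A₀| := fun s hs =>
    pos (hA₀ (p, s * S.exitTime p) ⟨hp, (mul_exitTime_mem p hs).1,
      (mul_exitTime_mem p hs).2.trans (hT p hS)⟩)
  have hdE : ‖D.dExit p‖ * k ≤ |r₁| * |A₀| := by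
    rw [dExit, norm_smul, norm_neg, norm_inv, Real.norm_eq_abs, ← hk, mul_comm (k⁻¹),
      inv_mul_cancel_right₀ hk0.ne']
    refine (ContinuousLinearMap.opNorm_comp_le _ _).trans ?_
    have := hA 1 ⟨zero_le_one, le_rfl⟩
    rw [one_mul] at this
    gcongr
    exact pos (hr₁ _ hE)
  have hI0 : ‖∫ s in (0 : ℝ)..1, f (D.φ p (s * S.exitTime p))‖ ≤ |F₀| := by
    have := intervalIntegral.norm_integral_le_of_norm_le_const (a := 0) (b := 1)
      (f := fun s => f (D.φ p (s * S.exitTime p))) (C := |F₀|) fun s hs => by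
        rw [uIoc_of_le zero_le_one] at hs
        exact pos (hF₀ _ (horb p hp hS _ (mul_exitTime_mem p (Ioc_subset_Icc_self hs))))
    simpa using this
  have hI1 : ‖∫ s in (0 : ℝ)..1, D.dScaled f p s‖ ≤ |F₁| * (|A₀| + ‖D.dExit p‖ * D.L) := by
    have := intervalIntegral.norm_integral_le_of_norm_le_const (a := 0) (b := 1)
      (f := fun s => D.dScaled f p s) (C := |F₁| * (|A₀| + ‖D.dExit p‖ * D.L)) fun s hs => by
        rw [uIoc_of_le zero_le_one] at hs
        have hs' := Ioc_subset_Icc_self hs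
        refine (ContinuousLinearMap.opNorm_comp_le _ _).trans ?_
        gcongr
        · exact pos (hF₁ _ (horb p hp hS _ (mul_exitTime_mem p hs')))
        · refine (norm_add_le _ _).trans (add_le_add (hA s hs') ?_)
          rw [ContinuousLinearMap.norm_smulRight_apply, norm_smul]
          have h1 : ‖s‖ ≤ 1 := by rw [Real.norm_eq_abs, abs_of_nonneg hs'.1]; exact hs'.2
          have h2 := D.norm_le (D.φ p (s * S.exitTime p))
          calc ‖s‖ * ‖D.dExit p‖ * ‖S.geodesicField (D.φ p (s * S.exitTime p))‖
              ≤ 1 * ‖D.dExit p‖ * D.L := by gcongr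
            _ = _ := by ring
    simpa using this
  have hmain : ‖D.dTransport f p‖ * k ≤ Q := by
    have h1 : ‖D.dTransport f p‖ ≤
        T * (|F₁| * (|A₀| + ‖D.dExit p‖ * D.L)) + ‖D.dExit p‖ * |F₀| := by
      refine (norm_add_le _ _).trans (add_le_add ?_ ?_)
      · rw [norm_smul, Real.norm_eq_abs, abs_of_nonneg hτ0]
        exact mul_le_mul (hT p hS) hI1 (norm_nonneg _) hT0.le
      · rw [ContinuousLinearMap.norm_smulRight_apply]
        gcongr
    calc ‖D.dTransport f p‖ * k
        ≤ (T * (|F₁| * (|A₀| + ‖D.dExit p‖ * D.L)) + ‖D.dExit p‖ * |F₀|) * k := by gcongr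
      _ = T * (|F₁| * (|A₀| * k + ‖D.dExit p‖ * k * D.L)) + ‖D.dExit p‖ * k * |F₀| := by ring
      _ ≤ Q := by rw [hQ]; gcongr
  have hQ0 : 0 ≤ Q := (by positivity : 0 ≤ ‖D.dTransport f p‖ * k).trans hmain
  rw [le_div_iff₀ hc]
  calc ‖D.dTransport f p‖ ^ 2 * (S.rho p.1 + S.rhoDot p ^ 2) * c
      = ‖D.dTransport f p‖ ^ 2 * (c * (S.rho p.1 + S.rhoDot p ^ 2)) := by ring
    _ ≤ ‖D.dTransport f p‖ ^ 2 * k ^ 2 := by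
        rw [hk, sq_abs]
        gcongr
        exact hcP p hp hS
    _ = (‖D.dTransport f p‖ * k) ^ 2 := by ring
    _ ≤ Q ^ 2 := by gcongr

end FlowData

end IsothermalSurface

/-! ### An angular integral and a coarea type inequality -/

theorem integral_fderiv_eq_zero {E G : Type*} [NormedAddCommGroup E] [NormedSpace ℝ E]
    [FiniteDimensional ℝ E] [MeasurableSpace E] [BorelSpace E] [NormedAddCommGroup G]
    [NormedSpace ℝ G] {μ : Measure E} [μ.IsAddHaarMeasure] {w : E → G} (hw : ContDiff ℝ 1 w)
    (hc : HasCompactSupport w) (v : E) : ∫ x, fderiv ℝ w x v ∂μ = 0 := by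
  have h1 : Continuous fun x => fderiv ℝ w x v :=
    (hw.continuous_fderiv one_ne_zero).clm_apply continuous_const
  have h2 : HasCompactSupport fun x => fderiv ℝ w x v :=
    (hc.fderiv (𝕜 := ℝ)).comp_left (g := fun L : E →L[ℝ] G => L v) rfl
  have := integral_smul_fderiv_eq_neg_fderiv_smul_of_integrable (μ := μ) (f := fun _ : E => (1 : ℝ))
    (g := w) (v := v) (by simp) (by simpa using h1.integrable_of_hasCompactSupport h2)
    (by simpa using hw.continuous.integrable_of_hasCompactSupport hc)
    (fun x _ => differentiableAt_const _)
    (fun x _ => hw.differentiable one_ne_zero x)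
  simpa using this

/-- Put `a = A cos θ + B sin θ`, so that `a² + a'² = A² + B²`. The part `a²/(r + a²)` is at most
one. For the other part, integrate the derivative of the periodic function `a' arctan(a/√r)`: it
gives `∫ √r a'²/(r + a²) = ∫ a arctan(a/√r) ≤ 2π · √(A² + B²) · π/2`. -/
theorem integral_inv_add_sq_le (A B : ℝ) {r : ℝ} (hr : 0 < r) :
    ∫ θ in (0 : ℝ)..(2 * Real.pi),
      (A ^ 2 + B ^ 2) / (r + (A * Real.cos θ + B * Real.sin θ) ^ 2) ≤
    2 * Real.pi + Real.pi ^ 2 * Real.sqrt (A ^ 2 + B ^ 2) / Real.sqrt r := by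
  set s := Real.sqrt r with hs
  have hs0 : 0 < s := Real.sqrt_pos.2 hr
  have hss : s ^ 2 = r := Real.sq_sqrt hr.le
  set k := Real.sqrt (A ^ 2 + B ^ 2) with hk
  have hk0 : 0 ≤ k := Real.sqrt_nonneg _
  have hkk : k ^ 2 = A ^ 2 + B ^ 2 := Real.sq_sqrt (by positivity)
  let a : ℝ → ℝ := fun θ => A * Real.cos θ + B * Real.sin θ
  let a' : ℝ → ℝ := fun θ => -A * Real.sin θ + B * Real.cos θ
  have hac : Continuous a := by fun_prop
  have hac' : Continuous a' := by fun_prop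
  have hsum : ∀ θ, a θ ^ 2 + a' θ ^ 2 = A ^ 2 + B ^ 2 := fun θ => by
    have := Real.sin_sq_add_cos_sq θ
    simp only [a, a']
    linear_combination (A ^ 2 + B ^ 2) * this
  have hda : ∀ θ, HasDerivAt a (a' θ) θ := fun θ => by
    have := ((Real.hasDerivAt_cos θ).const_mul A).add ((Real.hasDerivAt_sin θ).const_mul B)
    refine this.congr_deriv ?_
    simp only [a']; ring
  have hda' : ∀ θ, HasDerivAt a' (-a θ) θ := fun θ => by
    have := ((Real.hasDerivAt_sin θ).const_mul (-A)).add ((Real.hasDerivAt_cos θ).const_mul B)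
    refine this.congr_deriv ?_
    simp only [a]; ring
  have hden : ∀ θ, 0 < r + a θ ^ 2 := fun θ => by positivity
  have hd : ∀ θ, HasDerivAt (fun θ => a' θ * Real.arctan (a θ / s))
      (-(a θ * Real.arctan (a θ / s)) + a' θ ^ 2 * s / (r + a θ ^ 2)) θ := fun θ => by
    have := (hda' θ).mul (((hda θ).div_const s).arctan)
    refine this.congr_deriv ?_
    have h0 := (hden θ).ne'
    have h1 : 1 + (a θ / s) ^ 2 = (r + a θ ^ 2) / r := by rw [div_pow, hss]; field_simp
    rw [h1, ← hss]
    rw [← hss] at h0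
    field_simp
  have hca : Continuous fun θ => a θ * Real.arctan (a θ / s) := by fun_prop
  have hcb : Continuous fun θ => a' θ ^ 2 * s / (r + a θ ^ 2) :=
    (by fun_prop : Continuous fun θ => a' θ ^ 2 * s).div (by fun_prop) fun θ => (hden θ).ne'
  have hcc : Continuous fun θ => a θ ^ 2 / (r + a θ ^ 2) :=
    (by fun_prop : Continuous fun θ => a θ ^ 2).div (by fun_prop) fun θ => (hden θ).ne'
  have hFTC := intervalIntegral.integral_eq_sub_of_hasDerivAt (a := 0) (b := 2 * Real.pi)
    (fun θ _ => hd θ) ((hca.neg.add hcb).intervalIntegrable _ _)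
  have hper : a' (2 * Real.pi) * Real.arctan (a (2 * Real.pi) / s) - a' 0 * Real.arctan (a 0 / s) = 0 := by
    simp [a, a']
  have hcn : Continuous fun θ => -(a θ * Real.arctan (a θ / s)) := hca.neg
  rw [hper, intervalIntegral.integral_add (hcn.intervalIntegrable _ _)
    (hcb.intervalIntegrable _ _), intervalIntegral.integral_neg] at hFTC
  have h2π : (0 : ℝ) ≤ 2 * Real.pi := by positivity
  have hb1 : ∫ θ in (0 : ℝ)..(2 * Real.pi), a θ * Real.arctan (a θ / s) ≤ Real.pi ^ 2 * k := by
    have := intervalIntegral.integral_mono_on (μ := volume) h2π (hca.intervalIntegrable _ _)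
      (intervalIntegrable_const (c := k * (Real.pi / 2))) fun θ _ => by
        have h1 : |a θ| ≤ k := Real.abs_le_sqrt (by linarith [hsum θ, sq_nonneg (a' θ)])
        have h2 : |Real.arctan (a θ / s)| ≤ Real.pi / 2 :=
          abs_le.2 ⟨(Real.neg_pi_div_two_lt_arctan _).le, (Real.arctan_lt_pi_div_two _).le⟩
        calc _ ≤ |a θ * Real.arctan (a θ / s)| := le_abs_self _
          _ ≤ _ := by rw [abs_mul]; gcongr
    refine this.trans (le_of_eq ?_)
    rw [intervalIntegral.integral_const, smul_eq_mul]; ring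
  have hb2 : ∫ θ in (0 : ℝ)..(2 * Real.pi), a θ ^ 2 / (r + a θ ^ 2) ≤ 2 * Real.pi := by
    have := intervalIntegral.integral_mono_on (μ := volume) h2π (hcc.intervalIntegrable _ _)
      (intervalIntegrable_const (c := 1)) fun θ _ => by
        rw [div_le_one (hden θ)]; linarith
    simpa using this
  have hsplit : ∀ θ, (A ^ 2 + B ^ 2) / (r + (A * Real.cos θ + B * Real.sin θ) ^ 2) =
      a θ ^ 2 / (r + a θ ^ 2) + s⁻¹ * (a' θ ^ 2 * s / (r + a θ ^ 2)) := fun θ => by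
    have e : A * Real.cos θ + B * Real.sin θ = a θ := rfl
    have h0 := (hden θ).ne'
    rw [e, ← hsum θ]
    field_simp
  have hcd : Continuous fun θ => s⁻¹ * (a' θ ^ 2 * s / (r + a θ ^ 2)) := continuous_const.mul hcb
  simp_rw [hsplit]
  rw [intervalIntegral.integral_add (hcc.intervalIntegrable _ _)
    (hcd.intervalIntegrable _ _), intervalIntegral.integral_const_mul]
  have h3 : s⁻¹ * ∫ θ in (0 : ℝ)..(2 * Real.pi), a' θ ^ 2 * s / (r + a θ ^ 2) ≤
      Real.pi ^ 2 * k / s := by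
    rw [div_eq_inv_mul]
    gcongr
    linarith
  linarith

namespace IsothermalSurface

variable {S : IsothermalSurface}

/-- The Euclidean length of the differential of `ρ`, squared. -/
noncomputable def gradSq (S : IsothermalSurface) (x : ℝ × ℝ) : ℝ :=
  fderiv ℝ S.rho x (1, 0) ^ 2 + fderiv ℝ S.rho x (0, 1) ^ 2

theorem contDiff_fderiv_rho (S : IsothermalSurface) (v : ℝ × ℝ) :
    ContDiff ℝ ∞ fun x => fderiv ℝ S.rho x v :=
  (S.rho_smooth.fderiv_right (m := ∞) (by simp)).clm_apply contDiff_const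

theorem continuous_gradSq (S : IsothermalSurface) : Continuous S.gradSq :=
  ((S.contDiff_fderiv_rho (1, 0)).continuous.pow 2).add
    ((S.contDiff_fderiv_rho (0, 1)).continuous.pow 2)

theorem gradSq_nonneg (S : IsothermalSurface) (x : ℝ × ℝ) : 0 ≤ S.gradSq x := by
  unfold gradSq; positivity

theorem fderiv_apply_eq {F : Type*} [NormedAddCommGroup F] [NormedSpace ℝ F]
    (L : ℝ × ℝ →L[ℝ] F) (v : ℝ × ℝ) : L v = v.1 • L (1, 0) + v.2 • L (0, 1) := by
  rw [← map_smul, ← map_smul, ← map_add]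
  congr 1
  ext <;> simp

theorem gradSq_pos (S : IsothermalSurface) {x : ℝ × ℝ} (hx : S.rho x = 0) : 0 < S.gradSq x := by
  refine lt_of_le_of_ne (S.gradSq_nonneg x) fun h => S.regular x hx ?_
  have h1 : fderiv ℝ S.rho x (1, 0) = 0 := by
    unfold gradSq at h
    nlinarith [sq_nonneg (fderiv ℝ S.rho x (1, 0)), sq_nonneg (fderiv ℝ S.rho x (0, 1))]
  have h2 : fderiv ℝ S.rho x (0, 1) = 0 := by
    unfold gradSq at h
    nlinarith [sq_nonneg (fderiv ℝ S.rho x (1, 0)), sq_nonneg (fderiv ℝ S.rho x (0, 1))]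
  refine ContinuousLinearMap.ext fun v => ?_
  rw [fderiv_apply_eq, h1, h2]
  simp

/-- An upper bound in the coarea formula for `ρ`. -/
theorem exists_lintegral_gradSq_le (S : IsothermalSurface) : ∃ C R : ℝ, 0 ≤ C ∧ 0 ≤ R ∧
    ∀ (G g : ℝ → ℝ) (m : ℝ), Continuous g → (∀ r, HasDerivAt G (g r) r) → (∀ r, 0 ≤ g r) →
      (∀ r, |r| ≤ R → |G r| ≤ m) →
      ∫⁻ x in S.carrier, ENNReal.ofReal (S.gradSq x * g (S.rho x)) ≤ ENNReal.ofReal (C * m) := by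
  obtain ⟨R₀, hR₀⟩ := S.isCompact.isBounded.subset_closedBall 0
  have hR₀' : (0 : ℝ) < max R₀ 1 := by positivity
  let χ : ContDiffBump (0 : ℝ × ℝ) := ⟨max R₀ 1, max R₀ 1 + 1, hR₀', by linarith⟩
  have hχ1 : ∀ x ∈ S.carrier, χ x = 1 := fun x hx =>
    χ.one_of_mem_closedBall (Metric.closedBall_subset_closedBall (le_max_left _ _) (hR₀ hx))
  have hχc : HasCompactSupport χ := χ.hasCompactSupport
  obtain ⟨R, hR⟩ := hχc.isCompact.exists_bound_of_continuousOn S.rho_smooth.continuous.continuousOn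
  let w : ℝ × ℝ → ℝ × ℝ → ℝ := fun v x => χ x * fderiv ℝ S.rho x v
  have hw : ∀ v, ContDiff ℝ ∞ (w v) := fun v => χ.contDiff.mul (S.contDiff_fderiv_rho v)
  have hwc : ∀ v, HasCompactSupport (w v) := fun v => hχc.mul_right
  let d : ℝ × ℝ → ℝ × ℝ → ℝ := fun v x => fderiv ℝ (w v) x v
  have hdc : ∀ v, Continuous (d v) := fun v =>
    ((hw v).continuous_fderiv (by simp)).clm_apply continuous_const
  have hds : ∀ v, HasCompactSupport (d v) := fun v =>
    ((hwc v).fderiv (𝕜 := ℝ)).comp_left (g := fun L : ℝ × ℝ →L[ℝ] ℝ => L v) rfl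
  have hsupp : ∀ v, ∀ x, d v x ≠ 0 → x ∈ tsupport χ := fun v x hx => by
    have h1 : x ∈ tsupport (w v) := by
      by_contra h
      refine hx ?_
      have : fderiv ℝ (w v) x = 0 := by
        by_contra h'
        exact h (support_fderiv_subset ℝ h')
      simp [d, this]
    exact tsupport_mul_subset_left h1
  refine ⟨(∫ x, |d (1, 0) x|) + ∫ x, |d (0, 1) x|, max R 0, by positivity, le_max_right _ _,
    fun G g m hg hG hg0 hGm => ?_⟩
  have hGc : ContDiff ℝ 1 G := contDiff_one_iff_deriv.2 ⟨fun r => (hG r).differentiableAt, by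
    have : deriv G = g := funext fun r => (hG r).deriv
    rwa [this]⟩
  have hGρ : ContDiff ℝ 1 fun x => G (S.rho x) := hGc.comp (S.rho_smooth.of_le (by simp))
  -- The integral of `∂_v(χ ∂_vρ G(ρ))` vanishes. This trades the weight `g(ρ)`, which may be
  -- concentrated near the boundary, for its antiderivative `G(ρ)`, of which only a supremum bound
  -- is needed.
  have key : ∀ v, Integrable (fun x => χ x * fderiv ℝ S.rho x v ^ 2 * g (S.rho x)) ∧
      ∫ x, χ x * fderiv ℝ S.rho x v ^ 2 * g (S.rho x) ≤ (∫ x, |d v x|) * m := by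
    intro v
    have hW : ContDiff ℝ 1 fun x => w v x * G (S.rho x) := ((hw v).of_le (by simp)).mul hGρ
    have hder : ∀ x, fderiv ℝ (fun x => w v x * G (S.rho x)) x v =
        χ x * fderiv ℝ S.rho x v ^ 2 * g (S.rho x) + d v x * G (S.rho x) := fun x => by
      have h1 := ((hw v).differentiable (by simp) x).hasFDerivAt
      have h2 := (hG (S.rho x)).comp_hasFDerivAt x (S.rho_smooth.differentiable (by simp) x).hasFDerivAt
      have h3 := (h1.mul h2).fderiv
      have h4 : (fun x => w v x * G (S.rho x)) = w v * (G ∘ S.rho) := rfl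
      rw [h4, h3]
      simp [d, w]
      ring
    have h0 := integral_fderiv_eq_zero (μ := volume) hW (hwc v).mul_right v
    simp_rw [hder] at h0
    have hi2 : Integrable fun x => d v x * G (S.rho x) :=
      ((hdc v).mul hGρ.continuous).integrable_of_hasCompactSupport (hds v).mul_right
    have hi1 : Integrable fun x => χ x * fderiv ℝ S.rho x v ^ 2 * g (S.rho x) := by
      refine Continuous.integrable_of_hasCompactSupport ?_ (hχc.mul_right.mul_right)
      exact (χ.continuous.mul ((S.contDiff_fderiv_rho v).continuous.pow 2)).mul
        (hg.comp S.rho_smooth.continuous)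
    rw [integral_add hi1 hi2] at h0
    refine ⟨hi1, ?_⟩
    have h5 : -∫ x, d v x * G (S.rho x) ≤ ∫ x, |d v x| * m := by
      rw [← integral_neg]
      refine integral_mono hi2.neg (((hdc v).abs.integrable_of_hasCompactSupport
        (hds v).norm).mul_const m) fun x => ?_
      change -(d v x * G (S.rho x)) ≤ |d v x| * m
      by_cases hx : d v x = 0
      · simp [hx]
      · calc -(d v x * G (S.rho x)) ≤ |d v x * G (S.rho x)| := neg_le_abs _
          _ = |d v x| * |G (S.rho x)| := abs_mul _ _
          _ ≤ |d v x| * m := by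
            gcongr
            exact hGm _ ((hR x (hsupp v x hx)).trans (le_max_left _ _))
    rw [integral_mul_const] at h5
    linarith
  obtain ⟨hi1, hl1⟩ := key (1, 0)
  obtain ⟨hi2, hl2⟩ := key (0, 1)
  have hle : ∫⁻ x in S.carrier, ENNReal.ofReal (S.gradSq x * g (S.rho x)) ≤
      ∫⁻ x, ENNReal.ofReal (χ x * fderiv ℝ S.rho x (1, 0) ^ 2 * g (S.rho x) +
        χ x * fderiv ℝ S.rho x (0, 1) ^ 2 * g (S.rho x)) := by
    refine le_trans ?_ (setLIntegral_le_lintegral S.carrier _)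
    refine le_of_eq (setLIntegral_congr_fun S.isClosed_carrier.measurableSet fun x hx => ?_)
    simp only [hχ1 x hx, gradSq]
    congr 1; ring
  refine hle.trans ?_
  have hi : Integrable fun x => χ x * fderiv ℝ S.rho x (1, 0) ^ 2 * g (S.rho x) +
      χ x * fderiv ℝ S.rho x (0, 1) ^ 2 * g (S.rho x) := hi1.add hi2
  rw [← ofReal_integral_eq_lintegral_ofReal hi (Eventually.of_forall fun x => ?_)]
  · refine ENNReal.ofReal_le_ofReal ?_
    rw [integral_add hi1 hi2, add_mul]
    exact add_le_add hl1 hl2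
  · have := hg0 (S.rho x)
    have := χ.nonneg (x := x)
    simp only [Pi.zero_apply]
    positivity

end IsothermalSurface

/-! ### Collar volumes and integrability of the singular weight -/

namespace IsothermalSurface

variable {S : IsothermalSurface}

/-- Apply the coarea bound to `G(r) = arctan(r/ε)`: it is bounded independently of `ε`, and its
derivative is at least `1/(2ε)` on `[0, ε]`. The choice of `ε₀` keeps the gradient of `ρ` bounded
below in the collar. -/
theorem exists_volume_collar_le (S : IsothermalSurface) : ∃ C ε₀ : ℝ, 0 ≤ C ∧ 0 < ε₀ ∧
    ∀ ε ∈ Ioc 0 ε₀, volume (S.carrier ∩ {x | S.rho x ≤ ε}) ≤ ENNReal.ofReal (C * ε) := by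
  obtain ⟨C, R, hC, hR, h⟩ := S.exists_lintegral_gradSq_le
  obtain ⟨B, c, hB, hc, hBc⟩ := S.isCompact.exists_pos_le_add_mul S.continuous_gradSq
    S.rho_smooth.continuous (fun x hx => hx) fun x _ => S.gradSq_pos
  refine ⟨2 * Real.pi * C / c, c / (2 * B), by positivity, by positivity, fun ε hε => ?_⟩
  have hε0 := hε.1
  have h1 := h (fun r => Real.arctan (r / ε)) (fun r => 1 / (1 + (r / ε) ^ 2) * (1 / ε))
    (Real.pi / 2)
    ((continuous_const.div (by fun_prop) fun r => by positivity).mul continuous_const)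
    (fun r => ((hasDerivAt_id r).div_const ε).arctan) (fun r => by positivity)
    fun r _ => abs_le.2 ⟨(Real.neg_pi_div_two_lt_arctan _).le, (Real.arctan_lt_pi_div_two _).le⟩
  have hms : MeasurableSet (S.carrier ∩ {x | S.rho x ≤ ε}) :=
    S.isClosed_carrier.measurableSet.inter
      (isClosed_le S.rho_smooth.continuous continuous_const).measurableSet
  have h2 : ENNReal.ofReal (c / (4 * ε)) * volume (S.carrier ∩ {x | S.rho x ≤ ε}) ≤
      ENNReal.ofReal (C * (Real.pi / 2)) := by
    refine le_trans ?_ h1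
    rw [← setLIntegral_const]
    refine (setLIntegral_mono' hms fun x hx => ?_).trans (lintegral_mono_set inter_subset_left)
    refine ENNReal.ofReal_le_ofReal ?_
    have hx0 : 0 ≤ S.rho x := hx.1
    have hx1 : S.rho x ≤ ε := hx.2
    have h3 : c / 2 ≤ S.gradSq x := by
      have h4 := hBc x hx.1
      have h5 : B * S.rho x ≤ c / 2 := by
        calc B * S.rho x ≤ B * (c / (2 * B)) := by gcongr; exact hx1.trans hε.2
          _ = c / 2 := by field_simp
      linarith
    have h6 : (1 : ℝ) / 2 ≤ 1 / (1 + (S.rho x / ε) ^ 2) := by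
      refine one_div_le_one_div_of_le (by positivity) ?_
      have : S.rho x / ε ≤ 1 := (div_le_one hε0).2 hx1
      have h7 : 0 ≤ S.rho x / ε := by positivity
      nlinarith
    calc c / (4 * ε) = c / 2 * (1 / 2 * (1 / ε)) := by field_simp; norm_num
      _ ≤ _ := by
        have := S.gradSq_nonneg x
        gcongr
  have h3 : volume (S.carrier ∩ {x | S.rho x ≤ ε}) ≤
      ENNReal.ofReal (C * (Real.pi / 2)) / ENNReal.ofReal (c / (4 * ε)) := by
    rw [ENNReal.le_div_iff_mul_le (.inl (by simp; positivity)) (.inl (by simp)), mul_comm]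
    exact h2
  refine h3.trans (le_of_eq ?_)
  rw [← ENNReal.ofReal_div_of_pos (by positivity)]
  congr 1
  field_simp
  norm_num

theorem volume_bdry (S : IsothermalSurface) : volume S.bdry = 0 := by
  obtain ⟨C, ε₀, hC, hε₀, h⟩ := S.exists_volume_collar_le
  refine le_antisymm ?_ bot_le
  have ht : Tendsto (fun ε => ENNReal.ofReal (C * ε)) (𝓝[>] 0) (𝓝 0) := by
    have : Tendsto (fun ε => ENNReal.ofReal (C * ε)) (𝓝 0) (𝓝 (ENNReal.ofReal (C * 0))) :=
      (ENNReal.continuous_ofReal.comp (continuous_const.mul continuous_id)).tendsto 0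
    simpa using! this.mono_left nhdsWithin_le_nhds
  refine ge_of_tendsto ht ?_
  filter_upwards [Ioc_mem_nhdsGT hε₀] with ε hε
  refine (measure_mono fun x hx => ?_).trans (h ε hε)
  have hx' : S.rho x = 0 := hx
  exact ⟨hx'.ge, show S.rho x ≤ ε from hx'.trans_le hε.1.le⟩

theorem ae_mem_inner (S : IsothermalSurface) :
    ∀ᵐ x ∂volume.restrict S.carrier, x ∈ S.inner := by
  rw [ae_restrict_iff' S.isClosed_carrier.measurableSet]
  have : ∀ᵐ x, x ∉ S.bdry := by
    rw [ae_iff]; simpa using S.volume_bdry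
  filter_upwards [this] with x hx hxc
  exact lt_of_le_of_ne (show 0 ≤ S.rho x from hxc) (Ne.symm hx)

theorem lintegral_vol (S : IsothermalSurface) {f : PhasePoint → ENNReal} (hf : Measurable f) :
    ∫⁻ p, f p ∂S.vol = ∫⁻ x in S.carrier, ∫⁻ θ in Ioc 0 (2 * Real.pi),
      ENNReal.ofReal (Real.exp (2 * S.lam x)) * f (x, θ) := by
  have hm : Measurable fun p : PhasePoint => ENNReal.ofReal (Real.exp (2 * S.lam p.1)) := by
    have := S.lam_smooth.continuous
    exact (by fun_prop : Continuous fun p : PhasePoint =>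
      Real.exp (2 * S.lam p.1)).measurable.ennreal_ofReal
  rw [vol, lintegral_withDensity_eq_lintegral_mul _ hm hf, Measure.volume_eq_prod,
    ← Measure.prod_restrict, lintegral_prod _ (hm.mul hf).aemeasurable]
  rfl

theorem vol_absolutelyContinuous (S : IsothermalSurface) :
    S.vol ≪ volume.restrict (S.carrier ×ˢ Ioc 0 (2 * Real.pi)) :=
  withDensity_absolutelyContinuous _ _

theorem ae_mem_innerSM (S : IsothermalSurface) :
    ∀ᵐ p ∂S.vol, p ∈ S.innerSM := by
  refine S.vol_absolutelyContinuous.ae_le ?_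
  rw [Measure.volume_eq_prod, ← Measure.prod_restrict]
  exact Measure.quasiMeasurePreserving_fst.ae S.ae_mem_inner

theorem volume_carrier_lt_top (S : IsothermalSurface) : volume S.carrier < ⊤ :=
  S.isCompact.measure_lt_top

instance isFiniteMeasure_vol (S : IsothermalSurface) : IsFiniteMeasure S.vol := by
  have hc : IsCompact (S.carrier ×ˢ Icc (0 : ℝ) (2 * Real.pi)) := S.isCompact.prod isCompact_Icc
  have hcont : Continuous fun p : PhasePoint => Real.exp (2 * S.lam p.1) := by
    have := S.lam_smooth.continuous
    fun_prop
  refine isFiniteMeasure_withDensity_ofReal ?_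
  exact ((hcont.continuousOn.integrableOn_compact hc).mono_set
    (prod_mono le_rfl Ioc_subset_Icc_self)).2

/-- The antiderivative of `ρ^{-1/2}` is bounded. It is replaced by the regularisation `r/√q` with `q
= √(r² + ε²)`. The derivative of this is at least `1/(2√q)`, where `q ≤ r + ε` for `r ≥ 0`, and its
size for `|r| ≤ R` is at most `√R` for every `ε`. Fatou's lemma removes `ε`. -/
theorem lintegral_gradSq_div_sqrt_lt_top (S : IsothermalSurface) :
    ∫⁻ x in S.carrier, ENNReal.ofReal (S.gradSq x / Real.sqrt (S.rho x)) < ⊤ := by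
  obtain ⟨C, R, hC, hR, h⟩ := S.exists_lintegral_gradSq_le
  have key : ∀ ε > 0, ∫⁻ x in S.carrier, ENNReal.ofReal (S.gradSq x / Real.sqrt (S.rho x + ε)) ≤
      ENNReal.ofReal (2 * (C * Real.sqrt R)) := by
    intro ε hε
    let q : ℝ → ℝ := fun r => Real.sqrt (r ^ 2 + ε ^ 2)
    have hq0 : ∀ r, 0 < q r := fun r => Real.sqrt_pos.2 (by positivity)
    have hq2 : ∀ r, q r ^ 2 = r ^ 2 + ε ^ 2 := fun r => Real.sq_sqrt (by positivity)
    have hqc : Continuous q := by fun_prop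
    have hqs : ∀ r, 0 < Real.sqrt (q r) := fun r => Real.sqrt_pos.2 (hq0 r)
    let g : ℝ → ℝ := fun r => (1 - r ^ 2 / (2 * q r ^ 2)) / Real.sqrt (q r)
    have hg : Continuous g := by
      refine ((continuous_const.sub ((continuous_pow 2).div (by fun_prop) fun r => ?_))).div
        (by fun_prop) fun r => (hqs r).ne'
      have := hq0 r
      positivity
    have hg2 : ∀ r, 1 / (2 * Real.sqrt (q r)) ≤ g r := fun r => by
      have h1 : (1 : ℝ) / 2 ≤ 1 - r ^ 2 / (2 * q r ^ 2) := by
        have : r ^ 2 / (2 * q r ^ 2) ≤ 1 / 2 := by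
          rw [div_le_div_iff₀ (by have := hq0 r; positivity) two_pos, hq2]
          nlinarith [sq_nonneg ε]
        linarith
      have h2 := hqs r
      calc 1 / (2 * Real.sqrt (q r)) = (1 / 2) / Real.sqrt (q r) := by field_simp
        _ ≤ _ := by simp only [g]; gcongr
    have hG : ∀ r, HasDerivAt (fun r => r / Real.sqrt (q r)) (g r) r := fun r => by
      have h1 : HasDerivAt q ((2 * r) / (2 * q r)) r := by
        have := (((hasDerivAt_pow 2 r).add_const (ε ^ 2))).sqrt (by positivity)
        simpa using! this
      have h2 := (hasDerivAt_id r).div (h1.sqrt (hq0 r).ne') (hqs r).ne'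
      refine h2.congr_deriv ?_
      have h3 : Real.sqrt (q r) ^ 2 = q r := Real.sq_sqrt (hq0 r).le
      have h4 := hqs r
      have h5 := hq0 r
      simp only [g, id]
      rw [← h3] at h5 ⊢
      rw [Real.sqrt_sq h4.le]
      field_simp
    have h1 := h _ g (Real.sqrt R) hg hG (fun r => le_trans (by have := hqs r; positivity) (hg2 r))
      fun r hr => by
        have h2 := hqs r
        rw [abs_div, abs_of_pos h2, div_le_iff₀ h2, ← Real.sqrt_mul hR]
        refine Real.le_sqrt_of_sq_le ?_
        have h3 : |r| ≤ q r := Real.abs_le_sqrt (by linarith [sq_nonneg ε])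
        calc |r| ^ 2 = |r| * |r| := sq _
          _ ≤ R * q r := by gcongr
    calc _ ≤ ∫⁻ x in S.carrier, ENNReal.ofReal 2 * ENNReal.ofReal (S.gradSq x * g (S.rho x)) := by
          refine setLIntegral_mono' S.isClosed_carrier.measurableSet fun x hx => ?_
          rw [← ENNReal.ofReal_mul zero_le_two]
          refine ENNReal.ofReal_le_ofReal ?_
          have hx0 : 0 ≤ S.rho x := hx
          have h2 := hg2 (S.rho x)
          have h3 : 1 / Real.sqrt (S.rho x + ε) ≤ 1 / Real.sqrt (q (S.rho x)) := by
            refine one_div_le_one_div_of_le (hqs _) (Real.sqrt_le_sqrt ?_)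
            exact (Real.sqrt_le_left (by positivity)).2 (by nlinarith)
          have h4 := S.gradSq_nonneg x
          calc S.gradSq x / Real.sqrt (S.rho x + ε) = S.gradSq x * (1 / Real.sqrt (S.rho x + ε)) := by
                ring
            _ ≤ S.gradSq x * (1 / Real.sqrt (q (S.rho x))) := by gcongr
            _ = 2 * (S.gradSq x * (1 / (2 * Real.sqrt (q (S.rho x))))) := by ring
            _ ≤ _ := by gcongr
      _ = ENNReal.ofReal 2 * ∫⁻ x in S.carrier, ENNReal.ofReal (S.gradSq x * g (S.rho x)) := by
          rw [lintegral_const_mul]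
          exact ((S.continuous_gradSq.mul (hg.comp S.rho_smooth.continuous)).measurable).ennreal_ofReal
      _ ≤ _ := by
          rw [ENNReal.ofReal_mul zero_le_two]
          gcongr
  have hcont := S.continuous_gradSq
  have hcr := S.rho_smooth.continuous
  have hlim : ∫⁻ x in S.carrier, ENNReal.ofReal (S.gradSq x / Real.sqrt (S.rho x)) ≤
      ∫⁻ x in S.carrier, liminf (fun n : ℕ =>
        ENNReal.ofReal (S.gradSq x / Real.sqrt (S.rho x + 1 / ((n : ℝ) + 1)))) atTop := by
    refine lintegral_mono_ae ?_
    filter_upwards [S.ae_mem_inner] with x hx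
    have hx0 : 0 < S.rho x := hx
    refine le_of_eq (Tendsto.liminf_eq ?_).symm
    refine (ENNReal.continuous_ofReal.tendsto _).comp (Tendsto.div tendsto_const_nhds ?_
      (Real.sqrt_pos.2 hx0).ne')
    have := (tendsto_one_div_add_atTop_nhds_zero_nat (𝕜 := ℝ)).const_add (S.rho x)
    rw [add_zero] at this
    exact (Real.continuous_sqrt.tendsto _).comp this
  refine (hlim.trans (lintegral_liminf_le fun n => ?_)).trans_lt ?_
  · exact (hcont.measurable.div (by fun_prop : Continuous fun x =>
      Real.sqrt (S.rho x + 1 / ((n : ℝ) + 1))).measurable).ennreal_ofReal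
  · refine lt_of_le_of_lt (b := ENNReal.ofReal (2 * (C * Real.sqrt R))) ?_ ENNReal.ofReal_lt_top
    refine liminf_le_of_frequently_le' (Eventually.frequently (Eventually.of_forall fun n => ?_))
    exact key _ (by positivity)

theorem rhoDot_eq_cos_sin (x : ℝ × ℝ) (θ : ℝ) : S.rhoDot (x, θ) =
    Real.exp (-S.lam x) * fderiv ℝ S.rho x (1, 0) * Real.cos θ +
      Real.exp (-S.lam x) * fderiv ℝ S.rho x (0, 1) * Real.sin θ := by
  rw [rhoDot_eq, fderiv_apply_eq]
  simp [geodesicField]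
  ring

/-- Few geodesics are close to the boundary and almost tangential. -/
theorem lintegral_inv_rho_add_sq_rhoDot_lt_top (S : IsothermalSurface) :
    ∫⁻ p, ENNReal.ofReal ((S.rho p.1 + S.rhoDot p ^ 2)⁻¹) ∂S.vol < ⊤ := by
  let K : ℝ × ℝ → ℝ := fun x => Real.exp (-S.lam x) ^ 2 * S.gradSq x
  have hlc := S.lam_smooth.continuous
  have hgc := S.continuous_gradSq
  have hrc := S.rho_smooth.continuous
  have hK : Continuous K := by fun_prop
  have hK0 : ∀ x, 0 ≤ K x := fun x => mul_nonneg (by positivity) (S.gradSq_nonneg x)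
  -- The gradient may vanish inside `M`, where `ρ > 0` compensates. The square of `K` is used so
  -- that, after one factor `K` enters the angular integral, another remains to provide the `gradSq`
  -- in front of `ρ^{-1/2}`.
  obtain ⟨B, c, hB, hc, hBc⟩ := S.isCompact.exists_pos_le_add_mul (u := fun x => K x ^ 2) (hK.pow 2) hrc (fun x hx => hx)
    fun x _ hx => by
      have := S.gradSq_pos hx
      have h2 := Real.exp_pos (-S.lam x)
      change 0 < K x ^ 2
      simp only [K]; positivity
  obtain ⟨N₁, hN₁⟩ := S.isCompact.exists_bound_of_continuousOn (f := fun x =>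
    Real.exp (2 * S.lam x) * c⁻¹ * (2 * Real.pi * K x + 2 * Real.pi * B)) (by fun_prop)
  obtain ⟨N₂, hN₂⟩ := S.isCompact.exists_bound_of_continuousOn (f := fun x =>
    Real.exp (2 * S.lam x) * c⁻¹ * (Real.pi ^ 2 * Real.exp (-S.lam x) ^ 2 * Real.sqrt (K x)))
    (by fun_prop)
  have hrdc : Continuous S.rhoDot := contDiff_rhoDot.continuous
  have hmeas : Measurable fun p : PhasePoint => ENNReal.ofReal ((S.rho p.1 + S.rhoDot p ^ 2)⁻¹) :=
    (by fun_prop : Continuous fun p : PhasePoint => S.rho p.1 + S.rhoDot p ^ 2).measurable.inv.ennreal_ofReal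
  rw [S.lintegral_vol hmeas]
  have hb : ∀ x ∈ S.inner, ∫⁻ θ in Ioc 0 (2 * Real.pi), ENNReal.ofReal (Real.exp (2 * S.lam x)) *
      ENNReal.ofReal ((S.rho x + S.rhoDot (x, θ) ^ 2)⁻¹) ≤
      ENNReal.ofReal |N₁| + ENNReal.ofReal |N₂| *
        ENNReal.ofReal (S.gradSq x / Real.sqrt (S.rho x)) := by
    intro x hx
    have hx0 : 0 < S.rho x := hx
    have hxS := S.inner_subset_carrier hx
    set A := Real.exp (-S.lam x) * fderiv ℝ S.rho x (1, 0) with hA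
    set A' := Real.exp (-S.lam x) * fderiv ℝ S.rho x (0, 1) with hA'
    have hKA : A ^ 2 + A' ^ 2 = K x := by simp only [K, hA, hA', gradSq]; ring
    have hI := integral_inv_add_sq_le A A' hx0
    rw [hKA] at hI
    let J : ℝ → ℝ := fun θ => K x / (S.rho x + (A * Real.cos θ + A' * Real.sin θ) ^ 2)
    have hJc : Continuous J := continuous_const.div (by fun_prop) fun θ => by positivity
    let J' : ℝ → ℝ := fun θ => Real.exp (2 * S.lam x) * c⁻¹ * (K x * J θ + B)
    have hJ'c : Continuous J' := by fun_prop
    have hJ0 : ∀ θ, 0 ≤ J θ := fun θ => by have := hK0 x; positivity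
    have hJ'0 : ∀ θ, 0 ≤ J' θ := fun θ => by have := hK0 x; have := hJ0 θ; positivity
    calc _ ≤ ∫⁻ θ in Ioc 0 (2 * Real.pi), ENNReal.ofReal (J' θ) := by
          refine lintegral_mono fun θ => ?_
          simp only
          rw [← ENNReal.ofReal_mul (by positivity)]
          refine ENNReal.ofReal_le_ofReal ?_
          rw [rhoDot_eq_cos_sin, ← hA, ← hA']
          simp only [J', J]
          set d := S.rho x + (A * Real.cos θ + A' * Real.sin θ) ^ 2 with hd
          have hd0 : 0 < d := by positivity
          rw [mul_assoc]
          gcongr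
          rw [inv_le_iff_one_le_mul₀ hd0]
          have h1 := hBc x hxS
          have h2 : B * S.rho x ≤ B * d := by
            gcongr; rw [hd]; linarith [sq_nonneg (A * Real.cos θ + A' * Real.sin θ)]
          have h3 : c⁻¹ * (K x * (K x / d) + B) * d = c⁻¹ * (K x ^ 2 + B * d) := by
            field_simp
          rw [h3, inv_mul_eq_div, le_div_iff₀ hc]
          linarith
      _ = ENNReal.ofReal (∫ θ in Ioc 0 (2 * Real.pi), J' θ) := by
          rw [ofReal_integral_eq_lintegral_ofReal]
          · exact (hJ'c.integrableOn_Icc).mono_set Ioc_subset_Icc_self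
          · exact Eventually.of_forall hJ'0
      _ ≤ ENNReal.ofReal (|N₁| + |N₂| * (S.gradSq x / Real.sqrt (S.rho x))) := by
          refine ENNReal.ofReal_le_ofReal ?_
          rw [← intervalIntegral.integral_of_le (by positivity)]
          have hJK : Continuous fun θ => K x * J θ := by fun_prop
          simp only [J']
          rw [intervalIntegral.integral_const_mul, intervalIntegral.integral_add
            (hJK.intervalIntegrable _ _) (by simp), intervalIntegral.integral_const_mul,
            intervalIntegral.integral_const]
          have h1 := (le_abs_self _).trans ((hN₁ x hxS).trans (le_abs_self _))
          have h2 := (le_abs_self _).trans ((hN₂ x hxS).trans (le_abs_self _))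
          have h3 := hK0 x
          have h4 : 0 ≤ S.gradSq x / Real.sqrt (S.rho x) :=
            div_nonneg (S.gradSq_nonneg x) (Real.sqrt_nonneg _)
          calc _ ≤ Real.exp (2 * S.lam x) * c⁻¹ * (K x * (2 * Real.pi + Real.pi ^ 2 *
                Real.sqrt (K x) / Real.sqrt (S.rho x)) + (2 * Real.pi - 0) • B) := by gcongr
            _ = Real.exp (2 * S.lam x) * c⁻¹ * (2 * Real.pi * K x + 2 * Real.pi * B) +
              Real.exp (2 * S.lam x) * c⁻¹ * (Real.pi ^ 2 * Real.exp (-S.lam x) ^ 2 *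
                Real.sqrt (K x)) * (S.gradSq x / Real.sqrt (S.rho x)) := by
                have : K x = Real.exp (-S.lam x) ^ 2 * S.gradSq x := rfl
                set k' := Real.sqrt (K x)
                rw [this, smul_eq_mul]
                ring
            _ ≤ _ := by gcongr
      _ = _ := by
          rw [ENNReal.ofReal_add (by positivity) (mul_nonneg (abs_nonneg _)
            (div_nonneg (S.gradSq_nonneg x) (Real.sqrt_nonneg _))), ENNReal.ofReal_mul (by positivity)]
  calc _ ≤ ∫⁻ x in S.carrier, (ENNReal.ofReal |N₁| + ENNReal.ofReal |N₂| *
        ENNReal.ofReal (S.gradSq x / Real.sqrt (S.rho x))) := by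
        refine lintegral_mono_ae ?_
        filter_upwards [S.ae_mem_inner] with x hx using hb x hx
    _ < ⊤ := by
        rw [lintegral_add_left measurable_const, lintegral_const_mul]
        · refine ENNReal.add_lt_top.2 ⟨?_, ENNReal.mul_lt_top ENNReal.ofReal_lt_top
            S.lintegral_gradSq_div_sqrt_lt_top⟩
          rw [setLIntegral_const]
          exact ENNReal.mul_lt_top ENNReal.ofReal_lt_top S.volume_carrier_lt_top
        · exact (hgc.measurable.div (by fun_prop : Continuous fun x =>
            Real.sqrt (S.rho x)).measurable).ennreal_ofReal

end IsothermalSurface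

/-! ### Integration by parts on the unit circle bundle -/

theorem integrableOn_univ_prod_Ioc {A : PhasePoint → ℂ} (hA : Continuous A) {K : Set (ℝ × ℝ)}
    (hK : IsCompact K) (h0 : ∀ p, p.1 ∉ K → A p = 0) (a b : ℝ) :
    IntegrableOn A ((univ : Set (ℝ × ℝ)) ×ˢ Ioc a b) := by
  have h1 : IntegrableOn A (K ×ˢ Ioc a b) :=
    (hA.continuousOn.integrableOn_compact (hK.prod (isCompact_Icc (a := a) (b := b)))).mono_set
      (prod_mono le_rfl Ioc_subset_Icc_self)
  refine h1.of_forall_sdiff_eq_zero (MeasurableSet.univ.prod measurableSet_Ioc) fun p hp => h0 p ?_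
  exact fun hpK => hp.2 ⟨hpK, hp.1.2⟩

theorem integral_univ_prod_Ioc_fderiv_fst {A : PhasePoint → ℂ} (hA : ContDiff ℝ 1 A)
    {K : Set (ℝ × ℝ)} (hK : IsCompact K) (h0 : ∀ p : PhasePoint, p.1 ∉ K → A p = 0) (a b : ℝ)
    (v : ℝ × ℝ) : ∫ p in (univ : Set (ℝ × ℝ)) ×ˢ Ioc a b, fderiv ℝ A p (v, 0) = 0 := by
  have hd : Continuous fun p => fderiv ℝ A p (v, 0) :=
    (hA.continuous_fderiv one_ne_zero).clm_apply continuous_const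
  have hd0 : ∀ p : PhasePoint, p.1 ∉ K → fderiv ℝ A p (v, 0) = 0 := fun p hp => by
    have : A =ᶠ[𝓝 p] fun _ => 0 := by
      filter_upwards [(hK.isClosed.isOpen_compl.preimage continuous_fst).mem_nhds hp] with q hq
        using h0 q hq
    rw [this.fderiv_eq]; simp
  have hi := integrableOn_univ_prod_Ioc hd hK hd0 a b
  rw [Measure.volume_eq_prod] at hi ⊢
  rw [← setIntegral_prod_swap]
  have hi' : IntegrableOn (fun z : ℝ × (ℝ × ℝ) => fderiv ℝ A z.swap (v, 0))
      (Ioc a b ×ˢ (univ : Set (ℝ × ℝ))) (volume.prod volume) := by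
    rw [IntegrableOn, ← Measure.prod_restrict] at hi ⊢
    exact hi.swap
  rw [setIntegral_prod _ hi']
  have : ∀ θ, ∫ x, fderiv ℝ A (x, θ) (v, 0) = 0 := fun θ => by
    have hd : ∀ x, fderiv ℝ (fun x => A (x, θ)) x v = fderiv ℝ A (x, θ) (v, 0) := fun x => by
      have h1 : HasFDerivAt (fun x : ℝ × ℝ => (x, θ)) (ContinuousLinearMap.inl ℝ (ℝ × ℝ) ℝ) x :=
        hasFDerivAt_prodMk_left x θ
      have h2 := (hA.differentiable one_ne_zero (x, θ)).hasFDerivAt.comp x h1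
      have h3 : (fun x => A (x, θ)) = A ∘ fun x => (x, θ) := rfl
      rw [h3, h2.fderiv]
      simp
    simp_rw [← hd]
    refine integral_fderiv_eq_zero (hA.comp (by fun_prop : ContDiff ℝ 1 fun x : ℝ × ℝ => (x, θ)))
      (HasCompactSupport.intro hK fun x hx => h0 _ hx) v
  simp [this]

theorem integral_univ_prod_Ioc_fderiv_snd {A : PhasePoint → ℂ} (hA : ContDiff ℝ 1 A)
    {K : Set (ℝ × ℝ)} (hK : IsCompact K) (h0 : ∀ p : PhasePoint, p.1 ∉ K → A p = 0) {a b : ℝ}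
    (hab : a ≤ b) (hper : ∀ x, A (x, a) = A (x, b)) :
    ∫ p in (univ : Set (ℝ × ℝ)) ×ˢ Ioc a b, fderiv ℝ A p (0, 1) = 0 := by
  have hd : Continuous fun p => fderiv ℝ A p (0, 1) :=
    (hA.continuous_fderiv one_ne_zero).clm_apply continuous_const
  have hd0 : ∀ p : PhasePoint, p.1 ∉ K → fderiv ℝ A p (0, 1) = 0 := fun p hp => by
    have : A =ᶠ[𝓝 p] fun _ => 0 := by
      filter_upwards [(hK.isClosed.isOpen_compl.preimage continuous_fst).mem_nhds hp] with q hq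
        using h0 q hq
    rw [this.fderiv_eq]; simp
  have hi := integrableOn_univ_prod_Ioc hd hK hd0 a b
  rw [Measure.volume_eq_prod] at hi ⊢
  rw [setIntegral_prod _ hi]
  have : ∀ x, ∫ θ in Ioc a b, fderiv ℝ A (x, θ) (0, 1) = 0 := fun x => by
    rw [← intervalIntegral.integral_of_le hab, intervalIntegral.integral_eq_sub_of_hasDerivAt
      (f := fun θ => A (x, θ)), hper, sub_self]
    · intro θ _
      have h1 : HasDerivAt (fun θ : ℝ => (x, θ)) ((0 : ℝ × ℝ), (1 : ℝ)) θ :=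
        (hasDerivAt_const θ x).prodMk (hasDerivAt_id θ)
      exact (hA.differentiable one_ne_zero (x, θ)).hasFDerivAt.comp_hasDerivAt θ h1
    · exact (hd.comp (by fun_prop : Continuous fun θ : ℝ => (x, θ))).intervalIntegrable _ _
  simp [this]

namespace IsothermalSurface

variable {S : IsothermalSurface}

theorem geodesicField_rot_decomp (S : IsothermalSurface) (c : ℝ) (p : PhasePoint)
    {F : Type*} [NormedAddCommGroup F] [NormedSpace ℝ F] (L : PhasePoint →L[ℝ] F) :
    Real.exp (2 * S.lam p.1) • L (S.geodesicField (p.1, p.2 + c)) =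
      (Real.exp (S.lam p.1) * Real.cos (p.2 + c)) • L ((1, 0), 0) +
      (Real.exp (S.lam p.1) * Real.sin (p.2 + c)) • L ((0, 1), 0) +
      (Real.exp (S.lam p.1) * (-Real.sin (p.2 + c) * S.lamX p.1 +
        Real.cos (p.2 + c) * S.lamY p.1)) • L (0, 1) := by
  rw [← map_smul, ← map_smul, ← map_smul, ← map_smul, ← map_add, ← map_add]
  congr 1
  have h : Real.exp (2 * S.lam p.1) * Real.exp (-S.lam p.1) = Real.exp (S.lam p.1) := by
    rw [← Real.exp_add]; congr 1; ring
  simp only [geodesicField, smul_smul, h]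
  ext <;> simp

/-- The rotated geodesic fields preserve the volume form. -/
theorem integral_strip_eq_zero (S : IsothermalSurface) (c : ℝ) {w : PhasePoint → ℂ}
    (hw : ContDiff ℝ 1 w) {K : Set (ℝ × ℝ)} (hK : IsCompact K) (h0 : ∀ p : PhasePoint, p.1 ∉ K → w p = 0)
    (hper : ∀ x θ, w (x, θ + 2 * Real.pi) = w (x, θ)) :
    ∫ p in (univ : Set (ℝ × ℝ)) ×ˢ Ioc 0 (2 * Real.pi),
      Real.exp (2 * S.lam p.1) • fderiv ℝ w p (S.geodesicField (p.1, p.2 + c)) = 0 := by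
  have hl := S.lam_smooth
  have hx := S.contDiff_lamX
  have hy := S.contDiff_lamY
  let a₁ : PhasePoint → ℝ := fun p => Real.exp (S.lam p.1) * Real.cos (p.2 + c)
  let a₂ : PhasePoint → ℝ := fun p => Real.exp (S.lam p.1) * Real.sin (p.2 + c)
  let a₃ : PhasePoint → ℝ := fun p => Real.exp (S.lam p.1) * (-Real.sin (p.2 + c) * S.lamX p.1 +
    Real.cos (p.2 + c) * S.lamY p.1)
  have h₁ : ContDiff ℝ ∞ a₁ := by fun_prop
  have h₂ : ContDiff ℝ ∞ a₂ := by fun_prop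
  have h₃ : ContDiff ℝ ∞ a₃ := by fun_prop
  have hexp : ∀ p : PhasePoint, HasFDerivAt (fun p : PhasePoint => Real.exp (S.lam p.1))
      (Real.exp (S.lam p.1) • (fderiv ℝ S.lam p.1 ∘L ContinuousLinearMap.fst ℝ (ℝ × ℝ) ℝ)) p :=
    fun p => (((hl.differentiable (by simp) p.1).hasFDerivAt).comp p hasFDerivAt_fst).exp
  have hang : ∀ p : PhasePoint, HasFDerivAt (fun p : PhasePoint => p.2 + c)
      (ContinuousLinearMap.snd ℝ (ℝ × ℝ) ℝ) p := fun p => hasFDerivAt_snd.add_const c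
  have d₁ : ∀ p, fderiv ℝ a₁ p ((1, 0), 0) = Real.exp (S.lam p.1) * S.lamX p.1 * Real.cos (p.2 + c) :=
    fun p => by
      have := ((hexp p).mul (hang p).cos).fderiv
      have e : a₁ = (fun p : PhasePoint => Real.exp (S.lam p.1)) * fun p => Real.cos (p.2 + c) := rfl
      rw [e, this]
      simp [lamX]; ring
  have d₂ : ∀ p, fderiv ℝ a₂ p ((0, 1), 0) = Real.exp (S.lam p.1) * S.lamY p.1 * Real.sin (p.2 + c) :=
    fun p => by
      have := ((hexp p).mul (hang p).sin).fderiv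
      have e : a₂ = (fun p : PhasePoint => Real.exp (S.lam p.1)) * fun p => Real.sin (p.2 + c) := rfl
      rw [e, this]
      simp [lamY]; ring
  have d₃ : ∀ p, fderiv ℝ a₃ p (0, 1) = Real.exp (S.lam p.1) * (-Real.cos (p.2 + c) * S.lamX p.1 -
      Real.sin (p.2 + c) * S.lamY p.1) := fun p => by
    have hline : HasDerivAt (fun θ : ℝ => ((p.1, θ) : PhasePoint)) ((0 : ℝ × ℝ), (1 : ℝ)) p.2 :=
      (hasDerivAt_const _ _).prodMk (hasDerivAt_id _)
    have e1 := (h₃.differentiable (by simp) p).hasFDerivAt.comp_hasDerivAt p.2 hline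
    have hθ : HasDerivAt (fun θ : ℝ => θ + c) 1 p.2 := (hasDerivAt_id _).add_const c
    have e2 := (((hθ.sin.neg.mul_const (S.lamX p.1)).add (hθ.cos.mul_const (S.lamY p.1))).const_mul
      (Real.exp (S.lam p.1)))
    refine (e1.unique e2).trans ?_
    simp; ring
  have hprod : ∀ {a : PhasePoint → ℝ}, ContDiff ℝ ∞ a → ∀ p v, fderiv ℝ (fun p => a p • w p) p v =
      a p • fderiv ℝ w p v + fderiv ℝ a p v • w p := fun {a} ha p v => by
    have := ((ha.differentiable (by simp) p).hasFDerivAt.smul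
      (hw.differentiable one_ne_zero p).hasFDerivAt).fderiv
    rw [show (fun p => a p • w p) = a • w from rfl, this]
    simp
  have hC : ∀ {a : PhasePoint → ℝ}, ContDiff ℝ ∞ a → ContDiff ℝ 1 fun p => a p • w p :=
    fun ha => (ha.of_le (by simp)).smul hw
  have hZ : ∀ (a : PhasePoint → ℝ), ∀ p : PhasePoint, p.1 ∉ K → a p • w p = 0 := fun a p hp => by
    rw [h0 p hp, smul_zero]
  have hd : ∀ {a : PhasePoint → ℝ}, ContDiff ℝ ∞ a → ∀ v, IntegrableOn
      (fun p => fderiv ℝ (fun p => a p • w p) p v)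
      ((univ : Set (ℝ × ℝ)) ×ˢ Ioc 0 (2 * Real.pi)) := fun {a} ha v => by
    refine integrableOn_univ_prod_Ioc (((hC ha).continuous_fderiv one_ne_zero).clm_apply
      continuous_const) hK (fun p hp => ?_) _ _
    have : (fun p => a p • w p) =ᶠ[𝓝 p] fun _ => 0 := by
      filter_upwards [(hK.isClosed.isOpen_compl.preimage continuous_fst).mem_nhds hp] with q hq
        using hZ a q hq
    rw [this.fderiv_eq]; simp
  -- The horizontal divergence `e^λ (λ_x cos + λ_y sin)` cancels the angular one, so `e^{2λ}` times
  -- the derivative along the field is a sum of pure derivatives.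
  have hsum : ∀ p, Real.exp (2 * S.lam p.1) • fderiv ℝ w p (S.geodesicField (p.1, p.2 + c)) =
      fderiv ℝ (fun p => a₁ p • w p) p ((1, 0), 0) + fderiv ℝ (fun p => a₂ p • w p) p ((0, 1), 0) +
        fderiv ℝ (fun p => a₃ p • w p) p (0, 1) := fun p => by
    rw [geodesicField_rot_decomp, hprod h₁, hprod h₂, hprod h₃, d₁, d₂, d₃]
    simp only [a₁, a₂, a₃]
    module
  simp_rw [hsum]
  have hi : IntegrableOn (fun p => fderiv ℝ (fun p => a₁ p • w p) p ((1, 0), 0) +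
      fderiv ℝ (fun p => a₂ p • w p) p ((0, 1), 0))
      ((univ : Set (ℝ × ℝ)) ×ˢ Ioc 0 (2 * Real.pi)) := (hd h₁ _).add (hd h₂ _)
  rw [integral_add hi (hd h₃ _), integral_add (hd h₁ _) (hd h₂ _),
    integral_univ_prod_Ioc_fderiv_fst (hC h₁) hK (hZ a₁),
    integral_univ_prod_Ioc_fderiv_fst (hC h₂) hK (hZ a₂),
    integral_univ_prod_Ioc_fderiv_snd (hC h₃) hK (hZ a₃) (by positivity)]
  · simp
  · intro x
    have := hper x 0
    rw [zero_add] at this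
    simp only [a₃, this, add_comm (2 * Real.pi) c, Real.sin_add_two_pi, Real.cos_add_two_pi, zero_add]

theorem integral_vol (S : IsothermalSurface) (F : PhasePoint → ℂ) :
    ∫ p, F p ∂S.vol = ∫ p in S.carrier ×ˢ Ioc 0 (2 * Real.pi), Real.exp (2 * S.lam p.1) • F p := by
  have hm : Measurable fun p : PhasePoint => Real.toNNReal (Real.exp (2 * S.lam p.1)) := by
    have := S.lam_smooth.continuous
    exact (by fun_prop : Continuous fun p : PhasePoint => Real.exp (2 * S.lam p.1)).measurable.real_toNNReal
  have := integral_withDensity_eq_integral_smul (μ := volume.restrict (S.carrier ×ˢ Ioc 0 (2 * Real.pi)))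
    hm F
  rw [vol]
  refine this.trans (integral_congr_ae (Eventually.of_forall fun p => ?_))
  simp only [NNReal.smul_def, Real.coe_toNNReal _ (Real.exp_pos _).le]

theorem ae_mem_strip (S : IsothermalSurface) :
    ∀ᵐ p ∂S.vol, p ∈ S.innerSM ∧ p ∈ S.carrier ×ˢ Icc 0 (2 * Real.pi) := by
  filter_upwards [S.ae_mem_innerSM, S.vol_absolutelyContinuous.ae_le
    (ae_restrict_mem (S.isClosed_carrier.measurableSet.prod measurableSet_Ioc))] with p hp hp'
  exact ⟨hp, prod_mono le_rfl Ioc_subset_Icc_self hp'⟩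

theorem aestronglyMeasurable_vol {F : Type*} [TopologicalSpace F] [TopologicalSpace.PseudoMetrizableSpace F]
    [SecondCountableTopology F] {u : PhasePoint → F} (hu : ContinuousOn u S.innerSM) :
    AEStronglyMeasurable u S.vol := by
  rw [← Measure.restrict_eq_self_of_ae_mem S.ae_mem_innerSM]
  let _ : MeasurableSpace F := borel F
  have : BorelSpace F := ⟨rfl⟩
  exact hu.aestronglyMeasurable isOpen_innerSM.measurableSet

theorem integrable_vol_of_bound {u : PhasePoint → ℂ} (hu : ContinuousOn u S.innerSM) {M : ℝ}
    (hM : ∀ p ∈ S.carrier ×ˢ Icc 0 (2 * Real.pi), p ∈ S.innerSM → ‖u p‖ ≤ M) :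
    Integrable u S.vol := by
  refine Integrable.of_bound (aestronglyMeasurable_vol hu) M ?_
  filter_upwards [S.ae_mem_strip] with p hp using hM p hp.2 hp.1

theorem isCompact_strip (S : IsothermalSurface) : IsCompact (S.carrier ×ˢ Icc 0 (2 * Real.pi)) :=
  IsCompact.prod S.isCompact isCompact_Icc

theorem exists_vol_collar_le (S : IsothermalSurface) : ∃ C ε₀ : ℝ, 0 ≤ C ∧ 0 < ε₀ ∧
    ∀ ε ∈ Ioc 0 ε₀, S.vol.real {p | S.rho p.1 ≤ ε} ≤ C * ε := by
  obtain ⟨C, ε₀, hC, hε₀, h⟩ := S.exists_volume_collar_le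
  obtain ⟨Λ, hΛ⟩ := S.isCompact.exists_bound_of_continuousOn (f := fun x => Real.exp (2 * S.lam x))
    (by have := S.lam_smooth.continuous; fun_prop)
  refine ⟨|Λ| * (C * (2 * Real.pi)), ε₀, by positivity, hε₀, fun ε hε => ?_⟩
  have hms : MeasurableSet {p : PhasePoint | S.rho p.1 ≤ ε} :=
    (isClosed_le (S.rho_smooth.continuous.comp continuous_fst) continuous_const).measurableSet
  have hms2 : MeasurableSet (S.carrier ×ˢ Ioc 0 (2 * Real.pi)) :=
    S.isClosed_carrier.measurableSet.prod measurableSet_Ioc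
  refine ENNReal.toReal_le_of_le_ofReal (by have := hε.1; positivity) ?_
  rw [vol, withDensity_apply _ hms, Measure.restrict_restrict hms]
  calc _ ≤ ∫⁻ _ in {p : PhasePoint | S.rho p.1 ≤ ε} ∩ S.carrier ×ˢ Ioc 0 (2 * Real.pi),
        ENNReal.ofReal |Λ| := by
        refine setLIntegral_mono' (hms.inter hms2) fun p hp => ENNReal.ofReal_le_ofReal ?_
        exact (le_abs_self _).trans ((hΛ p.1 hp.2.1).trans (le_abs_self _))
    _ = ENNReal.ofReal |Λ| * volume ((S.carrier ∩ {x | S.rho x ≤ ε}) ×ˢ Ioc 0 (2 * Real.pi)) := by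
        rw [setLIntegral_const]
        congr 2
        ext p
        simp only [mem_inter_iff, mem_prod, Set.mem_ofPred_eq]
        tauto
    _ ≤ _ := by
        rw [Measure.volume_eq_prod, Measure.prod_prod, Real.volume_Ioc, sub_zero,
          show |Λ| * (C * (2 * Real.pi)) * ε = |Λ| * (C * ε * (2 * Real.pi)) by ring,
          ENNReal.ofReal_mul (abs_nonneg _),
          ENNReal.ofReal_mul (p := C * ε) (by have := hε.1; positivity)]
        exact mul_le_mul_right (mul_le_mul_left (h ε hε) _) _

/-- A function that tends to zero at the boundary is uniformly small near the boundary. -/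
theorem exists_norm_le_collar {w : PhasePoint → ℂ}
    (hlim : ∀ p : PhasePoint, p.1 ∈ S.bdry → Tendsto w (𝓝[S.innerSM] p) (𝓝 0)) {δ : ℝ} (hδ : 0 < δ) :
    ∃ ε > 0, ∀ p ∈ S.carrier ×ˢ Icc 0 (2 * Real.pi), p ∈ S.innerSM → S.rho p.1 ≤ ε → ‖w p‖ ≤ δ := by
  refine S.isCompact_strip.induction_on
    (p := fun s => ∃ ε > 0, ∀ p ∈ s, p ∈ S.innerSM → S.rho p.1 ≤ ε → ‖w p‖ ≤ δ)
    ⟨1, one_pos, by simp⟩ (fun s t hst ⟨ε, hε, h⟩ => ⟨ε, hε, fun p hp => h p (hst hp)⟩)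
    (fun s t ⟨ε, hε, h⟩ ⟨ε', hε', h'⟩ => ⟨min ε ε', lt_min hε hε', fun p hp hS hpε => ?_⟩)
    fun p hp => ?_
  · rcases hp with hp | hp
    · exact h p hp hS (hpε.trans (min_le_left _ _))
    · exact h' p hp hS (hpε.trans (min_le_right _ _))
  · have hc : Continuous fun q : PhasePoint => S.rho q.1 := S.rho_smooth.continuous.comp continuous_fst
    rcases (show 0 ≤ S.rho p.1 from hp.1).eq_or_lt with h0 | h0
    · have := (hlim p h0.symm).norm
      rw [norm_zero] at this
      have h1 : ∀ᶠ q in 𝓝 p, q ∈ S.innerSM → ‖w q‖ < δ :=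
        eventually_nhdsWithin_iff.1 (this.eventually_lt_const hδ)
      exact ⟨_, mem_nhdsWithin_of_mem_nhds h1, 1, one_pos, fun q hq hS _ => (hq hS).le⟩
    · refine ⟨{q | S.rho p.1 / 2 < S.rho q.1}, mem_nhdsWithin_of_mem_nhds
        ((isOpen_lt continuous_const hc).mem_nhds (half_lt_self h0)), S.rho p.1 / 2, half_pos h0,
        fun q hq _ hle => absurd hle (not_le.2 hq)⟩

end IsothermalSurface

namespace IsothermalSurface

variable {S : IsothermalSurface}

set_option maxHeartbeats 400000 in
/-- Integration by parts on `SM` for the (rotated) geodesic field, for functions that are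
differentiable in the interior only and vanish at the boundary. -/
theorem integral_vol_rot_eq_zero (S : IsothermalSurface) (c : ℝ) {w : PhasePoint → ℂ}
    {w' : PhasePoint → PhasePoint →L[ℝ] ℂ} (hw : ∀ p ∈ S.innerSM, HasFDerivAt w (w' p) p)
    (hw' : ContinuousOn w' S.innerSM)
    (hper : ∀ p ∈ S.innerSM, w (p.1, p.2 + 2 * Real.pi) = w p)
    (hint : Integrable (fun p => w' p (S.geodesicField (p.1, p.2 + c))) S.vol)
    (hlim : ∀ p : PhasePoint, p.1 ∈ S.bdry → Tendsto w (𝓝[S.innerSM] p) (𝓝 0)) :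
    ∫ p, w' p (S.geodesicField (p.1, p.2 + c)) ∂S.vol = 0 := by
  set Y : PhasePoint → PhasePoint := fun p => S.geodesicField (p.1, p.2 + c) with hY
  have hYc : Continuous Y := S.contDiff_geodesicField.continuous.comp (by fun_prop)
  have hrc := S.rho_smooth.continuous
  let s : ℝ → ℝ := Real.smoothTransition
  have hs : ContDiff ℝ ∞ s := Real.smoothTransition.contDiff
  -- A cutoff that vanishes for `ρ ≤ ε/2` and equals one for `ρ ≥ ε`, so its derivative is `O(1/ε)`
  -- and, over `M`, supported in the collar.
  let ψ : ℝ → PhasePoint → ℝ := fun ε p => s (2 * S.rho p.1 / ε - 1)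
  have hψ : ∀ ε, ContDiff ℝ ∞ (ψ ε) := fun ε => by
    have := S.rho_smooth
    exact hs.comp (by fun_prop)
  have hψ0 : ∀ ε > 0, ∀ p : PhasePoint, S.rho p.1 ≤ ε / 2 → ψ ε p = 0 := fun ε hε p hp => by
    refine Real.smoothTransition.zero_of_nonpos ?_
    rw [sub_nonpos, div_le_one hε]; linarith
  have hψ1 : ∀ ε > 0, ∀ p : PhasePoint, ε ≤ S.rho p.1 → ψ ε p = 1 := fun ε hε p hp => by
    refine Real.smoothTransition.one_of_one_le ?_
    have : 2 ≤ 2 * S.rho p.1 / ε := by rw [le_div_iff₀ hε]; linarith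
    linarith
  have hψn : ∀ ε p, ‖ψ ε p‖ ≤ 1 := fun ε p => by
    rw [Real.norm_eq_abs, abs_of_nonneg (Real.smoothTransition.nonneg _)]
    exact Real.smoothTransition.le_one _
  -- the derivative of the cutoff
  obtain ⟨s₁, hs₁⟩ := (isCompact_Icc (a := (-1 : ℝ)) (b := 1)).exists_bound_of_continuousOn
    (hs.continuous_deriv (by simp)).continuousOn
  obtain ⟨N, hN⟩ := S.isCompact_strip.exists_bound_of_continuousOn (f := fun p =>
    fderiv ℝ S.rhoLift p (Y p))
    (((S.contDiff_rhoLift.continuous_fderiv (by simp)).clm_apply hYc).continuousOn)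
  have hdψ : ∀ ε p, fderiv ℝ (ψ ε) p (Y p) =
      deriv s (2 * S.rho p.1 / ε - 1) * (2 / ε * fderiv ℝ S.rhoLift p (Y p)) := fun ε p => by
    have h1 := (S.contDiff_rhoLift.differentiable (by simp) p).hasFDerivAt
    have h2 : HasFDerivAt (fun p : PhasePoint => 2 * S.rho p.1 / ε - 1)
        ((2 / ε) • fderiv ℝ S.rhoLift p) p := by
      have := (h1.const_mul (2 / ε)).sub_const 1
      refine this.congr_of_eventuallyEq (Eventually.of_forall fun q => ?_)
      simp only [rhoLift]; ring
    have h3 := ((hs.differentiable (by simp) (2 * S.rho p.1 / ε - 1)).hasDerivAt.comp_hasFDerivAt p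
      h2).fderiv
    rw [show ψ ε = s ∘ fun p : PhasePoint => 2 * S.rho p.1 / ε - 1 from rfl, h3]
    simp
  have hdψle : ∀ ε > 0, ∀ p ∈ S.carrier ×ˢ Icc 0 (2 * Real.pi), S.rho p.1 ≤ ε →
      ‖fderiv ℝ (ψ ε) p (Y p)‖ ≤ |s₁| * (2 / ε * |N|) := fun ε hε p hp hpε => by
    have hp0 : 0 ≤ S.rho p.1 := hp.1
    rw [hdψ, norm_mul, norm_mul, Real.norm_eq_abs (2 / ε), abs_of_pos (by positivity)]
    gcongr
    · refine (hs₁ _ ⟨?_, ?_⟩).trans (le_abs_self _)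
      · have : 0 ≤ 2 * S.rho p.1 / ε := by positivity
        linarith
      · have : 2 * S.rho p.1 / ε ≤ 2 := by rw [div_le_iff₀ hε]; linarith
        linarith
    · exact (hN p hp).trans (le_abs_self _)
  have hdψ0 : ∀ ε > 0, ∀ p : PhasePoint, ε < S.rho p.1 → fderiv ℝ (ψ ε) p (Y p) = 0 :=
    fun ε hε p hp => by
      have : ψ ε =ᶠ[𝓝 p] fun _ => 1 := by
        filter_upwards [(isOpen_lt continuous_const (hrc.comp continuous_fst)).mem_nhds hp] with q hq
          using hψ1 ε hε q (le_of_lt hq)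
      rw [this.fderiv_eq]; simp
  -- the truncated function
  have hwd : ContDiffOn ℝ 1 w S.innerSM := by
    rw [show (1 : WithTop ℕ∞) = 0 + 1 from rfl, contDiffOn_succ_iff_fderiv_of_isOpen isOpen_innerSM]
    refine ⟨fun p hp => (hw p hp).differentiableAt.differentiableWithinAt, by simp, ?_⟩
    rw [contDiffOn_zero]
    exact hw'.congr fun p hp => (hw p hp).fderiv
  have htrunc : ∀ ε > 0, ContDiff ℝ 1 fun p => ψ ε p • w p := fun ε hε => by
    rw [contDiff_iff_contDiffAt]
    intro p
    by_cases hp : 0 < S.rho p.1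
    · exact ((hψ ε).of_le (by simp)).contDiffAt.smul (hwd.contDiffAt (isOpen_innerSM.mem_nhds hp))
    · have : (fun p => ψ ε p • w p) =ᶠ[𝓝 p] fun _ => 0 := by
        filter_upwards [(isOpen_lt (hrc.comp continuous_fst) continuous_const).mem_nhds
          (show S.rho p.1 < ε / 2 by linarith [half_pos hε])] with q hq
        rw [hψ0 ε hε q (le_of_lt hq), zero_smul]
      exact contDiffAt_const.congr_of_eventuallyEq this
  have hK : ∀ ε > 0, IsCompact {x | ε / 2 ≤ S.rho x} := fun ε hε =>
    S.isCompact.of_isClosed_subset (isClosed_le continuous_const hrc) fun x hx =>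
      (half_pos hε).le.trans hx
  have hKz : ∀ ε > 0, ∀ p : PhasePoint, p.1 ∉ {x | ε / 2 ≤ S.rho x} → ψ ε p • w p = 0 :=
    fun ε hε p hp => by rw [hψ0 ε hε p (le_of_not_ge hp), zero_smul]
  have htot : ∀ ε > 0, ∫ p, fderiv ℝ (fun p => ψ ε p • w p) p (Y p) ∂S.vol = 0 := fun ε hε => by
    rw [integral_vol]
    have h1 := S.integral_strip_eq_zero c (htrunc ε hε) (hK ε hε) (hKz ε hε) fun x θ => by
      by_cases hx : 0 < S.rho x
      · have := hper (x, θ) hx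
        simp only at this
        rw [this]
      · rw [hψ0 ε hε _ (by simp only; linarith [half_pos hε]), zero_smul, zero_smul]
    rw [← h1]
    refine (setIntegral_eq_of_subset_of_forall_sdiff_eq_zero (MeasurableSet.univ.prod measurableSet_Ioc)
      (prod_mono (subset_univ _) le_rfl) fun p hp => ?_).symm
    have hpc : S.rho p.1 < 0 := not_le.1 fun h => hp.2 ⟨h, hp.1.2⟩
    have : (fun p => ψ ε p • w p) =ᶠ[𝓝 p] fun _ => 0 := by
      filter_upwards [(isOpen_lt (hrc.comp continuous_fst) continuous_const).mem_nhds hpc] with q hq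
      rw [hψ0 ε hε q (le_trans (le_of_lt hq) (half_pos hε).le), zero_smul]
    rw [this.fderiv_eq]; simp
  have htoti : ∀ ε > 0, Integrable (fun p => fderiv ℝ (fun p => ψ ε p • w p) p (Y p)) S.vol :=
    fun ε hε => by
      have hcd := ((htrunc ε hε).continuous_fderiv one_ne_zero).clm_apply hYc
      obtain ⟨M, hM⟩ := S.isCompact_strip.exists_bound_of_continuousOn hcd.continuousOn
      exact integrable_vol_of_bound hcd.continuousOn fun p hp _ => hM p hp
  have hψi : ∀ ε, Integrable (fun p => ψ ε p • w' p (Y p)) S.vol := fun ε =>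
    hint.norm.mono ((hψ ε).continuous.aestronglyMeasurable.smul hint.1) (Eventually.of_forall fun p => by
      rw [norm_smul, norm_norm]
      exact mul_le_of_le_one_left (norm_nonneg _) (hψn ε p))
  have hexp : ∀ ε, ∀ p ∈ S.innerSM, fderiv ℝ (fun p => ψ ε p • w p) p (Y p) =
      ψ ε p • w' p (Y p) + fderiv ℝ (ψ ε) p (Y p) • w p := fun ε p hp => by
    have := (((hψ ε).differentiable (by simp) p).hasFDerivAt.smul (hw p hp)).fderiv
    rw [show (fun p => ψ ε p • w p) = ψ ε • w from rfl, this]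
    simp
  have hlimψ : Tendsto (fun ε => ∫ p, ψ ε p • w' p (Y p) ∂S.vol) (𝓝[>] 0)
      (𝓝 (∫ p, w' p (Y p) ∂S.vol)) := by
    refine tendsto_integral_filter_of_dominated_convergence (fun p => ‖w' p (Y p)‖)
      (Eventually.of_forall fun ε => (hψi ε).1) (Eventually.of_forall fun ε =>
        Eventually.of_forall fun p => ?_) hint.norm ?_
    · rw [norm_smul]
      exact mul_le_of_le_one_left (norm_nonneg _) (hψn ε p)
    · filter_upwards [S.ae_mem_innerSM] with p hp
      refine tendsto_const_nhds.congr' ?_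
      filter_upwards [Ioc_mem_nhdsGT (show 0 < S.rho p.1 from hp)] with ε hε
      rw [hψ1 ε hε.1 p hε.2, one_smul]
  obtain ⟨C, ε₀, hC, hε₀, hcol⟩ := S.exists_vol_collar_le
  -- The error is the derivative of the cutoff times `w`, that is `O(1/ε)` times `δ` on a set of
  -- measure at most `C ε`. The powers of `ε` cancel and `δ` is arbitrary.
  have hbound : ∀ δ > 0, ∀ᶠ ε in 𝓝[>] 0, ‖∫ p, ψ ε p • w' p (Y p) ∂S.vol‖ ≤
      2 * |s₁| * |N| * C * δ := fun δ hδ => by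
    obtain ⟨ε₁, hε₁, hsm⟩ := exists_norm_le_collar hlim hδ
    filter_upwards [Ioc_mem_nhdsGT (lt_min hε₀ hε₁)] with ε hε
    have hε0 := hε.1
    have hmeas : MeasurableSet {p : PhasePoint | S.rho p.1 ≤ ε} :=
      (isClosed_le (hrc.comp continuous_fst) continuous_const).measurableSet
    have h1 : ∫ p, ψ ε p • w' p (Y p) ∂S.vol = ∫ p, (ψ ε p • w' p (Y p) -
        fderiv ℝ (fun p => ψ ε p • w p) p (Y p)) ∂S.vol := by
      rw [integral_sub (hψi ε) (htoti ε hε0), htot ε hε0, sub_zero]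
    rw [h1]
    calc _ ≤ ∫ p, {p : PhasePoint | S.rho p.1 ≤ ε}.indicator
          (fun _ => |s₁| * (2 / ε * |N|) * δ) p ∂S.vol := by
          refine norm_integral_le_of_norm_le ((integrable_const _).indicator hmeas) ?_
          filter_upwards [S.ae_mem_strip] with p hp
          rw [hexp ε p hp.1, sub_add_cancel_left, norm_neg, norm_smul]
          by_cases hpε : S.rho p.1 ≤ ε
          · rw [indicator_of_mem (show p ∈ {p : PhasePoint | S.rho p.1 ≤ ε} from hpε)]
            gcongr
            · exact hdψle ε hε0 p hp.2 hpε
            · exact hsm p hp.2 hp.1 (hpε.trans (hε.2.trans (min_le_right _ _)))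
          · rw [hdψ0 ε hε0 p (not_le.1 hpε), norm_zero, zero_mul]
            exact indicator_nonneg (fun _ _ => by positivity) _
      _ = S.vol.real {p | S.rho p.1 ≤ ε} * (|s₁| * (2 / ε * |N|) * δ) := by
          rw [integral_indicator hmeas, setIntegral_const, smul_eq_mul]
      _ ≤ C * ε * (|s₁| * (2 / ε * |N|) * δ) := by
          gcongr
          exact hcol ε ⟨hε0, hε.2.trans (min_le_left _ _)⟩
      _ = _ := by field_simp
  have hfin : ∀ δ > 0, ‖∫ p, w' p (Y p) ∂S.vol‖ ≤ 2 * |s₁| * |N| * C * δ := fun δ hδ =>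
    le_of_tendsto hlimψ.norm (hbound δ hδ)
  refine norm_le_zero_iff.1 (ge_of_tendsto (x := 𝓝[>] (0 : ℝ))
    (f := fun δ => 2 * |s₁| * |N| * C * δ) ?_ ?_)
  · have : Tendsto (fun δ => 2 * |s₁| * |N| * C * δ) (𝓝 0) (𝓝 (2 * |s₁| * |N| * C * 0)) :=
      (continuous_const.mul continuous_id).tendsto 0
    rw [mul_zero] at this
    exact this.mono_left nhdsWithin_le_nhds
  · filter_upwards [self_mem_nhdsWithin] with δ hδ using hfin δ hδ

/-- Since `X_⊥` is `X` rotated by `-π/2`, a single integration by parts for rotated fields serves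
both operators. -/
theorem transverseField_eq (p : PhasePoint) :
    S.transverseField p = S.geodesicField (p.1, p.2 + -(Real.pi / 2)) := by
  ext <;> simp [transverseField, geodesicField, Real.cos_add, Real.sin_add]
  ring

end IsothermalSurface

/-! ### Parity, periodicity and boundary behaviour -/

namespace IsothermalSurface

variable {S : IsothermalSurface}

theorem contDiffOn_of_mem_Omega {k : ℤ} {f : PhasePoint → ℂ} (hf : f ∈ S.Omega k) :
    ContDiffOn ℝ 1 f S.SM := hf.1.1.of_le (by simp)

theorem differentiableOn_of_mem_Omega {k : ℤ} {f : PhasePoint → ℂ} (hf : f ∈ S.Omega k) :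
    DifferentiableOn ℝ f S.SM := (contDiffOn_of_mem_Omega hf).differentiableOn one_ne_zero

theorem eq_exp_mul_of_mem_Omega {k : ℤ} {f : PhasePoint → ℂ} (hf : f ∈ S.Omega k) {x : ℝ × ℝ}
    (hx : x ∈ S.carrier) (θ : ℝ) : f (x, θ) = Complex.exp (Complex.I * k * θ) * f (x, 0) := by
  have hmem : ∀ θ : ℝ, (x, θ) ∈ S.SM := fun _ => hx
  have hd : ∀ θ : ℝ, HasDerivAt (fun θ => f (x, θ)) (Complex.I * k * f (x, θ)) θ := fun θ => by
    have h1 := (differentiableOn_of_mem_Omega hf (x, θ) (hmem θ)).hasFDerivWithinAt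
    have h2 : HasDerivAt (fun θ : ℝ => ((x, θ) : PhasePoint)) ((0 : ℝ × ℝ), (1 : ℝ)) θ :=
      (hasDerivAt_const _ _).prodMk (hasDerivAt_id _)
    have h3 := h1.comp_hasDerivWithinAt (s := univ) θ h2.hasDerivWithinAt fun θ _ => hmem θ
    rw [hasDerivWithinAt_univ] at h3
    exact h3.congr_deriv (hf.2 (x, θ) (hmem θ))
  have he : ∀ θ : ℝ, HasDerivAt (fun θ : ℝ => Complex.exp (-(Complex.I * k * θ)))
      (Complex.exp (-(Complex.I * k * θ)) * -(Complex.I * k)) θ := fun θ => by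
    have h1 : HasDerivAt (fun θ : ℝ => -(Complex.I * k * (θ : ℂ))) (-(Complex.I * k * 1)) θ :=
      ((Complex.ofRealCLM.hasDerivAt (x := θ)).const_mul (Complex.I * k)).neg
    simpa using h1.cexp
  have hc : ∀ θ, HasDerivAt (fun θ : ℝ => f (x, θ) * Complex.exp (-(Complex.I * k * θ))) 0 θ :=
    fun θ => by
      refine ((hd θ).mul (he θ)).congr_deriv ?_
      ring
  have h := is_const_of_deriv_eq_zero (fun θ => (hc θ).differentiableAt) (fun θ => (hc θ).deriv) θ 0
  simp only [Complex.ofReal_zero, mul_zero, neg_zero, Complex.exp_zero, mul_one] at h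
  rw [← h, mul_comm, mul_assoc, ← Complex.exp_add]
  simp

theorem exp_I_mul_int_mul_pi (k : ℤ) : Complex.exp (Complex.I * k * (Real.pi : ℝ)) = (-1) ^ k := by
  rw [show Complex.I * k * (Real.pi : ℝ) = k * (Real.pi * Complex.I) by ring, Complex.exp_int_mul,
    Complex.exp_pi_mul_I]

theorem flip_of_mem_Omega {k : ℤ} {f : PhasePoint → ℂ} (hf : f ∈ S.Omega k) {p : PhasePoint}
    (hp : p ∈ S.SM) : f (flip p) = (-1) ^ k * f p := by
  have h1 := eq_exp_mul_of_mem_Omega hf hp (p.2 + Real.pi)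
  have h2 := eq_exp_mul_of_mem_Omega hf hp p.2
  change f (p.1, p.2 + Real.pi) = (-1) ^ k * f (p.1, p.2)
  rw [h1, h2, Complex.ofReal_add, mul_add, Complex.exp_add, exp_I_mul_int_mul_pi]
  ring

/-- Rotations of the fibre preserve `SM`, and unique differentiability transfers the equivariance of
`h` to its derivative, boundary included. The shift `π` gives parity and `2π` gives periodicity. -/
theorem fderivWithin_rot {h : PhasePoint → ℂ} (hd : DifferentiableOn ℝ h S.SM) {a : ℂ} {c : ℝ}
    (hh : ∀ p ∈ S.SM, h (p.1, p.2 + c) = a * h p) {p : PhasePoint} (hp : p ∈ S.SM) :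
    fderivWithin ℝ h S.SM (p.1, p.2 + c) = a • fderivWithin ℝ h S.SM p := by
  have hs : HasFDerivAt (fun q : PhasePoint => ((q.1, q.2 + c) : PhasePoint))
      (ContinuousLinearMap.id ℝ PhasePoint) p := by
    have := (hasFDerivAt_fst (𝕜 := ℝ) (p := p)).prodMk
      ((hasFDerivAt_snd (𝕜 := ℝ) (p := p)).add_const c)
    simpa using! this
  have h1 := (hd (p.1, p.2 + c) hp).hasFDerivWithinAt.comp p hs.hasFDerivWithinAt
    (fun q (hq : q ∈ S.SM) => (show ((q.1, q.2 + c) : PhasePoint) ∈ S.SM from hq))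
  have h2 : HasFDerivWithinAt (fun q => a * h q) (a • fderivWithin ℝ h S.SM p) S.SM p :=
    (hd p hp).hasFDerivWithinAt.const_mul a
  have h3 := (S.uniqueDiffOn_SM p hp).eq (h1.congr (fun q hq => (hh q hq).symm) (hh p hp).symm) h2
  simpa using h3

/-- Reversing the vector changes the sign of `X_⊥`, so `X_⊥ h` has the parity opposite to that of
`h`. This is the sign that the symmetry of the transport operator needs. -/
theorem Xperp_flip {k : ℤ} {h : PhasePoint → ℂ} (hh : h ∈ S.Omega k) {p : PhasePoint}
    (hp : p ∈ S.SM) : S.Xperp h (flip p) = -((-1) ^ k * S.Xperp h p) := by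
  have := fderivWithin_rot (c := Real.pi) (differentiableOn_of_mem_Omega hh)
    (fun p hp => flip_of_mem_Omega hh hp) hp
  unfold Xperp
  rw [transverseField_flip, map_neg, flip, this]
  simp

theorem Xperp_add_period {h : PhasePoint → ℂ} (hd : DifferentiableOn ℝ h S.SM)
    (hper : ∀ p ∈ S.SM, h (p.1, p.2 + 2 * Real.pi) = h p) {p : PhasePoint} (hp : p ∈ S.SM) :
    S.Xperp h (p.1, p.2 + 2 * Real.pi) = S.Xperp h p := by
  have := fderivWithin_rot (a := 1) hd (fun p hp => by rw [hper p hp, one_mul]) hp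
  have ht : S.transverseField (p.1, p.2 + 2 * Real.pi) = S.transverseField p := by
    simp [transverseField]
  unfold Xperp
  rw [this, one_smul, ht]

theorem contDiffOn_Xperp {h : PhasePoint → ℂ} (hh : S.IsSmooth h) :
    ContDiffOn ℝ 1 (S.Xperp h) S.SM :=
  (hh.1.fderivWithin S.uniqueDiffOn_SM (m := 1) (by norm_cast)).clm_apply
    (S.contDiff_transverseField.of_le (by simp)).contDiffOn

theorem continuous_flip : Continuous flip := by unfold flip; fun_prop

theorem hasFDerivAt_flip (p : PhasePoint) :
    HasFDerivAt flip (ContinuousLinearMap.id ℝ PhasePoint) p := by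
  have := (hasFDerivAt_fst (𝕜 := ℝ) (p := p)).prodMk
    ((hasFDerivAt_snd (𝕜 := ℝ) (p := p)).add_const Real.pi)
  simpa using! this

/-- Used to see that a product of `u^f` with a reversed transport solution vanishes on the whole
boundary. -/
theorem outflow_or_flip {p : PhasePoint} (hp : p.1 ∈ S.bdry) : p ∈ S.outflow ∨ flip p ∈ S.outflow := by
  rcases le_total (S.rhoDot p) 0 with h | h
  · exact .inl ⟨hp, h⟩
  · refine .inr ⟨hp, ?_⟩
    change S.rhoDot (flip p) ≤ 0
    rw [rhoDot_flip]; linarith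

theorem Xperp_eq_of_hasFDerivAt {u : PhasePoint → ℂ} {p : PhasePoint} (hp : p ∈ S.innerSM)
    {L : PhasePoint →L[ℝ] ℂ} (h : HasFDerivAt u L p) : S.Xperp u p = L (S.transverseField p) := by
  unfold Xperp
  rw [fderivWithin_of_mem_nhds (SM_mem_nhds hp), h.fderiv]

theorem integral_vol_eq_iterated {F : PhasePoint → ℂ} (hF : Integrable F S.vol) :
    ∫ p, F p ∂S.vol = ∫ x in S.carrier, Real.exp (2 * S.lam x) •
      ∫ θ in (0 : ℝ)..(2 * Real.pi), F (x, θ) := by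
  have hm : Measurable fun p : PhasePoint => Real.toNNReal (Real.exp (2 * S.lam p.1)) := by
    have := S.lam_smooth.continuous
    exact (by fun_prop : Continuous fun p : PhasePoint => Real.exp (2 * S.lam p.1)).measurable.real_toNNReal
  have hi : IntegrableOn (fun p : PhasePoint => Real.exp (2 * S.lam p.1) • F p)
      (S.carrier ×ˢ Ioc 0 (2 * Real.pi)) := by
    have := (integrable_withDensity_iff_integrable_smul
      (μ := volume.restrict (S.carrier ×ˢ Ioc 0 (2 * Real.pi))) hm (g := F)).1 hF
    refine this.congr (Eventually.of_forall fun p => ?_)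
    simp only [NNReal.smul_def, Real.coe_toNNReal _ (Real.exp_pos _).le]
  rw [integral_vol]
  rw [Measure.volume_eq_prod] at hi ⊢
  rw [setIntegral_prod _ hi]
  refine integral_congr_ae (Eventually.of_forall fun x => ?_)
  simp only
  rw [intervalIntegral.integral_of_le (by positivity), integral_smul]

theorem integral_vol_flip {F : PhasePoint → ℂ} (hF : Integrable F S.vol)
    (hF' : Integrable (fun p => F (flip p)) S.vol)
    (hper : ∀ p ∈ S.SM, F (p.1, p.2 + 2 * Real.pi) = F p) :
    ∫ p, F (flip p) ∂S.vol = ∫ p, F p ∂S.vol := by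
  rw [integral_vol_eq_iterated hF, integral_vol_eq_iterated hF']
  refine setIntegral_congr_fun S.isClosed_carrier.measurableSet fun x hx => ?_
  simp only [flip]
  have hp : Function.Periodic (fun θ => F (x, θ)) (2 * Real.pi) := fun θ => hper (x, θ) hx
  have h1 := hp.intervalIntegral_add_eq 0 Real.pi
  rw [zero_add] at h1
  rw [intervalIntegral.integral_comp_add_right (fun θ => F (x, θ)), h1, zero_add, add_comm]

namespace FlowData

theorem transport_add_period (D : S.FlowData) {f : PhasePoint → ℂ}
    (hper : ∀ p ∈ S.SM, f (p.1, p.2 + 2 * Real.pi) = f p) {p : PhasePoint} (hp : p ∈ S.SM) :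
    S.transport f (p.1, p.2 + 2 * Real.pi) = S.transport f p := by
  have h1 := D.exitTime_add_period p 1
  have h2 := D.φ_add_period p 1
  simp only [Int.cast_one, one_mul] at h1 h2
  rw [D.transport_eq f (show ((p.1, p.2 + 2 * Real.pi) : PhasePoint) ∈ S.SM from hp),
    D.transport_eq f hp, h1]
  refine intervalIntegral.integral_congr fun t ht => ?_
  rw [uIcc_of_le (S.exitTime_nonneg p)] at ht
  rw [h2, hper _ (D.φ_mem hp ht)]

/-- The transport equation holds along orbits with one-sided derivatives; at time zero the full
derivative of `u^f` must give the same value. -/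
theorem dTransport_geodesicField (D : S.FlowData) (hnt : S.NonTrapping)
    (hconv : S.StrictlyConvexBoundary) {f : PhasePoint → ℂ} (hf : ContDiffOn ℝ 1 f S.SM)
    {p : PhasePoint} (hp : p ∈ S.innerSM) : D.dTransport f p (S.geodesicField p) = -f p := by
  have hpS := innerSM_subset hp
  have hτ : 0 < S.exitTime p := D.exitTime_pos hnt hpS (.inl hp)
  have h1 := (D.isTransportSolution hnt hconv hf.continuousOn).1 p _ _ (D.isGeodesicArc_exitTime hpS) 0
    ⟨le_rfl, hτ.le⟩
  have h2 := D.isFlow.hasDerivAt p 0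
  have h3 := D.hasFDerivAt_transport hnt hconv hf hp
  rw [D.φ_zero] at h1 h2
  have h4 : HasDerivAt (fun s => S.transport f (D.φ p s)) (D.dTransport f p (S.geodesicField p)) 0 := by
    have h3' : HasFDerivAt (S.transport f) (D.dTransport f p) (D.φ p 0) := by rwa [D.φ_zero]
    exact h3'.comp_hasDerivAt (0 : ℝ) h2
  exact (uniqueDiffOn_Icc hτ 0 ⟨le_rfl, hτ.le⟩).eq_deriv _ h4.hasDerivWithinAt h1

/-- The orbit of an outflow vector has `ρ < 0` at arbitrarily small times, because its exit time is
zero, and this persists for nearby vectors. -/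
theorem tendsto_exitTime_of_outflow (D : S.FlowData) (hnt : S.NonTrapping)
    (hconv : S.StrictlyConvexBoundary) {p : PhasePoint} (hp : p ∈ S.outflow) :
    Tendsto S.exitTime (𝓝[S.SM] p) (𝓝 0) := by
  have h0 : S.rho p.1 = 0 := hp.1
  have hpS : p ∈ S.SM := show 0 ≤ S.rho p.1 from h0.ge
  refine tendsto_order.2 ⟨fun a ha => Eventually.of_forall fun q =>
    ha.trans_le (S.exitTime_nonneg q), fun a ha => ?_⟩
  obtain ⟨t, ht, hneg⟩ : ∃ t ∈ Icc 0 (a / 2), S.rho (D.φ p t).1 < 0 := by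
    by_contra! h
    have := D.le_exitTime hnt hpS (T := a / 2) (by positivity) fun t ht => h t ht
    rw [D.exitTime_eq_zero_of_outflow hconv hp] at this
    linarith
  have hc : Continuous fun q => S.rho (D.φ q t).1 :=
    S.rho_smooth.continuous.comp (continuous_fst.comp
      (D.continuous_φ.comp (f := fun q => (q, t)) (by fun_prop)))
  have hev : ∀ᶠ q in 𝓝[S.SM] p, S.rho (D.φ q t).1 < 0 :=
    nhdsWithin_le_nhds ((isOpen_lt hc continuous_const).mem_nhds hneg)
  filter_upwards [hev, self_mem_nhdsWithin] with q hq hqS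
  exact (D.exitTime_le_of_rho_neg hqS ht.1 hq).trans_lt (by linarith [ht.2])

theorem tendsto_transport_of_outflow (D : S.FlowData) (hnt : S.NonTrapping)
    (hconv : S.StrictlyConvexBoundary) {f : PhasePoint → ℂ} (hf : ContinuousOn f S.SM)
    {p : PhasePoint} (hp : p ∈ S.outflow) : Tendsto (S.transport f) (𝓝[S.SM] p) (𝓝 0) := by
  obtain ⟨M, -, hM⟩ := D.exists_norm_transport_le_mul_exitTime hnt hf (isCompact_closedBall p 1)
  refine squeeze_zero_norm' (a := fun q => M * S.exitTime q) ?_ ?_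
  · filter_upwards [self_mem_nhdsWithin, mem_nhdsWithin_of_mem_nhds (Metric.closedBall_mem_nhds p one_pos)]
      with q hq hq1 using hM q hq1 hq
  · simpa using (D.tendsto_exitTime_of_outflow hnt hconv hp).const_mul M

theorem exists_eventually_norm_transport_le (D : S.FlowData) (hnt : S.NonTrapping) {f : PhasePoint → ℂ}
    (hf : ContinuousOn f S.SM) (p : PhasePoint) :
    ∃ M, ∀ᶠ q in 𝓝[S.SM] p, ‖S.transport f q‖ ≤ M := by
  obtain ⟨M, hM⟩ := D.exists_norm_transport_le hnt hf (isCompact_closedBall p 1)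
  refine ⟨M, ?_⟩
  filter_upwards [self_mem_nhdsWithin, mem_nhdsWithin_of_mem_nhds (Metric.closedBall_mem_nhds p one_pos)]
    with q hq hq1 using hM q hq1 hq

end FlowData

end IsothermalSurface

/-! ### Square integrability and the two pairing identities -/

namespace IsothermalSurface

variable {S : IsothermalSurface}

theorem exists_norm_le_strip {F : Type*} [NormedAddCommGroup F] {g : PhasePoint → F}
    (hg : ContinuousOn g S.SM) :
    ∃ M, ∀ p ∈ S.carrier ×ˢ Icc 0 (2 * Real.pi), ‖g p‖ ≤ M :=
  S.isCompact_strip.exists_bound_of_continuousOn (hg.mono fun _ hp => hp.1)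

theorem continuousOn_Xperp {h : PhasePoint → ℂ} (hh : ContDiffOn ℝ 1 h S.SM) :
    ContinuousOn (S.Xperp h) S.SM :=
  (hh.continuousOn_fderivWithin S.uniqueDiffOn_SM le_rfl).clm_apply
    S.contDiff_transverseField.continuous.continuousOn

theorem hasFDerivAt_of_contDiffOn {h : PhasePoint → ℂ} (hh : ContDiffOn ℝ 1 h S.SM)
    {p : PhasePoint} (hp : p ∈ S.innerSM) : HasFDerivAt h (fderivWithin ℝ h S.SM p) p :=
  ((hh.differentiableOn one_ne_zero) p (innerSM_subset hp)).hasFDerivWithinAt.hasFDerivAt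
    (SM_mem_nhds hp)

theorem HasFDerivAt.star_complex {h : PhasePoint → ℂ} {L : PhasePoint →L[ℝ] ℂ} {p : PhasePoint}
    (hh : HasFDerivAt h L p) :
    HasFDerivAt (fun p => starRingEnd ℂ (h p)) ((Complex.conjCLE : ℂ →L[ℝ] ℂ) ∘L L) p :=
  (Complex.conjCLE : ℂ →L[ℝ] ℂ).hasFDerivAt.comp p hh

namespace FlowData

/-- The pointwise bound on the derivative of `u^f` by the weight `1/(ρ + (Xρ)²)` is used with the
integrability of that weight. -/
theorem memLp_Xperp_transport (D : S.FlowData) (hnt : S.NonTrapping)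
    (hconv : S.StrictlyConvexBoundary) {f : PhasePoint → ℂ} (hf : ContDiffOn ℝ 1 f S.SM) :
    MemLp (S.Xperp (S.transport f)) 2 S.vol := by
  have hYc := S.contDiff_transverseField.continuous
  have hc : ContinuousOn (fun p => D.dTransport f p (S.transverseField p)) S.innerSM :=
    (D.continuousOn_dTransport hnt hconv hf).clm_apply hYc.continuousOn
  have hae : (fun p => D.dTransport f p (S.transverseField p)) =ᵐ[S.vol]
      S.Xperp (S.transport f) := by
    filter_upwards [S.ae_mem_innerSM] with p hp
    exact (Xperp_eq_of_hasFDerivAt hp (D.hasFDerivAt_transport hnt hconv hf hp)).symm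
  refine MemLp.ae_eq hae ?_
  obtain ⟨M, hM⟩ := D.exists_sq_norm_dTransport_le hnt hconv hf S.isCompact_strip
  obtain ⟨N, hN⟩ := exists_norm_le_strip (S := S) hYc.continuousOn
  rw [memLp_two_iff_integrable_sq_norm (aestronglyMeasurable_vol hc)]
  refine ⟨(aestronglyMeasurable_vol (hc.norm.pow 2)), ?_⟩
  refine hasFiniteIntegral_iff_norm _ |>.2 (lt_of_le_of_lt (b := ENNReal.ofReal (|M| * |N| ^ 2) *
    ∫⁻ p, ENNReal.ofReal ((S.rho p.1 + S.rhoDot p ^ 2)⁻¹) ∂S.vol) ?_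
    (ENNReal.mul_lt_top ENNReal.ofReal_lt_top S.lintegral_inv_rho_add_sq_rhoDot_lt_top))
  rw [← lintegral_const_mul' _ _ ENNReal.ofReal_ne_top]
  refine lintegral_mono_ae ?_
  filter_upwards [S.ae_mem_strip] with p hp
  rw [← ENNReal.ofReal_mul (by positivity)]
  refine ENNReal.ofReal_le_ofReal ?_
  have h0 : 0 < S.rho p.1 := hp.1
  have hr : 0 < S.rho p.1 + S.rhoDot p ^ 2 := by positivity
  have h1 : ‖D.dTransport f p‖ ^ 2 ≤ |M| * (S.rho p.1 + S.rhoDot p ^ 2)⁻¹ := by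
    rw [← div_eq_mul_inv, le_div_iff₀ hr]
    exact (hM p hp.2 hp.1).trans (le_abs_self _)
  rw [norm_pow, norm_norm]
  calc _ ≤ (‖D.dTransport f p‖ * ‖S.transverseField p‖) ^ 2 := by
        gcongr; exact ContinuousLinearMap.le_opNorm _ _
    _ = ‖D.dTransport f p‖ ^ 2 * ‖S.transverseField p‖ ^ 2 := mul_pow _ _ _
    _ ≤ (|M| * (S.rho p.1 + S.rhoDot p ^ 2)⁻¹) * |N| ^ 2 := by
        gcongr
        exact (hN p hp.2).trans (le_abs_self _)
    _ = _ := by ring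

theorem exists_norm_transport_le_strip (D : S.FlowData) (hnt : S.NonTrapping) {f : PhasePoint → ℂ}
    (hf : ContinuousOn f S.SM) : ∃ M, ∀ p ∈ S.carrier ×ˢ Icc 0 (2 * Real.pi), p ∈ S.innerSM →
      ‖S.transport f p‖ ≤ M := by
  obtain ⟨M, hM⟩ := D.exists_norm_transport_le hnt hf S.isCompact_strip
  exact ⟨M, fun p hp _ => hM p hp hp.1⟩

theorem memLp_transport (D : S.FlowData) (hnt : S.NonTrapping)
    (hconv : S.StrictlyConvexBoundary) {f : PhasePoint → ℂ} (hf : ContinuousOn f S.SM) :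
    MemLp (S.transport f) 2 S.vol := by
  obtain ⟨M, hM⟩ := D.exists_norm_transport_le_strip hnt hf
  refine MemLp.of_bound (aestronglyMeasurable_vol (D.continuousOn_transport hnt hconv hf)) M ?_
  filter_upwards [S.ae_mem_strip] with p hp using hM p hp.2 hp.1

end FlowData

theorem memLp_of_continuousOn {f : PhasePoint → ℂ} (hf : ContinuousOn f S.SM) :
    MemLp f 2 S.vol := by
  obtain ⟨M, hM⟩ := exists_norm_le_strip (S := S) hf
  refine MemLp.of_bound (aestronglyMeasurable_vol (hf.mono innerSM_subset)) M ?_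
  filter_upwards [S.ae_mem_strip] with p hp using hM p hp.2

theorem MemLp.integrable_mul_star {u v : PhasePoint → ℂ} {μ : Measure PhasePoint} (hu : MemLp u 2 μ)
    (hv : MemLp v 2 μ) : Integrable (fun p => u p * starRingEnd ℂ (v p)) μ :=
  hu.integrable_mul (q := 2) hv.star

namespace FlowData

/-- Integrate `X_⊥(u^f h̄)`. At the boundary `h` tends to zero while `u^f` stays bounded, so no
boundary term appears. -/
theorem pairing_Xperp_transport (D : S.FlowData) (hnt : S.NonTrapping)
    (hconv : S.StrictlyConvexBoundary) {f h : PhasePoint → ℂ} (hf : ContDiffOn ℝ 1 f S.SM)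
    (hfper : ∀ p ∈ S.SM, f (p.1, p.2 + 2 * Real.pi) = f p) (hh : ContDiffOn ℝ 1 h S.SM)
    (hhper : ∀ p ∈ S.SM, h (p.1, p.2 + 2 * Real.pi) = h p)
    (h0 : ∀ p : PhasePoint, p.1 ∈ S.bdry → h p = 0) :
    S.pairing (S.Xperp (S.transport f)) h = -S.pairing (S.transport f) (S.Xperp h) := by
  have hi₁ := MemLp.integrable_mul_star (D.memLp_Xperp_transport hnt hconv hf)
    (memLp_of_continuousOn hh.continuousOn)
  have hi₂ := MemLp.integrable_mul_star (D.memLp_transport hnt hconv hf.continuousOn)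
    (memLp_of_continuousOn (continuousOn_Xperp hh))
  let w' : PhasePoint → PhasePoint →L[ℝ] ℂ := fun p =>
    S.transport f p • ((Complex.conjCLE : ℂ →L[ℝ] ℂ) ∘L fderivWithin ℝ h S.SM p) +
      starRingEnd ℂ (h p) • D.dTransport f p
  have hval : ∀ p ∈ S.innerSM, w' p (S.geodesicField (p.1, p.2 + -(Real.pi / 2))) =
      S.Xperp (S.transport f) p * starRingEnd ℂ (h p) +
        S.transport f p * starRingEnd ℂ (S.Xperp h p) := fun p hp => by
    rw [← transverseField_eq, Xperp_eq_of_hasFDerivAt hp (D.hasFDerivAt_transport hnt hconv hf hp)]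
    simp [w', Xperp]
    ring
  have hval' : (fun p => S.Xperp (S.transport f) p * starRingEnd ℂ (h p) +
      S.transport f p * starRingEnd ℂ (S.Xperp h p)) =ᵐ[S.vol]
        fun p => w' p (S.geodesicField (p.1, p.2 + -(Real.pi / 2))) := by
    filter_upwards [S.ae_mem_innerSM] with p hp using (hval p hp).symm
  have hi : Integrable (fun p => S.Xperp (S.transport f) p * starRingEnd ℂ (h p) +
      S.transport f p * starRingEnd ℂ (S.Xperp h p)) S.vol := hi₁.add hi₂
  have key := S.integral_vol_rot_eq_zero (-(Real.pi / 2))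
    (w := fun p => S.transport f p * starRingEnd ℂ (h p)) (w' := w')
    (fun p hp => (D.hasFDerivAt_transport hnt hconv hf hp).mul
      (HasFDerivAt.star_complex (hasFDerivAt_of_contDiffOn hh hp))) ?_ ?_
    (hi.congr hval') ?_
  · rw [← integral_congr_ae hval', integral_add hi₁ hi₂] at key
    exact eq_neg_of_add_eq_zero_left key
  · refine ContinuousOn.add ?_ ?_
    · exact ((D.continuousOn_transport hnt hconv hf.continuousOn).smul
        (continuousOn_const.clm_comp ((hh.continuousOn_fderivWithin S.uniqueDiffOn_SM le_rfl).mono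
          innerSM_subset)))
    · exact (Complex.continuous_conj.comp_continuousOn (hh.continuousOn.mono innerSM_subset)).smul
        (D.continuousOn_dTransport hnt hconv hf)
  · intro p hp
    rw [D.transport_add_period hfper (innerSM_subset hp), hhper p (innerSM_subset hp)]
  · intro p hp
    have hpS : p ∈ S.SM := show 0 ≤ S.rho p.1 from (show S.rho p.1 = 0 from hp).ge
    obtain ⟨M, hM⟩ := D.exists_eventually_norm_transport_le hnt hf.continuousOn p
    have h1 : Tendsto h (𝓝[S.SM] p) (𝓝 0) := by
      have := hh.continuousOn p hpS
      rwa [ContinuousWithinAt, h0 p hp] at this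
    refine Tendsto.mono_left ?_ (nhdsWithin_mono p innerSM_subset)
    refine squeeze_zero_norm' (a := fun q => M * ‖h q‖) ?_ (by simpa using h1.norm.const_mul M)
    filter_upwards [hM] with q hq
    rw [norm_mul, RCLike.norm_conj]
    gcongr

/-- Santaló's symmetry of the transport operator. -/
theorem pairing_transport (D : S.FlowData) (hnt : S.NonTrapping)
    (hconv : S.StrictlyConvexBoundary) {f g : PhasePoint → ℂ} (hf : ContDiffOn ℝ 1 f S.SM)
    (hfper : ∀ p ∈ S.SM, f (p.1, p.2 + 2 * Real.pi) = f p) (hg : ContDiffOn ℝ 1 g S.SM)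
    (hgper : ∀ p ∈ S.SM, g (p.1, p.2 + 2 * Real.pi) = g p) {a : ℂ} (ha : a * a = 1)
    (hff : ∀ p ∈ S.SM, f (flip p) = a * f p)
    (hgf : ∀ p ∈ S.SM, starRingEnd ℂ (g (flip p)) = -(a * starRingEnd ℂ (g p))) :
    S.pairing f (S.transport g) = -S.pairing (S.transport f) g := by
  have hflip : ∀ {p}, p ∈ S.innerSM → flip p ∈ S.innerSM := fun hp => hp
  have hcf := hf.continuousOn.mono innerSM_subset
  have hct := D.continuousOn_transport hnt hconv hf.continuousOn
  have hcg := D.continuousOn_transport hnt hconv hg.continuousOn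
  have hcgf : ContinuousOn (fun p => S.transport g (flip p)) S.innerSM :=
    hcg.comp continuous_flip.continuousOn fun p hp => hp
  have hper : ∀ p ∈ S.SM, S.transport g (p.1, p.2 + 2 * Real.pi) = S.transport g p := fun p hp =>
    D.transport_add_period hgper hp
  have hm₁ := memLp_of_continuousOn (S := S) hf.continuousOn
  have hm₂ := D.memLp_transport hnt hconv hg.continuousOn
  have hm₃ := D.memLp_transport hnt hconv hf.continuousOn
  have hm₄ := memLp_of_continuousOn (S := S) hg.continuousOn
  have hm₅ : MemLp (fun p => S.transport g (flip p)) 2 S.vol := by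
    obtain ⟨M, hM⟩ := D.exists_norm_transport_le hnt hg.continuousOn
      (S.isCompact_strip.image continuous_flip)
    refine MemLp.of_bound (aestronglyMeasurable_vol hcgf) M ?_
    filter_upwards [S.ae_mem_strip] with p hp using hM _ (mem_image_of_mem _ hp.2) hp.2.1
  have hi₁ := MemLp.integrable_mul_star hm₁ hm₂
  have hi₂ := MemLp.integrable_mul_star hm₃ hm₄
  have hi₃ := MemLp.integrable_mul_star hm₁ hm₅
  -- The derivative of `u^f · conj(u^g ∘ flip)`. The reversed factor is used because `u^f conj(u^g)`
  -- need not vanish at inflow vectors, whereas `u^g ∘ flip` does.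
  let w' : PhasePoint → PhasePoint →L[ℝ] ℂ := fun p =>
    S.transport f p • ((Complex.conjCLE : ℂ →L[ℝ] ℂ) ∘L D.dTransport g (flip p)) +
      starRingEnd ℂ (S.transport g (flip p)) • D.dTransport f p
  have hval : ∀ p ∈ S.innerSM, w' p (S.geodesicField (p.1, p.2 + 0)) =
      -a * (S.transport f p * starRingEnd ℂ (g p)) +
        -(f p * starRingEnd ℂ (S.transport g (flip p))) := fun p hp => by
    have h1 := D.dTransport_geodesicField hnt hconv hf hp
    have h2 := D.dTransport_geodesicField hnt hconv hg (hflip hp)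
    rw [geodesicField_flip, map_neg, neg_inj] at h2
    have h3 := hgf p (innerSM_subset hp)
    simp only [add_zero, Prod.mk.eta, w']
    change S.transport f p * starRingEnd ℂ (D.dTransport g (flip p) (S.geodesicField p)) +
      starRingEnd ℂ (S.transport g (flip p)) * D.dTransport f p (S.geodesicField p) = _
    rw [h1, h2, h3]
    ring
  have hval' : (fun p => -a * (S.transport f p * starRingEnd ℂ (g p)) +
        -(f p * starRingEnd ℂ (S.transport g (flip p)))) =ᵐ[S.vol]
        fun p => w' p (S.geodesicField (p.1, p.2 + 0)) := by
    filter_upwards [S.ae_mem_innerSM] with p hp using (hval p hp).symm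
  have hi : Integrable (fun p => -a * (S.transport f p * starRingEnd ℂ (g p)) +
        -(f p * starRingEnd ℂ (S.transport g (flip p)))) S.vol := (hi₂.const_mul (-a)).add hi₃.neg
  have key := S.integral_vol_rot_eq_zero 0
    (w := fun p => S.transport f p * starRingEnd ℂ (S.transport g (flip p))) (w' := w')
    (fun p hp => (D.hasFDerivAt_transport hnt hconv hf hp).mul
      (HasFDerivAt.star_complex ?_)) ?_ ?_
    (hi.congr hval') ?_
  · have hi₃n : Integrable (fun p => -(f p * starRingEnd ℂ (S.transport g (flip p)))) S.vol := hi₃.neg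
    rw [← integral_congr_ae hval', integral_add (hi₂.const_mul (-a)) hi₃n, integral_const_mul] at key
    -- The parity of `f` costs a factor `a`, after which the whole integrand is composed with
    -- `flip`, a rotation of the fibres that preserves the integral.
    have hrev : ∫ p, f p * starRingEnd ℂ (S.transport g (flip p)) ∂S.vol =
        a * ∫ p, f p * starRingEnd ℂ (S.transport g p) ∂S.vol := by
      have hae : ∀ p ∈ S.SM, f p * starRingEnd ℂ (S.transport g (flip p)) =
          a * (f (flip p) * starRingEnd ℂ (S.transport g (flip p))) := fun p hp => by
        rw [hff p hp, ← mul_assoc, ← mul_assoc, ha, one_mul]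
      have hae' : (fun p => f p * starRingEnd ℂ (S.transport g (flip p))) =ᵐ[S.vol] fun p =>
          a * (f (flip p) * starRingEnd ℂ (S.transport g (flip p))) := by
        filter_upwards [S.ae_mem_innerSM] with p hp using hae p (innerSM_subset hp)
      have ha0 : a ≠ 0 := fun h => by simp [h] at ha
      have hi₄ : Integrable (fun p => f (flip p) * starRingEnd ℂ (S.transport g (flip p))) S.vol := by
        have := (hi₃.congr hae').const_mul a
        refine this.congr (Eventually.of_forall fun p => ?_)
        simp only
        rw [← mul_assoc, ha, one_mul]
      rw [integral_congr_ae hae', integral_const_mul]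
      congr 1
      refine integral_vol_flip (F := fun p => f p * starRingEnd ℂ (S.transport g p)) hi₁ hi₄
        fun p hp => ?_
      rw [hfper p hp, hper p hp]
    simp only [pairing]
    rw [integral_neg, hrev] at key
    linear_combination (-a) * key -
      ((∫ p, S.transport f p * starRingEnd ℂ (g p) ∂S.vol) +
        ∫ p, f p * starRingEnd ℂ (S.transport g p) ∂S.vol) * ha
  · have := (D.hasFDerivAt_transport hnt hconv hg (hflip hp)).comp p (hasFDerivAt_flip p)
    simpa using! this
  · refine ContinuousOn.add ?_ ?_
    · exact hct.smul (continuousOn_const.clm_comp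
        ((D.continuousOn_dTransport hnt hconv hg).comp continuous_flip.continuousOn fun p hp => hp))
    · exact (Complex.continuous_conj.comp_continuousOn hcgf).smul
        (D.continuousOn_dTransport hnt hconv hf)
  · intro p hp
    have hpS := innerSM_subset hp
    have h1 : flip (p.1, p.2 + 2 * Real.pi) = ((flip p).1, (flip p).2 + 2 * Real.pi) := by
      simp [flip]; ring
    rw [h1, D.transport_add_period hfper hpS, hper (flip p) hpS]
  · intro p hp
    refine Tendsto.mono_left ?_ (nhdsWithin_mono p innerSM_subset)
    have hfl : Tendsto flip (𝓝[S.SM] p) (𝓝[S.SM] (flip p)) :=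
      continuous_flip.continuousWithinAt.tendsto_nhdsWithin fun q hq => hq
    -- Whichever of the vector and its reverse is in the outflow boundary, the corresponding factor
    -- tends to zero and the other one stays bounded.
    rcases outflow_or_flip hp with hout | hout
    · obtain ⟨M, hM⟩ := D.exists_eventually_norm_transport_le hnt hg.continuousOn (flip p)
      have h1 := D.tendsto_transport_of_outflow hnt hconv hf.continuousOn hout
      refine squeeze_zero_norm' (a := fun q => ‖S.transport f q‖ * M) ?_
        (by simpa using h1.norm.mul_const M)
      filter_upwards [hfl.eventually hM] with q hq
      rw [norm_mul, RCLike.norm_conj]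
      gcongr
    · obtain ⟨M, hM⟩ := D.exists_eventually_norm_transport_le hnt hf.continuousOn p
      have h1 := (D.tendsto_transport_of_outflow hnt hconv hg.continuousOn hout).comp hfl
      refine squeeze_zero_norm' (a := fun q => M * ‖S.transport g (flip q)‖) ?_
        (by simpa using! h1.norm.const_mul M)
      filter_upwards [hM] with q hq
      rw [norm_mul, RCLike.norm_conj]
      gcongr

end FlowData

end IsothermalSurface

/-! ### Fourier components and the spaces `H_k` -/

namespace IsothermalSurface

variable {S : IsothermalSurface}

/-- The coefficient of `e^{ikθ}` in the Fourier expansion of `u`. -/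
noncomputable def fourierCoef (k : ℤ) (u : PhasePoint → ℂ) (x : ℝ × ℝ) : ℂ :=
  (1 / (2 * (Real.pi : ℂ))) *
    ∫ θ in (0 : ℝ)..(2 * Real.pi), u (x, θ) * Complex.exp (-(Complex.I * k * θ))

theorem fourierComp_eq (k : ℤ) (u : PhasePoint → ℂ) (p : PhasePoint) :
    fourierComp k u p = Complex.exp (Complex.I * k * p.2) * fourierCoef k u p.1 := rfl

theorem norm_exp_I_mul (k : ℤ) (θ : ℝ) : ‖Complex.exp (Complex.I * k * θ)‖ = 1 := by
  rw [show Complex.I * k * θ = ((k * θ : ℝ) : ℂ) * Complex.I by push_cast; ring,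
    Complex.norm_exp_ofReal_mul_I]

theorem star_exp_I_mul (k : ℤ) (θ : ℝ) : starRingEnd ℂ (Complex.exp (Complex.I * k * θ)) =
    Complex.exp (-(Complex.I * k * θ)) := by
  rw [← Complex.exp_conj]
  simp

theorem continuousOn_fourierCoef {u : PhasePoint → ℂ} (hu : ContinuousOn u S.innerSM) (k : ℤ) :
    ContinuousOn (fourierCoef k u) S.inner := by
  refine continuousOn_const.mul (continuousOn_intervalIntegral_of_continuousOn S.isOpen_inner
    (by positivity) ?_)
  refine ContinuousOn.mul (hu.mono fun q hq => hq.1) ?_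
  fun_prop

theorem continuousOn_fourierComp {u : PhasePoint → ℂ} (hu : ContinuousOn u S.innerSM) (k : ℤ) :
    ContinuousOn (fourierComp k u) S.innerSM := by
  refine ContinuousOn.mul (by fun_prop) ((continuousOn_fourierCoef hu k).comp continuousOn_fst
    fun p hp => hp)

/-- The coefficient is at most the mean `m` of `|u|` over the circle, and `∫ (|u| - m)² ≥ 0` is the
Cauchy–Schwarz inequality for that mean. -/
theorem sq_norm_fourierCoef_le {k : ℤ} {u : PhasePoint → ℂ} {x : ℝ × ℝ}
    (hu : Continuous fun θ : ℝ => u (x, θ)) :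
    2 * Real.pi * ‖fourierCoef k u x‖ ^ 2 ≤ ∫ θ in (0 : ℝ)..(2 * Real.pi), ‖u (x, θ)‖ ^ 2 := by
  have hπ := Real.two_pi_pos
  set n : ℝ → ℝ := fun θ => ‖u (x, θ)‖ with hn
  have hnc : Continuous n := hu.norm
  set m := (2 * Real.pi)⁻¹ * ∫ θ in (0 : ℝ)..(2 * Real.pi), n θ with hm
  have hle : ‖fourierCoef k u x‖ ≤ m := by
    rw [fourierCoef, norm_mul]
    have h1 : ‖(1 : ℂ) / (2 * (Real.pi : ℂ))‖ = (2 * Real.pi)⁻¹ := by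
      simp [abs_of_pos Real.pi_pos]
    rw [h1, hm]
    gcongr
    refine (intervalIntegral.norm_integral_le_integral_norm hπ.le).trans (le_of_eq ?_)
    refine intervalIntegral.integral_congr fun θ _ => ?_
    simp only [norm_mul, ← star_exp_I_mul, RCLike.norm_conj, norm_exp_I_mul, mul_one, hn]
  have hm0 : (∫ θ in (0 : ℝ)..(2 * Real.pi), n θ) = 2 * Real.pi * m := by
    rw [hm]; field_simp
  have hsq : 0 ≤ ∫ θ in (0 : ℝ)..(2 * Real.pi), (n θ - m) ^ 2 :=
    intervalIntegral.integral_nonneg hπ.le fun θ _ => sq_nonneg _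
  have hexp : ∫ θ in (0 : ℝ)..(2 * Real.pi), (n θ - m) ^ 2 =
      (∫ θ in (0 : ℝ)..(2 * Real.pi), n θ ^ 2) - 2 * Real.pi * m ^ 2 := by
    have h1 : ∀ θ, (n θ - m) ^ 2 = n θ ^ 2 - (2 * m * n θ - m ^ 2) := fun θ => by ring
    simp_rw [h1]
    have hc1 : Continuous fun θ => n θ ^ 2 := by fun_prop
    have hc2 : Continuous fun θ => 2 * m * n θ - m ^ 2 := by fun_prop
    have hc3 : Continuous fun θ => 2 * m * n θ := by fun_prop
    rw [intervalIntegral.integral_sub (hc1.intervalIntegrable _ _) (hc2.intervalIntegrable _ _),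
      intervalIntegral.integral_sub (hc3.intervalIntegrable _ _) (by simp),
      intervalIntegral.integral_const_mul, hm0, intervalIntegral.integral_const, smul_eq_mul]
    ring
  have : ‖fourierCoef k u x‖ ^ 2 ≤ m ^ 2 := by gcongr
  have h3 : 2 * Real.pi * ‖fourierCoef k u x‖ ^ 2 ≤ 2 * Real.pi * m ^ 2 := by gcongr
  linarith

theorem memLp_fourierComp {u : PhasePoint → ℂ} (hu : ContinuousOn u S.innerSM)
    (hL : MemLp u 2 S.vol) (k : ℤ) : MemLp (fourierComp k u) 2 S.vol := by
  have hc := continuousOn_fourierComp hu k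
  have hms : MeasurableSet S.innerSM := isOpen_innerSM.measurableSet
  -- Continuity is known over the interior only, so Tonelli is applied to the extension by zero,
  -- which agrees almost everywhere.
  have hmeas : ∀ {g : PhasePoint → ℂ}, ContinuousOn g S.innerSM →
      Measurable (S.innerSM.indicator fun p => ENNReal.ofReal (‖g p‖ ^ 2)) := fun {g} hg => by
    classical
    have : ContinuousOn (fun p => ENNReal.ofReal (‖g p‖ ^ 2)) S.innerSM :=
      ENNReal.continuous_ofReal.comp_continuousOn (hg.norm.pow 2)
    rw [← Set.piecewise_eq_indicator]
    exact this.measurable_piecewise continuousOn_const hms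
  have hlin : ∀ {g : PhasePoint → ℂ}, ContinuousOn g S.innerSM →
      ∫⁻ p, ENNReal.ofReal ‖(‖g p‖ ^ 2)‖ ∂S.vol = ∫⁻ x in S.carrier, ∫⁻ θ in Ioc 0 (2 * Real.pi),
        ENNReal.ofReal (Real.exp (2 * S.lam x)) *
          S.innerSM.indicator (fun p => ENNReal.ofReal (‖g p‖ ^ 2)) (x, θ) := fun {g} hg => by
    rw [← S.lintegral_vol (hmeas hg)]
    refine lintegral_congr_ae ?_
    filter_upwards [S.ae_mem_innerSM] with p hp
    rw [indicator_of_mem hp, norm_pow, norm_norm]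
  rw [memLp_two_iff_integrable_sq_norm (aestronglyMeasurable_vol hc)]
  rw [memLp_two_iff_integrable_sq_norm (aestronglyMeasurable_vol hu)] at hL
  refine ⟨aestronglyMeasurable_vol (hc.norm.pow 2), ?_⟩
  have hfin := hasFiniteIntegral_iff_norm _ |>.1 hL.2
  refine hasFiniteIntegral_iff_norm _ |>.2 (lt_of_le_of_lt ?_ hfin)
  rw [hlin hc, hlin hu]
  refine lintegral_mono_ae ?_
  filter_upwards [S.ae_mem_inner] with x hx
  have hmem : ∀ θ : ℝ, (x, θ) ∈ S.innerSM := fun _ => hx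
  simp only [indicator_of_mem (hmem _)]
  rw [lintegral_const_mul' _ _ ENNReal.ofReal_ne_top, lintegral_const_mul' _ _ ENNReal.ofReal_ne_top]
  gcongr 1
  have hux : Continuous fun θ : ℝ => u (x, θ) :=
    continuousOn_univ.1 (hu.comp (f := fun θ : ℝ => (x, θ)) (by fun_prop) fun θ _ => hmem θ)
  have hsqi : IntegrableOn (fun θ : ℝ => ‖u (x, θ)‖ ^ 2) (Ioc 0 (2 * Real.pi)) :=
    (hux.norm.pow 2).integrableOn_Icc.mono_set Ioc_subset_Icc_self
  simp only [fourierComp_eq, norm_mul, norm_exp_I_mul, one_mul]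
  rw [setLIntegral_const, Real.volume_Ioc, sub_zero, ← ENNReal.ofReal_mul (by positivity), mul_comm,
    ← ofReal_integral_eq_lintegral_ofReal hsqi (Eventually.of_forall fun θ => by positivity)]
  refine ENNReal.ofReal_le_ofReal ?_
  have := sq_norm_fourierCoef_le (k := k) hux
  rwa [intervalIntegral.integral_of_le (by positivity)] at this

theorem pairing_star (u v : PhasePoint → ℂ) : starRingEnd ℂ (S.pairing u v) = S.pairing v u := by
  unfold pairing
  rw [← integral_conj]
  refine integral_congr_ae (Eventually.of_forall fun p => ?_)
  simp [mul_comm]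

/-- On each circle `h` is a multiple of `e^{ikθ}`, so the integral over the angle sees only the
`k`-th coefficient of `u`. -/
theorem pairing_fourierComp {u h : PhasePoint → ℂ} (hu : ContinuousOn u S.innerSM)
    (hL : MemLp u 2 S.vol) (hh : MemLp h 2 S.vol) {k : ℤ}
    (hk : ∀ x ∈ S.carrier, ∀ θ : ℝ, h (x, θ) = Complex.exp (Complex.I * k * θ) * h (x, 0)) :
    S.pairing (fourierComp k u) h = S.pairing u h := by
  unfold pairing
  rw [integral_vol_eq_iterated (MemLp.integrable_mul_star (memLp_fourierComp hu hL k) hh),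
    integral_vol_eq_iterated (MemLp.integrable_mul_star hL hh)]
  refine setIntegral_congr_fun S.isClosed_carrier.measurableSet fun x hx => ?_
  congr 1
  have h1 : ∀ θ : ℝ, fourierComp k u (x, θ) * starRingEnd ℂ (h (x, θ)) =
      fourierCoef k u x * starRingEnd ℂ (h (x, 0)) := fun θ => by
    rw [hk x hx θ, map_mul, star_exp_I_mul, fourierComp_eq, Complex.exp_neg]
    have := Complex.exp_ne_zero (Complex.I * k * θ)
    field_simp
  have h2 : ∀ θ : ℝ, u (x, θ) * starRingEnd ℂ (h (x, θ)) =
      u (x, θ) * Complex.exp (-(Complex.I * k * θ)) * starRingEnd ℂ (h (x, 0)) := fun θ => by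
    rw [hk x hx θ, map_mul, star_exp_I_mul]; ring
  simp_rw [h1, h2]
  rw [intervalIntegral.integral_const, intervalIntegral.integral_mul_const, fourierCoef, sub_zero,
    Complex.real_smul]
  have := Real.pi_ne_zero
  push_cast
  field_simp

theorem integrableOn_iterated {F : PhasePoint → ℂ} (hF : Integrable F S.vol) :
    IntegrableOn (fun x => Real.exp (2 * S.lam x) • ∫ θ in (0 : ℝ)..(2 * Real.pi), F (x, θ))
      S.carrier := by
  have hm : Measurable fun p : PhasePoint => Real.toNNReal (Real.exp (2 * S.lam p.1)) := by
    have := S.lam_smooth.continuous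
    exact (by fun_prop : Continuous fun p : PhasePoint => Real.exp (2 * S.lam p.1)).measurable.real_toNNReal
  have hi : Integrable (fun p : PhasePoint => Real.exp (2 * S.lam p.1) • F p)
      ((volume.restrict S.carrier).prod (volume.restrict (Ioc 0 (2 * Real.pi)))) := by
    have := (integrable_withDensity_iff_integrable_smul
      (μ := volume.restrict (S.carrier ×ˢ Ioc 0 (2 * Real.pi))) hm (g := F)).1 hF
    rw [Measure.prod_restrict, ← Measure.volume_eq_prod]
    refine this.congr (Eventually.of_forall fun p => ?_)
    simp only [NNReal.smul_def, Real.coe_toNNReal _ (Real.exp_pos _).le]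
  refine hi.integral_prod_left.congr (Eventually.of_forall fun x => ?_)
  simp only
  rw [intervalIntegral.integral_of_le (by positivity), integral_smul]

theorem mul_exp_mem_OmegaC {φ : ℝ × ℝ → ℝ} (hφ : ContDiff ℝ ∞ φ) (hc : HasCompactSupport φ)
    (hs : tsupport φ ⊆ S.inner) (k : ℤ) :
    (fun p : PhasePoint => (φ p.1 : ℂ) * Complex.exp (Complex.I * k * p.2)) ∈ S.OmegaC k := by
  have h1 : ContDiff ℝ ∞ fun p : PhasePoint => (φ p.1 : ℂ) :=
    Complex.ofRealCLM.contDiff.comp (hφ.comp contDiff_fst)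
  have h2 : ContDiff ℝ ∞ fun p : PhasePoint => (p.2 : ℂ) :=
    Complex.ofRealCLM.contDiff.comp contDiff_snd
  have h3 : ContDiff ℝ ∞ fun p : PhasePoint => (φ p.1 : ℂ) * Complex.exp (Complex.I * k * p.2) :=
    h1.mul (contDiff_const.mul h2).cexp
  refine ⟨⟨⟨h3.contDiffOn, fun p _ => ?_⟩, fun p hp => ?_⟩, tsupport φ, hs, hc, fun p _ hp => ?_⟩
  · have : Complex.exp (Complex.I * k * ((p.2 + 2 * Real.pi : ℝ) : ℂ)) =
        Complex.exp (Complex.I * k * p.2) := by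
      rw [Complex.exp_eq_exp_iff_exists_int]
      exact ⟨k, by push_cast; ring⟩
    simp only [this]
  · have hd := h3.differentiable (by simp) p
    unfold vert
    rw [hd.fderivWithin (S.uniqueDiffOn_SM p hp)]
    have hline : HasDerivAt (fun θ : ℝ => ((p.1, θ) : PhasePoint)) ((0 : ℝ × ℝ), (1 : ℝ)) p.2 :=
      (hasDerivAt_const _ _).prodMk (hasDerivAt_id _)
    have e1 := hd.hasFDerivAt.comp_hasDerivAt p.2 hline
    have e0 : HasDerivAt (fun θ : ℝ => Complex.I * k * (θ : ℂ)) (Complex.I * k * 1) p.2 :=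
      (Complex.ofRealCLM.hasDerivAt (x := p.2)).const_mul (Complex.I * k)
    have e2 := e0.cexp.const_mul (φ p.1 : ℂ)
    refine (e1.unique e2).trans ?_
    ring
  · simp only [image_eq_zero_of_notMem_tsupport hp, Complex.ofReal_zero, zero_mul]

theorem inner_eq_pairing (F G : Lp ℂ 2 S.vol) : Inner.inner ℂ F G = S.pairing G F := by
  rw [L2.inner_def]
  rfl

theorem pairing_congr {u u' v v' : PhasePoint → ℂ} (hu : u =ᵐ[S.vol] u') (hv : v =ᵐ[S.vol] v') :
    S.pairing u v = S.pairing u' v' := by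
  refine integral_congr_ae ?_
  filter_upwards [hu, hv] with p h1 h2
  rw [h1, h2]

theorem memLp_of_mem_OmegaC {k : ℤ} {f : PhasePoint → ℂ} (hf : f ∈ S.OmegaC k) : MemLp f 2 S.vol :=
  memLp_of_continuousOn (contDiffOn_of_mem_Omega hf.1).continuousOn

/-- The square integrable functions of the form `e^{ikθ} b(x)` belong to `H_k`. -/
theorem exists_represents {k : ℤ} {v : PhasePoint → ℂ} {b : ℝ × ℝ → ℂ} (hv : MemLp v 2 S.vol)
    (hb : ∀ p ∈ S.innerSM, v p = Complex.exp (Complex.I * k * p.2) * b p.1) :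
    ∃ F : S.H k, S.Represents F v := by
  refine ⟨⟨hv.toLp v, ?_⟩, hv.coeFn_toLp⟩
  -- The closure is treated as a double orthogonal complement: it suffices that `v` is orthogonal to
  -- every `G` orthogonal to the test functions.
  rw [H, ← Submodule.orthogonal_orthogonal_eq_closure, Submodule.mem_orthogonal]
  intro G hG
  rw [Submodule.mem_orthogonal] at hG
  have hGL : MemLp G 2 S.vol := Lp.memLp G
  have hpair : ∀ f ∈ S.OmegaC k, S.pairing G f = 0 := fun f hf => by
    have hfL := memLp_of_mem_OmegaC hf
    have := hG (hfL.toLp f) (Submodule.subset_span ⟨f, hf, hfL.coeFn_toLp⟩)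
    rw [inner_eq_pairing] at this
    rw [← this]
    exact pairing_congr (ae_eq_refl _) hfL.coeFn_toLp.symm
  let e : PhasePoint → ℂ := fun p => Complex.exp (Complex.I * k * p.2)
  have heL : MemLp e 2 S.vol := memLp_of_continuousOn (by fun_prop)
  -- Up to the weight and a constant this is the `k`-th Fourier coefficient of `G`. Orthogonality to
  -- all `φ(x) e^{ikθ}` forces it to vanish almost everywhere, and the pairing of `G` with `v` is
  -- the integral of it against `conj b`.
  let γ : ℝ × ℝ → ℂ := fun x => Real.exp (2 * S.lam x) •
    ∫ θ in (0 : ℝ)..(2 * Real.pi), (G : PhasePoint → ℂ) (x, θ) * starRingEnd ℂ (e (x, θ))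
  have hγ : IntegrableOn γ S.carrier := integrableOn_iterated (MemLp.integrable_mul_star hGL heL)
  have hγ0 : ∀ᵐ x, x ∈ S.inner → γ x = 0 := by
    refine S.isOpen_inner.ae_eq_zero_of_integral_contDiff_smul_eq_zero
      (hγ.mono_set S.inner_subset_carrier).locallyIntegrableOn fun φ hφ hc hs => ?_
    have h0 := hpair _ (mul_exp_mem_OmegaC hφ hc hs k)
    unfold pairing at h0
    rw [integral_vol_eq_iterated (MemLp.integrable_mul_star hGL
      (memLp_of_mem_OmegaC (mul_exp_mem_OmegaC hφ hc hs k)))] at h0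
    rw [← h0, ← setIntegral_eq_integral_of_forall_compl_eq_zero (s := S.carrier)]
    · refine setIntegral_congr_fun S.isClosed_carrier.measurableSet fun x _ => ?_
      have h1 : ∀ θ : ℝ, (G : PhasePoint → ℂ) (x, θ) * starRingEnd ℂ
          ((φ x : ℂ) * Complex.exp (Complex.I * k * θ)) =
          φ x * ((G : PhasePoint → ℂ) (x, θ) * starRingEnd ℂ (e (x, θ))) := fun θ => by
        rw [map_mul, Complex.conj_ofReal]
        simp only [e]
        ring
      simp only [γ]
      simp_rw [h1]
      rw [intervalIntegral.integral_const_mul]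
      simp only [Complex.real_smul]
      ring
    · intro x hx
      rw [image_eq_zero_of_notMem_tsupport fun h => hx (S.inner_subset_carrier (hs h)), zero_smul]
  rw [inner_eq_pairing, ← pairing_star, pairing_congr (ae_eq_refl _) hv.coeFn_toLp]
  unfold pairing
  rw [integral_vol_eq_iterated (MemLp.integrable_mul_star hGL hv), map_eq_zero]
  refine integral_eq_zero_of_ae ?_
  filter_upwards [S.ae_mem_inner, ae_restrict_of_ae hγ0] with x hx hx0
  have h1 : ∀ θ : ℝ, (G : PhasePoint → ℂ) (x, θ) * starRingEnd ℂ (v (x, θ)) =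
      (G : PhasePoint → ℂ) (x, θ) * starRingEnd ℂ (e (x, θ)) * starRingEnd ℂ (b x) := fun θ => by
    rw [hb (x, θ) hx, map_mul, ← mul_assoc]
  simp_rw [h1]
  rw [intervalIntegral.integral_mul_const, ← smul_mul_assoc]
  change γ x * _ = 0
  rw [hx0 hx, zero_mul]

/-- The difference lies both in the closure of the span of the test functions and in its orthogonal
complement, hence is zero. -/
theorem eq_of_forall_inner_OmegaC {k : ℤ} {P Q : S.H k}
    (h : ∀ f ∈ S.OmegaC k, ∀ F : S.H k, S.Represents F f → Inner.inner ℂ P F = Inner.inner ℂ Q F) : P = Q := by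
  rw [← sub_eq_zero, ← Submodule.coe_eq_zero]
  set K := Submodule.span ℂ {F : Lp ℂ 2 S.vol | ∃ f ∈ S.OmegaC k, F =ᵐ[S.vol] f} with hK
  have hmem : ((P - Q : S.H k) : Lp ℂ 2 S.vol) ∈ Kᗮᗮ := by
    rw [Submodule.orthogonal_orthogonal_eq_closure]; exact (P - Q).2
  have horth : ((P - Q : S.H k) : Lp ℂ 2 S.vol) ∈ Kᗮ := by
    rw [Submodule.mem_orthogonal']
    intro u hu
    induction hu using Submodule.span_induction with
    | mem u hu =>
      obtain ⟨f, hf, huf⟩ := hu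
      have := h f hf ⟨u, Submodule.le_topologicalClosure _ (Submodule.subset_span ⟨f, hf, huf⟩)⟩ huf
      rw [Submodule.coe_sub, inner_sub_left, sub_eq_zero]
      simpa using this
    | zero => simp
    | add u v _ _ hu hv => rw [inner_add_right, hu, hv, add_zero]
    | smul a u _ hu => rw [inner_smul_right, hu, mul_zero]
  exact inner_self_eq_zero.1 ((Submodule.mem_orthogonal _ _).1 hmem _ horth)

end IsothermalSurface

/-! ### The adjoint identity and the conclusion -/

namespace IsothermalSurface

variable {S : IsothermalSurface}

namespace FlowData

theorem continuousOn_Xperp_transport (D : S.FlowData) (hnt : S.NonTrapping)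
    (hconv : S.StrictlyConvexBoundary) {f : PhasePoint → ℂ} (hf : ContDiffOn ℝ 1 f S.SM) :
    ContinuousOn (S.Xperp (S.transport f)) S.innerSM :=
  ((D.continuousOn_dTransport hnt hconv hf).clm_apply
    S.contDiff_transverseField.continuous.continuousOn).congr fun _ hp =>
      Xperp_eq_of_hasFDerivAt hp (D.hasFDerivAt_transport hnt hconv hf hp)

/-- Moving `X_⊥` and moving the transport operator each cost a sign, and the signs cancel. The
parities `(-1)^k` of `f` and `-(-1)^k` of `X_⊥ h` are those required by the second step. -/
theorem pairing_adjoint (D : S.FlowData) (hnt : S.NonTrapping)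
    (hconv : S.StrictlyConvexBoundary) {k : ℤ} {f h : PhasePoint → ℂ} (hf : f ∈ S.Omega k)
    (hh : h ∈ S.OmegaZero k) :
    S.pairing f (S.transport (S.Xperp h)) = S.pairing (S.Xperp (S.transport f)) h := by
  have hf1 := contDiffOn_of_mem_Omega hf
  have hh1 := contDiffOn_of_mem_Omega hh.1
  have hsq : ((-1 : ℂ) ^ k) * (-1) ^ k = 1 := by
    rw [← mul_zpow]; simp
  rw [D.pairing_Xperp_transport hnt hconv hf1 hf.1.2 hh1 hh.1.1.2 hh.2]
  refine D.pairing_transport hnt hconv hf1 hf.1.2 (contDiffOn_Xperp hh.1.1)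
    (fun p hp => Xperp_add_period (differentiableOn_of_mem_Omega hh.1) hh.1.1.2 hp) hsq
    (fun p hp => flip_of_mem_Omega hf hp) fun p hp => ?_
  rw [Xperp_flip hh.1 hp]
  simp

end FlowData

namespace Agrees

variable {S' : IsothermalSurface}

theorem innerSM (h : Agrees S S') : S'.innerSM = S.innerSM := by
  simp only [IsothermalSurface.innerSM, h.inner]

theorem pairing (h : Agrees S S') : S'.pairing = S.pairing := by
  funext u v; simp only [IsothermalSurface.pairing, h.vol]

theorem outflow (h : Agrees S S') : S'.outflow = S.outflow := by
  ext p
  simp only [IsothermalSurface.outflow, h.bdry]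
  refine and_congr_right fun hp => ?_
  rw [h.lieX_rhoLift (show 0 ≤ S.rho p.1 from (show S.rho p.1 = 0 from hp).ge)]

theorem isTransportSolution (h : Agrees S S') : S'.IsTransportSolution = S.IsTransportSolution := by
  funext f u
  simp only [IsTransportSolution, h.isGeodesicArc, h.outflow]

end Agrees

/-- The analytic properties of the transport operator on a non-trapping surface with strictly convex
boundary. -/
theorem transport_properties (hnt : S.NonTrapping) (hconv : S.StrictlyConvexBoundary) :
    (∀ f : PhasePoint → ℂ, ContinuousOn f S.SM →
      S.IsTransportSolution f (S.transport f) ∧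
      (∀ u, S.IsTransportSolution f u → EqOn u (S.transport f) S.SM) ∧
      ContinuousOn (S.transport f) S.innerSM ∧ MemLp (S.transport f) 2 S.vol) ∧
    (∀ f : PhasePoint → ℂ, ContDiffOn ℝ 1 f S.SM →
      (∀ p ∈ S.innerSM, DifferentiableAt ℝ (S.transport f) p) ∧
      ContinuousOn (S.Xperp (S.transport f)) S.innerSM ∧
      MemLp (S.Xperp (S.transport f)) 2 S.vol) ∧
    ∀ (k : ℤ), ∀ f ∈ S.Omega k, ∀ h ∈ S.OmegaZero k,
      S.pairing f (S.transport (S.Xperp h)) = S.pairing (S.Xperp (S.transport f)) h := by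
  -- The flow exists for the surface with truncated conformal factor. All objects in the conclusions
  -- coincide for the two surfaces, so the results are rewritten back.
  obtain ⟨S', hS, hc⟩ := S.exists_agrees
  obtain ⟨D⟩ := S'.nonempty_flowData hc
  have hnt' := hS.nonTrapping hnt
  have hconv' := hS.strictlyConvexBoundary hconv
  have h1 : ∀ f : PhasePoint → ℂ, ContinuousOn f S'.SM →
      S'.IsTransportSolution f (S'.transport f) ∧
      (∀ u, S'.IsTransportSolution f u → EqOn u (S'.transport f) S'.SM) ∧
      ContinuousOn (S'.transport f) S'.innerSM ∧ MemLp (S'.transport f) 2 S'.vol := fun f hf =>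
    ⟨D.isTransportSolution hnt' hconv' hf, fun u hu =>
      D.eqOn_of_isTransportSolution hnt' hu (D.isTransportSolution hnt' hconv' hf),
      D.continuousOn_transport hnt' hconv' hf, D.memLp_transport hnt' hconv' hf⟩
  have h2 : ∀ f : PhasePoint → ℂ, ContDiffOn ℝ 1 f S'.SM →
      (∀ p ∈ S'.innerSM, DifferentiableAt ℝ (S'.transport f) p) ∧
      ContinuousOn (S'.Xperp (S'.transport f)) S'.innerSM ∧
      MemLp (S'.Xperp (S'.transport f)) 2 S'.vol := fun f hf =>
    ⟨fun p hp => (D.hasFDerivAt_transport hnt' hconv' hf hp).differentiableAt,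
      D.continuousOn_Xperp_transport hnt' hconv' hf, D.memLp_Xperp_transport hnt' hconv' hf⟩
  have h3 : ∀ (k : ℤ), ∀ f ∈ S'.Omega k, ∀ h ∈ S'.OmegaZero k,
      S'.pairing f (S'.transport (S'.Xperp h)) = S'.pairing (S'.Xperp (S'.transport f)) h :=
    fun k f hf h hh => D.pairing_adjoint hnt' hconv' hf hh
  simp only [hS.isTransportSolution, hS.transport, hS.SM, hS.innerSM, hS.vol, hS.xperp, hS.pairing,
    hS.omega, hS.omegaZero] at h1 h2 h3
  exact ⟨h1, h2, h3⟩

theorem continuous_circle {u : PhasePoint → ℂ} (hu : ContinuousOn u S.innerSM) {x : ℝ × ℝ}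
    (hx : x ∈ S.inner) : Continuous fun θ : ℝ => u (x, θ) :=
  continuousOn_univ.1 (hu.comp (f := fun θ : ℝ => (x, θ)) (by fun_prop) fun _ _ => hx)

end IsothermalSurface
theorem proposition5p5 (S : IsothermalSurface) (hnt : S.NonTrapping)
    (hconv : S.StrictlyConvexBoundary) (k : ℤ) :
    -- `u^f` is the unique solution of the transport problem
    (∀ f : PhasePoint → ℂ, ContinuousOn f S.SM →
      S.IsTransportSolution f (S.transport f) ∧
      ∀ u, S.IsTransportSolution f u → EqOn u (S.transport f) S.SM) ∧
    -- `W_k` is well defined on `Ω_k`, with values in `H_k`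
    (∀ f ∈ S.Omega k,
      (∀ x ∈ S.inner, ∀ θ : ℝ, DifferentiableAt ℝ (S.transport f) (x, θ)) ∧
      (∀ x ∈ S.inner, Continuous fun θ : ℝ => S.Xperp (S.transport f) (x, θ)) ∧
      (∃ F : S.H k, S.Represents F f) ∧ ∃ F : S.H k, S.Represents F (S.W k f)) ∧
    -- `W_k^*` is well defined on the elements of `Ω_k` that vanish on `∂M`, with values in `H_k`
    (∀ h ∈ S.OmegaZero k,
      (∀ x ∈ S.inner, Continuous fun θ : ℝ => S.transport (S.Xperp h) (x, θ)) ∧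
      ∃ F : S.H k, S.Represents F (S.Wstar k h)) ∧
    -- `(f, W_k^* h) = (W_k f, h)`
    (∀ f ∈ S.Omega k, ∀ h ∈ S.OmegaZero k,
      Integrable (fun p => f p * starRingEnd ℂ (S.Wstar k h p)) S.vol ∧
      Integrable (fun p => S.W k f p * starRingEnd ℂ (h p)) S.vol ∧
      S.pairing f (S.Wstar k h) = S.pairing (S.W k f) h) ∧
    -- the Hilbert space adjoint of every bounded extension of `W_k` to `H_k` extends `W_k^*`
    (∀ T : S.H k →L[ℂ] S.H k,
      (∀ f ∈ S.OmegaC k, ∀ F : S.H k, S.Represents F f → S.Represents (T F) (S.W k f)) →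
      ∀ h ∈ S.OmegaZero k, ∀ G : S.H k, S.Represents G h →
        S.Represents (ContinuousLinearMap.adjoint T G) (S.Wstar k h)) := by
  open IsothermalSurface in
  obtain ⟨htr, hder, hpair⟩ := transport_properties hnt hconv
  have hW : ∀ f ∈ S.Omega k, MemLp (S.W k f) 2 S.vol := fun f hf =>
    have h := hder f (contDiffOn_of_mem_Omega hf)
    memLp_fourierComp h.2.1 h.2.2 k
  have hWs : ∀ h ∈ S.OmegaZero k, MemLp (S.Wstar k h) 2 S.vol := fun h hh =>
    have h1 := htr _ (contDiffOn_Xperp hh.1.1).continuousOn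
    memLp_fourierComp h1.2.2.1 h1.2.2.2 k
  have hL : ∀ f ∈ S.Omega k, MemLp f 2 S.vol := fun f hf =>
    memLp_of_continuousOn (contDiffOn_of_mem_Omega hf).continuousOn
  have hadj : ∀ f ∈ S.Omega k, ∀ h ∈ S.OmegaZero k,
      S.pairing f (S.Wstar k h) = S.pairing (S.W k f) h := fun f hf h hh => by
    have h1 := htr _ (contDiffOn_Xperp hh.1.1).continuousOn
    have h2 := hder f (contDiffOn_of_mem_Omega hf)
    -- Both `f` and `h` consist of the single mode `k`, so the projections in `W_k` and `W_k^*` can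
    -- be dropped inside the pairings.
    have e1 : S.pairing (S.Wstar k h) f = S.pairing (S.transport (S.Xperp h)) f :=
      pairing_fourierComp h1.2.2.1 h1.2.2.2 (hL f hf) fun x hx θ => eq_exp_mul_of_mem_Omega hf hx θ
    have e2 : S.pairing (S.W k f) h = S.pairing (S.Xperp (S.transport f)) h :=
      pairing_fourierComp h2.2.1 h2.2.2 (hL h hh.1) fun x hx θ => eq_exp_mul_of_mem_Omega hh.1 hx θ
    rw [e2, ← hpair k f hf h hh, ← pairing_star, e1, pairing_star]
  have hWsH : ∀ h ∈ S.OmegaZero k, ∃ F : S.H k, S.Represents F (S.Wstar k h) := fun h hh =>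
    exists_represents (hWs h hh) fun p _ => fourierComp_eq k _ p
  refine ⟨fun f hf => ⟨(htr f hf).1, (htr f hf).2.1⟩, fun f hf => ?_, fun h hh => ?_,
    fun f hf h hh => ?_, fun T hT h hh G hG => ?_⟩
  · have h := hder f (contDiffOn_of_mem_Omega hf)
    exact ⟨fun x hx θ => h.1 (x, θ) hx, fun x hx => continuous_circle h.2.1 hx,
      exists_represents (b := fun x => f (x, 0)) (hL f hf) fun p hp =>
        eq_exp_mul_of_mem_Omega hf (S.inner_subset_carrier hp) p.2,
      exists_represents (hW f hf) fun p _ => fourierComp_eq k _ p⟩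
  · exact ⟨fun x hx => continuous_circle (htr _ (contDiffOn_Xperp hh.1.1).continuousOn).2.2.1 hx,
      hWsH h hh⟩
  · exact ⟨MemLp.integrable_mul_star (hL f hf) (hWs h hh),
      MemLp.integrable_mul_star (hW f hf) (hL h hh.1), hadj f hf h hh⟩
  · obtain ⟨P, hP⟩ := hWsH h hh
    -- Both sides lie in `H_k`, so it suffices to test against compactly supported elements, where
    -- the bounded operator is given by `W_k` and the pairing identity applies.
    have : ContinuousLinearMap.adjoint T G = P := by
      refine eq_of_forall_inner_OmegaC fun f hf F hF => ?_
      have hTF := hT f hf F hF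
      rw [ContinuousLinearMap.adjoint_inner_left, Submodule.coe_inner, Submodule.coe_inner,
        inner_eq_pairing, inner_eq_pairing, pairing_congr hTF hG, pairing_congr hF hP]
      exact (hadj f hf.1 h hh).symm
    rw [this]
    exact hP
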